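/- **Conventions.** $\langle\xi\rangle=(1+|\xi|^2)^{1/2}$, and $\widehat f(\xi)=(2\pi)^{-d/2}\int_{\mathbf R^d} f(x)e^{-i\langle x,\xi\rangle}\,dx$, extended to $\mathscr S'(\mathbf R^d)$. *Weights.* $\mathscr P(\mathbf R^n)$ is the set of positive measurable functions $\omega$ on $\mathbf R^n$ such that, for some polynomial $p$ and constant $C$, $\omega(x+y)\le C\omega(x)p(y)$ for all $x,y$. For $\rho\in\mathbf R$, $\mathscr P_{\rho,0}(\mathbf R^{2d})$ is the set of smooth $\omega_0\in\mathscr P(\mathbf R^{2d})$ such that $\langle\xi\rangle^{\rho|\beta|}(\partial_x^\alpha\partial_\xi^\beta\omega_0)(x,\xi)/\omega_0(x,\xi)$ is bounded for all multi-indices $\alpha,\beta$, and $S^{(\omega_0)}_{\rho,0}(\mathbf R^{2d})$ is the set of $a\in C^\infty(\mathbf R^{2d})$ with $|\partial_x^\alpha\partial_\xi^\beta a(x,\xi)|\le C_{\alpha,\beta}\,\omega_0(x,\xi)\langle\xi\rangle^{-\rho|\beta|}$ for all $\alpha,\beta$. *Operators.* For $f\in\mathscr S(\mathbf R^d)$,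 $\operatorname{Op}(a)f(x)=(2\pi)^{-d}\iint a(x,\xi)f(y)e^{i\langle x-y,\xi\rangle}\,dy\,d\xi$; on $\mathscr S'(\mathbf R^d)$, $\operatorname{Op}(a)$ denotes the unique continuous extension of this operator. *BF-spaces.* A translation invariant BF-space on $\mathbf R^d$ is a Banach space $\mathscr B$ of complex-valued measurable functions on $\mathbf R^d$ (modulo equality a.e.) for which there are an even weight $v\in\mathscr P(\mathbf R^d)$ that is submultiplicative ($v(x+y)\le C v(x)v(y)$) and a constant $C$ such that (i) $\mathscr S(\mathbf R^d)\subseteq\mathscr B\subseteq\mathscr S'(\mathbf R^d)$ with continuous embeddings; (ii) if $x\in\mathbf R^d$ and $f\in\mathscr B$, then $f(\cdot-x)\in\mathscr B$ and $\|f(\cdot-x)\|_{\mathscr B}\le Cv(x)\|f\|_{\mathscr B}$; (iii) if $f,g\in L^1_{loc}$, $g\in\mathscr B$ and $|f|\le|g|$ a.e., then $f\in\mathscr B$ and $\|f\|_{\mathscr B}\le C\|g\|_{\mathscr B}$. *Seminorms and wave-front sets.* For $\omega\in\mathscr P(\mathbf R^{2d})$, $x\in\mathbf R^d$ and an open cone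 $\Gamma\subseteq\mathbf R^d\setminus 0$, let $|f|_{\mathscr{FB}(\omega,\Gamma)_x}=\|\widehat f\,\omega(x,\cdot)\,\chi_\Gamma\|_{\mathscr B}$, with the value $+\infty$ if $\widehat f\,\omega(x,\cdot)\chi_\Gamma\notin\mathscr B$ or if $\widehat f$ is not a locally integrable function. Let $\Sigma_{\mathscr{FB}(\omega)_x}(f)$ be the set of $\xi\in\mathbf R^d\setminus0$ such that $|f|_{\mathscr{FB}(\omega,\Gamma)_x}=\infty$ for every open cone $\Gamma\ni\xi$, and let $\operatorname{WF}_{\mathscr{FB}(\omega)_x}(f)$ be the set of $(x_0,\xi_0)\in\mathbf R^d\times(\mathbf R^d\setminus 0)$ such that $\xi_0\in\Sigma_{\mathscr{FB}(\omega)_x}(\varphi f)$ for every $\varphi\in C_0^\infty(\mathbf R^d)$ with $\varphi(x_0)\ne0$. (Finiteness of the seminorm and the wave-front set do not depend on the choice of $x$.) **Proposition.** Let $\rho>0$, $\omega\in\mathscr P(\mathbf R^{2d})$, $\omega_0\in\mathscr P_{\rho,0}(\mathbf R^{2d})$, $a\in S^{(\omega_0)}_{\rho,0}(\mathbf R^{2d})$,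 and let $\mathscr B$ be a translation invariant BF-space on $\mathbf R^d$. Then the operator $\operatorname{Op}(a)$ on $\mathscr S'(\mathbf R^d)$ is well defined: it maps $\mathscr S(\mathbf R^d)$ into itself and has a unique continuous extension to $\mathscr S'(\mathbf R^d)$. Moreover, for every $f\in\mathscr E'(\mathbf R^d)$ (a compactly supported distribution) and all $x,y\in\mathbf R^d$: 1. if $\Gamma_1,\Gamma_2\subseteq\mathbf R^d\setminus0$ are open cones such that the closure of $\Gamma_2$ in $\mathbf R^d\setminus 0$ is contained in $\Gamma_1$, and $|f|_{\mathscr{FB}(\omega,\Gamma_1)_x}<\infty$, then $|\operatorname{Op}(a)f|_{\mathscr{FB}(\omega/\omega_0,\Gamma_2)_y}<\infty$; 2. $\operatorname{WF}_{\mathscr{FB}(\omega/\omega_0)_y}(\operatorname{Op}(a)f)\subseteq\operatorname{WF}_{\mathscr{FB}(\omega)_x}(f)$. -/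

import Mathlib

open MeasureTheory SchwartzMap
open scoped ENNReal FourierTransform

namespace FourierBanach

/-- The Euclidean space `ℝ^d`. -/
abbrev E (d : ℕ) : Type := EuclideanSpace ℝ (Fin d)

/-! ### Weights -/

/-- `ω` is `v`-moderate: `ω (x + y) ≤ C ω x v y`. -/
def IsModerate {F : Type*} [Add F] (ω v : F → ℝ) : Prop :=
  ∃ C : ℝ, ∀ x y, ω (x + y) ≤ C * ω x * v y

/-- The class `𝒫` of polynomially moderate weights: positive measurable functions which are moderate
with respect to some polynomial, i.e. with respect to a power of `1 + |y|²`.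
(Local boundedness follows from the moderateness.) -/
structure IsWeight {F : Type*} [NormedAddCommGroup F] [MeasurableSpace F] (ω : F → ℝ) : Prop where
  pos : ∀ x, 0 < ω x
  measurable : Measurable ω
  moderate : ∃ N : ℕ, IsModerate ω (fun y => (1 + ‖y‖ ^ 2) ^ N)

/-- `⟨ξ⟩ = (1 + |ξ|²)^{1/2}`. -/
noncomputable def bracket {d : ℕ} (ξ : E d) : ℝ := Real.sqrt (1 + ‖ξ‖ ^ 2)

/-- The size at `(x, ξ)` of the collection of all mixed derivatives `∂_x^α ∂_ξ^β a`
with `|α| = m` and `|β| = n`. -/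
noncomputable def mixedDeriv {d : ℕ} {G : Type*} [NormedAddCommGroup G] [NormedSpace ℝ G]
    (m n : ℕ) (a : E d × E d → G) (x ξ : E d) : ℝ :=
  ‖iteratedFDeriv ℝ m (fun x' => iteratedFDeriv ℝ n (fun ξ' => a (x', ξ')) ξ) x‖

/-- The class `𝒫_{ρ,δ}` of smooth weights `ω` on phase space such that
`⟨ξ⟩^{ρ|β| - δ|α|} (∂_x^α ∂_ξ^β ω) / ω` is bounded for all `α`, `β`. -/
structure IsSymbolWeight {d : ℕ} (ρ δ : ℝ) (ω : E d × E d → ℝ) : Prop where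
  weight : IsWeight ω
  smooth : ContDiff ℝ (⊤ : ℕ∞) ω
  bound : ∀ m n : ℕ, ∃ C : ℝ, ∀ x ξ,
    mixedDeriv m n ω x ξ ≤ C * ω (x, ξ) * bracket ξ ^ (-ρ * n + δ * m)

/-- The symbol class `S^{(ω₀)}_{ρ,δ}`. -/
structure IsSymbol {d : ℕ} (ρ δ : ℝ) (ω₀ : E d × E d → ℝ) (a : E d × E d → ℂ) : Prop where
  smooth : ContDiff ℝ (⊤ : ℕ∞) a
  bound : ∀ m n : ℕ, ∃ C : ℝ, ∀ x ξ,
    mixedDeriv m n a x ξ ≤ C * ω₀ (x, ξ) * bracket ξ ^ (-ρ * n + δ * m)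

/-! ### Distributions given by functions, and the Fourier transform -/

/-- The tempered distribution `u` is (integration against) the locally integrable function `g`. -/
def IsGivenBy {d : ℕ} (u : 𝓢'(E d, ℂ)) (g : E d → ℂ) : Prop :=
  LocallyIntegrable g ∧
    ∀ φ : 𝓢(E d, ℂ), HasCompactSupport φ → u φ = ∫ y, g y * φ y

/-- Dilation by `(2π)⁻¹` on `ℝ^d`. -/
noncomputable def dilation (d : ℕ) : E d ≃L[ℝ] E d :=
  ContinuousLinearEquiv.smulLeft
    (Units.mk0 ((2 * Real.pi)⁻¹ : ℝ) (inv_ne_zero (by positivity)))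

/-- The Fourier transform `φ̂(ξ) = (2π)^{-d/2} ∫ φ(x) e^{-i⟨x,ξ⟩} dx` on Schwartz functions, obtained
from Mathlib's transform (with kernel `e^{-2πi⟨x,ξ⟩}`) by rescaling; see `fourierS_apply`. -/
noncomputable def fourierS (d : ℕ) : 𝓢(E d, ℂ) →L[ℂ] 𝓢(E d, ℂ) :=
  (((2 * Real.pi) ^ (-(d : ℝ) / 2) : ℝ) : ℂ) •
    (SchwartzMap.compCLMOfContinuousLinearEquiv ℂ (dilation d)).comp
      (FourierTransform.fourierCLM ℂ 𝓢(E d, ℂ))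

theorem fourierS_apply (d : ℕ) (φ : 𝓢(E d, ℂ)) (ξ : E d) :
    fourierS d φ ξ = (((2 * Real.pi) ^ (-(d : ℝ) / 2) : ℝ) : ℂ) *
      ∫ x, φ x * Complex.exp (-(Complex.I * (inner ℝ x ξ : ℝ))) := by
  have h : fourierS d φ ξ = (((2 * Real.pi) ^ (-(d : ℝ) / 2) : ℝ) : ℂ) *
      (𝓕 (φ : E d → ℂ)) ((2 * Real.pi)⁻¹ • ξ) := rfl
  rw [h, Real.fourier_eq']
  congr 1
  refine integral_congr_ae (Filter.Eventually.of_forall fun x => ?_)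
  simp only [inner_smul_right, smul_eq_mul]
  rw [mul_comm]
  congr 2
  have : (Real.pi : ℂ) ≠ 0 := by exact_mod_cast Real.pi_ne_zero
  push_cast
  field_simp

/-- The Fourier transform on tempered distributions, `⟨û, φ⟩ = ⟨u, φ̂⟩`. -/
noncomputable def fourierT {d : ℕ} (u : 𝓢'(E d, ℂ)) : 𝓢'(E d, ℂ) :=
  PointwiseConvergenceCLM.precomp ℂ (fourierS d) u

/-! ### Translation invariant Banach function spaces

A Banach space `ℬ` of measurable functions on `ℝ^d` (modulo equality a.e.) is modelled by a Banach
space `B` with an injective linear map `ι` into the space of a.e. classes of measurable functions. -/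

/-- `(B, ι)` is a translation invariant BF-space with respect to the weight `v`. -/
structure IsInvariantBFSpace {d : ℕ} {B : Type*} [NormedAddCommGroup B] [NormedSpace ℂ B]
    [CompleteSpace B] (ι : B →ₗ[ℂ] (E d →ₘ[volume] ℂ)) (v : E d → ℝ) : Prop where
  weight : IsWeight v
  submultiplicative : IsModerate v v
  even : ∀ x, v (-x) = v x
  injective : Function.Injective ι
  /-- `𝓢 ⊆ ℬ` continuously. -/
  schwartz_embedding : ∃ J : 𝓢(E d, ℂ) →L[ℂ] B, ∀ φ, ι (J φ) =ᵐ[volume] φ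
  /-- `ℬ ⊆ 𝓢'` continuously. -/
  tempered_embedding : ∃ T : B →L[ℂ] 𝓢'(E d, ℂ), ∀ b, IsGivenBy (T b) (ι b)
  /-- Invariance under translations. -/
  translation : ∃ C : ℝ, ∀ (x : E d) (b : B), ∃ b' : B,
    (ι b' =ᵐ[volume] fun y => ι b (y - x)) ∧ ‖b'‖ ≤ C * v x * ‖b‖
  /-- Solidity. -/
  solid : ∃ C : ℝ, ∀ (f : E d →ₘ[volume] ℂ) (g : B), LocallyIntegrable f →
    (∀ᵐ x, ‖f x‖ ≤ ‖ι g x‖) → ∃ b : B, ι b = f ∧ ‖b‖ ≤ C * ‖g‖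

/-! ### Fourier Banach seminorms and wave-front sets -/

/-- Open cones in `ℝ^d ∖ 0`. -/
structure IsOpenCone {d : ℕ} (Γ : Set (E d)) : Prop where
  isOpen : IsOpen Γ
  zero_notMem : (0 : E d) ∉ Γ
  smul_mem : ∀ t : ℝ, 0 < t → ∀ ξ ∈ Γ, t • ξ ∈ Γ

/-- `|f|_{ℱℬ(ω,Γ)_x} = ‖f̂ · ω(x, ·) · χ_Γ‖_ℬ ∈ [0, ∞]`. It is the norm of the unique `b ∈ B` that
represents `f̂ · ω(x, ·) · χ_Γ`, and `∞` if this product is not an element of `ℬ`. -/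
noncomputable def seminormFB {d : ℕ} {B : Type*} [NormedAddCommGroup B] [NormedSpace ℂ B]
    (ι : B →ₗ[ℂ] (E d →ₘ[volume] ℂ)) (ω : E d × E d → ℝ) (Γ : Set (E d)) (x : E d)
    (f : 𝓢'(E d, ℂ)) : ℝ≥0∞ :=
  ⨅ (b : B) (_ : ∃ g : E d → ℂ, IsGivenBy (fourierT f) g ∧
    ι b =ᵐ[volume] Γ.indicator (fun ξ => g ξ * (ω (x, ξ) : ℂ))), ‖b‖ₑ

/-- `Σ_{ℱℬ(ω)}(f)`: the directions `ξ ≠ 0` without an open conical neighbourhood on which the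
seminorm of `f` is finite. -/
def sigmaFB {d : ℕ} {B : Type*} [NormedAddCommGroup B] [NormedSpace ℂ B]
    (ι : B →ₗ[ℂ] (E d →ₘ[volume] ℂ)) (ω : E d × E d → ℝ) (x : E d) (f : 𝓢'(E d, ℂ)) :
    Set (E d) :=
  {ξ | ξ ≠ 0 ∧ ¬ ∃ Γ : Set (E d), IsOpenCone Γ ∧ ξ ∈ Γ ∧ seminormFB ι ω Γ x f < ⊤}

/-- The wave-front set `WF_{ℱℬ(ω)}(f)`, computed with the frozen weight `ω(x, ·)`. -/
def waveFrontFB {d : ℕ} {B : Type*} [NormedAddCommGroup B] [NormedSpace ℂ B]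
    (ι : B →ₗ[ℂ] (E d →ₘ[volume] ℂ)) (ω : E d × E d → ℝ) (x : E d) (f : 𝓢'(E d, ℂ)) :
    Set (E d × E d) :=
  {p | p.2 ≠ 0 ∧ ∀ φ : E d → ℂ, ContDiff ℝ (⊤ : ℕ∞) φ → HasCompactSupport φ → φ p.1 ≠ 0 →
    p.2 ∈ sigmaFB ι ω x (TemperedDistribution.smulLeftCLM ℂ φ f)}

/-! ### Pseudo-differential operators -/

/-- The Kohn-Nirenberg operator on Schwartz functions:
`(Op(a)φ)(x) = (2π)^{-d} ∬ a(x, ξ) φ(y) e^{i⟨x - y, ξ⟩} dy dξ`. -/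
noncomputable def opSchwartz {d : ℕ} (a : E d × E d → ℂ) (φ : 𝓢(E d, ℂ)) (x : E d) : ℂ :=
  ((((2 * Real.pi) ^ d)⁻¹ : ℝ) : ℂ) *
    ∫ ξ, ∫ y, a (x, ξ) * φ y * Complex.exp (Complex.I * (inner ℝ (x - y) ξ : ℝ))

/-- `A` is a continuous operator on `𝓢'` that extends `φ ↦ Op(a)φ`, `φ ∈ 𝓢`. -/
def ExtendsOp {d : ℕ} (a : E d × E d → ℂ) (A : 𝓢'(E d, ℂ) →L[ℂ] 𝓢'(E d, ℂ)) : Prop :=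
  ∀ φ : 𝓢(E d, ℂ), ∃ ψ : 𝓢(E d, ℂ), (∀ x, ψ x = opSchwartz a φ x) ∧
    A (SchwartzMap.toTemperedDistributionCLM (E d) ℂ volume φ) =
      SchwartzMap.toTemperedDistributionCLM (E d) ℂ volume ψ

end FourierBanach

/-! Let f be supported in a ball. Expanding test functions in a Fourier series on a large cube and
dualizing gives, for every shift ξ₀, f = c Σ_m F(ξ₀ - s_m) e^{i⟨x, ξ₀ - s_m⟩} χ(x). Here s_m runs
through a lattice, χ is a cutoff, and F is the smooth function f̂ up to a constant
(`hasSum_sampling_distribution`). The action of a continuous operator on f can therefore be read off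
from its action on the wave packets e^{i⟨x, η⟩} χ.

Op(a) sends such a packet to e^{i⟨x, η⟩} θ_η with θ_η = Op(a(·, · + η)) χ. Since ω₀ is moderate, the
translated symbol is of size ω₀(0, η), so every Schwartz seminorm of θ_η is O(ω₀(0, η))
(`IsSymbol.schwartzLocal`). The Fourier transform of the image packet is thus O(ω₀(0, η) (1 + |ξ -
η|)^{-N}) for all N (`FreqLocal`). With the choice ξ₀ = ξ, this bounds the Fourier transform of
Op(a)f at ξ by C ω₀(0, ξ) Σ_m (1 + |s_m|)^{-N} |F(ξ - s_m)| (`FreqLocal.exists_isGivenBy_le`). A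
lattice sum replaces the usual convolution integral: sums of translates with rapidly decaying
coefficients converge absolutely in the norm of ℬ, and no continuity of translations is needed.

Part 1 splits this sum for ξ ∈ Γ₂. If ξ - s_m ∈ Γ₁, moderateness of ω bounds the term by a translate
of the given element of ℬ. Otherwise |s_m| ≥ c|ξ|, and the coefficient beats the polynomial growth
of F and ω, leaving a high negative power of 1 + |ξ|, which ℬ dominates. Solidity concludes
(`FreqLocal.seminormFB_lt_top`).

Part 2 takes φ with φ(x₀) ≠ 0 for which φf is finite near ξ₀, a cutoff χ near x₀ inside {φ ≠ 0}, and
α supported where χ = 1. Then αOp(a)f = αOp(a)(χ/φ)(φf) + αOp(a)(1 - χ)f. The first term obeys the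
estimate of part 1. The second is smoothing by pseudo-locality: repeated integration by parts in the
frequency gains powers of ⟨ξ⟩^{-ρ}, and here ρ > 0 is essential (`IsSymbol.freqLocal_of_disjoint`).

The extension of Op(a) to 𝓢' is dual to its transpose, an operator of the same kind with the
variables of the amplitude exchanged. It is unique because weak-* continuous functionals on 𝓢' are
evaluations (`existsUnique_extendsOp`). -/

namespace FourierBanach

/-! ### Increasing norms on the Schwartz space -/

section SchwartzNorms

variable {D D' V V' : Type*} [NormedAddCommGroup D] [NormedSpace ℝ D]
  [NormedAddCommGroup D'] [NormedSpace ℝ D']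
  [NormedAddCommGroup V] [NormedSpace ℂ V] [NormedAddCommGroup V'] [NormedSpace ℂ V']

/-- The increasing family of norms on the Schwartz space. -/
noncomputable def schwartzSup (D V : Type*) [NormedAddCommGroup D] [NormedSpace ℝ D]
    [NormedAddCommGroup V] [NormedSpace ℂ V] (m : ℕ × ℕ) : Seminorm ℝ 𝓢(D, V) :=
  (Finset.Iic m).sup (schwartzSeminormFamily ℝ D V)

theorem schwartzSup_le {m : ℕ × ℕ} {f : 𝓢(D, V)} {M : ℝ} (hM : 0 ≤ M)
    (h : ∀ k ≤ m.1, ∀ n ≤ m.2, ∀ x, ‖x‖ ^ k * ‖iteratedFDeriv ℝ n f x‖ ≤ M) :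
    schwartzSup D V m f ≤ M := by
  refine Seminorm.finset_sup_apply_le hM fun i hi => ?_
  rw [Finset.mem_Iic] at hi
  exact SchwartzMap.seminorm_le_bound ℝ i.1 i.2 f hM (h i.1 hi.1 i.2 hi.2)

theorem one_add_pow_mul_le_schwartzSup {m : ℕ × ℕ} {k n : ℕ} (hk : k ≤ m.1) (hn : n ≤ m.2)
    (f : 𝓢(D, V)) (x : D) :
    (1 + ‖x‖) ^ k * ‖iteratedFDeriv ℝ n f x‖ ≤ 2 ^ m.1 * schwartzSup D V m f :=
  one_add_le_sup_seminorm_apply (𝕜 := ℝ) hk hn f x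

theorem one_add_pow_mul_norm_le_schwartzSup (k : ℕ) (f : 𝓢(D, V)) (x : D) :
    (1 + ‖x‖) ^ k * ‖f x‖ ≤ 2 ^ k * schwartzSup D V (k, 0) f := by
  simpa using one_add_pow_mul_le_schwartzSup (m := (k, 0)) le_rfl le_rfl f x

theorem pow_mul_le_schwartzSup {m : ℕ × ℕ} {k n : ℕ} (hk : k ≤ m.1) (hn : n ≤ m.2)
    (f : 𝓢(D, V)) (x : D) :
    ‖x‖ ^ k * ‖iteratedFDeriv ℝ n f x‖ ≤ schwartzSup D V m f :=
  (le_seminorm ℝ k n f x).trans (Seminorm.le_finset_sup_apply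
    (p := schwartzSeminormFamily ℝ D V) (i := (k, n)) (Finset.mem_Iic.2 ⟨hk, hn⟩))

theorem schwartzSup_mono {m m' : ℕ × ℕ} (h : m ≤ m') (f : 𝓢(D, V)) :
    schwartzSup D V m f ≤ schwartzSup D V m' f :=
  schwartzSup_le (apply_nonneg _ _) fun _ hk _ hn x =>
    pow_mul_le_schwartzSup (hk.trans h.1) (hn.trans h.2) f x

theorem continuous_schwartzSup (m : ℕ × ℕ) : Continuous (schwartzSup D V m) := by
  refine Seminorm.continuous_of_le (q := ∑ i ∈ Finset.Iic m, schwartzSeminormFamily ℝ D V i) ?_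
    (Seminorm.finset_sup_le_sum _ _)
  have : (⇑(∑ i ∈ Finset.Iic m, schwartzSeminormFamily ℝ D V i) : 𝓢(D, V) → ℝ) =
      fun f => ∑ i ∈ Finset.Iic m, schwartzSeminormFamily ℝ D V i f := by
    ext f
    exact map_sum (AddMonoidHom.mk' (fun p : Seminorm ℝ 𝓢(D, V) => p f) fun _ _ => rfl) _ _
  rw [this]
  exact continuous_finsetSum _ fun i _ => (schwartz_withSeminorms ℝ D V).continuous_seminorm i

/-- The norms increase with the index, so the finitely many seminorms that witness continuity can be
replaced by one norm, at the supremum of their indices. -/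
theorem exists_le_schwartzSup_of_continuous (q : Seminorm ℝ 𝓢(D, V)) (hq : Continuous q) :
    ∃ m : ℕ × ℕ, ∃ C : ℝ, 0 ≤ C ∧ ∀ f, q f ≤ C * schwartzSup D V m f := by
  obtain ⟨s, C, -, h⟩ := Seminorm.bound_of_continuous (schwartz_withSeminorms ℝ D V) q hq
  refine ⟨s.sup id, C, C.2, fun f => (h f).trans ?_⟩
  refine mul_le_mul_of_nonneg_left ?_ C.2
  refine Seminorm.finset_sup_apply_le (apply_nonneg _ _) fun i hi => ?_
  exact Seminorm.le_finset_sup_apply (p := schwartzSeminormFamily ℝ D V)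
    (Finset.mem_Iic.2 (Finset.le_sup (f := id) hi))

theorem exists_schwartzSup_map_le (L : 𝓢(D, V) →L[ℂ] 𝓢(D', V')) (m' : ℕ × ℕ) :
    ∃ m : ℕ × ℕ, ∃ C : ℝ, 0 ≤ C ∧
      ∀ f, schwartzSup D' V' m' (L f) ≤ C * schwartzSup D V m f :=
  exists_le_schwartzSup_of_continuous ((schwartzSup D' V' m').comp
    ((L.restrictScalars ℝ : 𝓢(D, V) →L[ℝ] 𝓢(D', V')) : 𝓢(D, V) →ₗ[ℝ] 𝓢(D', V')))
    ((continuous_schwartzSup m').comp L.continuous)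

theorem exists_norm_map_le (L : 𝓢(D, V) →L[ℂ] V') :
    ∃ m : ℕ × ℕ, ∃ C : ℝ, 0 ≤ C ∧ ∀ f, ‖L f‖ ≤ C * schwartzSup D V m f :=
  exists_le_schwartzSup_of_continuous ((normSeminorm ℝ V').comp
    ((L.restrictScalars ℝ : 𝓢(D, V) →L[ℝ] V') : 𝓢(D, V) →ₗ[ℝ] V'))
    (continuous_norm.comp L.continuous)

end SchwartzNorms

/-! ### Oscillatory integrals: pointwise decay -/

section OscillatoryOperator

variable {d : ℕ} {V : Type} [NormedAddCommGroup V] [NormedSpace ℂ V]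

/-- Quantitative symbol estimates up to order `r`. -/
def SymBound (M r : ℕ) (A : ℝ) (b : E d × E d → V) : Prop :=
  ∀ i ≤ r, ∀ x ξ, ‖iteratedFDeriv ℝ i b (x, ξ)‖ ≤ A * ((1 + ‖x‖) ^ M * (1 + ‖ξ‖) ^ M)

/-- Smooth functions all of whose derivatives are bounded by the same power of
`(1 + |x|) (1 + |ξ|)`. -/
structure IsAmplitude (M : ℕ) (b : E d × E d → V) : Prop where
  smooth : ContDiff ℝ (⊤ : ℕ∞) b
  bound : ∀ r, ∃ A, SymBound M r A b

theorem SymBound.nonneg {M r : ℕ} {A : ℝ} {b : E d × E d → V} (h : SymBound M r A b) : 0 ≤ A := by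
  have := (norm_nonneg _).trans (h 0 (Nat.zero_le _) 0 0)
  simpa using this

theorem SymBound.mono {M r r' : ℕ} {A : ℝ} {b : E d × E d → V} (h : SymBound M r A b)
    (hr : r' ≤ r) : SymBound M r' A b := fun i hi => h i (hi.trans hr)

theorem SymBound.norm_le {M r : ℕ} {A : ℝ} {b : E d × E d → V} (h : SymBound M r A b) (x ξ : E d) :
    ‖b (x, ξ)‖ ≤ A * ((1 + ‖x‖) ^ M * (1 + ‖ξ‖) ^ M) := by
  simpa using h 0 (Nat.zero_le _) x ξ

theorem norm_iteratedFDeriv_slice_le {b : E d × E d → V} (hb : ContDiff ℝ (⊤ : ℕ∞) b) (x ξ : E d)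
    (i : ℕ) : ‖iteratedFDeriv ℝ i (fun ξ' => b (x, ξ')) ξ‖ ≤ ‖iteratedFDeriv ℝ i b (x, ξ)‖ := by
  have h1 : (fun ξ' => b (x, ξ')) =
      (fun z => b (z + (x, 0))) ∘ (ContinuousLinearMap.inr ℝ (E d) (E d)) := by
    ext ξ'; simp
  have h2 : ContDiff ℝ (⊤ : ℕ∞) (fun z : E d × E d => b (z + (x, 0))) :=
    hb.comp (contDiff_id.add contDiff_const)
  rw [h1, ContinuousLinearMap.iteratedFDeriv_comp_right _ h2 ξ (i := i) (by exact_mod_cast le_top),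
    iteratedFDeriv_comp_add_right]
  refine (ContinuousMultilinearMap.norm_compContinuousLinearMap_le _ _).trans ?_
  simp only [ContinuousLinearMap.inr_apply, Prod.mk_add_mk, zero_add, add_zero]
  refine mul_le_of_le_one_right (norm_nonneg _) ?_
  exact Finset.prod_le_one (fun _ _ => norm_nonneg _)
    fun _ _ => ContinuousLinearMap.norm_inr_le_one ℝ (E d) (E d)

/-- Leibniz' rule: the growth of b in ξ is paid for by M extra powers in the norm of g, and the
binomial coefficients add up to 2 ^ l. -/
theorem slice_bound {M k l : ℕ} {A : ℝ} {b : E d × E d → V} (hb : ContDiff ℝ (⊤ : ℕ∞) b)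
    (hA : SymBound M l A b) (g : 𝓢(E d, ℂ)) (x ξ : E d) :
    (1 + ‖ξ‖) ^ k * ‖iteratedFDeriv ℝ l (fun ξ' => g ξ' • b (x, ξ')) ξ‖ ≤
      2 ^ l * 2 ^ (k + M) * (A * (1 + ‖x‖) ^ M) * schwartzSup (E d) ℂ (k + M, l) g := by
  have hbx : ContDiff ℝ (⊤ : ℕ∞) (fun ξ' => b (x, ξ')) := hb.comp (by fun_prop)
  have h := norm_iteratedFDeriv_smul_le (g.smooth ⊤) hbx ξ (n := l) (by exact_mod_cast le_top)
  have hA0 := hA.nonneg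
  calc (1 + ‖ξ‖) ^ k * ‖iteratedFDeriv ℝ l (fun ξ' => g ξ' • b (x, ξ')) ξ‖
      ≤ (1 + ‖ξ‖) ^ k * ∑ i ∈ Finset.range (l + 1), (l.choose i : ℝ) * ‖iteratedFDeriv ℝ i g ξ‖ *
          (A * ((1 + ‖x‖) ^ M * (1 + ‖ξ‖) ^ M)) := by
        refine mul_le_mul_of_nonneg_left (h.trans ?_) (by positivity)
        gcongr with i hi
        exact (norm_iteratedFDeriv_slice_le hb x ξ _).trans (hA _ (Nat.sub_le _ _) x ξ)
    _ = ∑ i ∈ Finset.range (l + 1), (l.choose i : ℝ) * (A * (1 + ‖x‖) ^ M) *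
          ((1 + ‖ξ‖) ^ (k + M) * ‖iteratedFDeriv ℝ i g ξ‖) := by
        rw [Finset.mul_sum]
        refine Finset.sum_congr rfl fun i _ => ?_
        ring
    _ ≤ ∑ i ∈ Finset.range (l + 1), (l.choose i : ℝ) * (A * (1 + ‖x‖) ^ M) *
          (2 ^ (k + M) * schwartzSup (E d) ℂ (k + M, l) g) := by
        refine Finset.sum_le_sum fun i hi => mul_le_mul_of_nonneg_left ?_ (by positivity)
        exact one_add_pow_mul_le_schwartzSup (m := (k + M, l)) le_rfl
          (Nat.lt_succ_iff.1 (Finset.mem_range.1 hi)) g ξ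
    _ = _ := by
        rw [← Finset.sum_mul, ← Finset.sum_mul, ← Nat.cast_sum, Nat.sum_range_choose]
        push_cast
        ring

/-- The Schwartz function `ξ ↦ g ξ b (x, ξ)`. -/
noncomputable def slice {M : ℕ} {b : E d × E d → V} (hb : IsAmplitude M b) (g : 𝓢(E d, ℂ))
    (x : E d) : 𝓢(E d, V) where
  toFun ξ := g ξ • b (x, ξ)
  smooth' := (g.smooth ⊤).smul (hb.smooth.comp (by fun_prop))
  decay' k l := by
    obtain ⟨A, hA⟩ := hb.bound l
    refine ⟨_, fun ξ => le_trans ?_ (slice_bound (k := k) hb.smooth hA g x ξ)⟩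
    gcongr
    linarith [norm_nonneg ξ]

theorem schwartzSup_slice_le {M : ℕ} {b : E d × E d → V} (hb : IsAmplitude M b)
    (m : ℕ × ℕ) {A : ℝ} (hA : SymBound M m.2 A b) (g : 𝓢(E d, ℂ)) (x : E d) :
    schwartzSup (E d) V m (slice hb g x) ≤
      2 ^ m.2 * 2 ^ (m.1 + M) * (A * (1 + ‖x‖) ^ M) *
        schwartzSup (E d) ℂ (m.1 + M, m.2) g := by
  have hA0 := hA.nonneg
  refine schwartzSup_le (by positivity) fun k hk l hl ξ => ?_
  refine le_trans ?_ ((slice_bound (k := k) hb.smooth (hA.mono hl) g x ξ).trans ?_)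
  · refine mul_le_mul_of_nonneg_right ?_ (norm_nonneg _)
    gcongr
    linarith [norm_nonneg ξ]
  · gcongr
    · norm_num
    · norm_num
    · exact schwartzSup_mono ⟨by simpa using hk, hl⟩ g

/-- `T_b g (x) = ∫ e^{2πi⟨x, ξ⟩} g(ξ) b(x, ξ) dξ`. -/
noncomputable def oscInt (b : E d × E d → V) (g : 𝓢(E d, ℂ)) (x : E d) : V :=
  ∫ ξ, (𝐞 (inner ℝ ξ x) : ℂ) • (g ξ • b (x, ξ))

theorem oscInt_eq_fourierInv {M : ℕ} {b : E d × E d → V} (hb : IsAmplitude M b) (g : 𝓢(E d, ℂ))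
    (x : E d) : oscInt b g x = 𝓕⁻ (slice hb g x) x := by
  rw [SchwartzMap.fourierInv_coe, Real.fourierInv_eq]
  rfl

/-- For frozen x the integral is an inverse Fourier transform, evaluated at the same x. Its decay of
order k + M absorbs the growth (1 + |x|)^M of the slice. The data r, m, K do not depend on the
amplitude, which later gives uniformity over all frequency shifts of a symbol. -/
theorem norm_oscInt_le [CompleteSpace V] (k M : ℕ) : ∃ r : ℕ, ∃ m : ℕ × ℕ, ∃ K : ℝ, 0 ≤ K ∧
    ∀ (b : E d × E d → V) (_ : IsAmplitude M b) (A : ℝ), SymBound M r A b → ∀ (g : 𝓢(E d, ℂ)) x,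
      (1 + ‖x‖) ^ k * ‖oscInt b g x‖ ≤ K * A * schwartzSup (E d) ℂ m g := by
  obtain ⟨m, C, hC, h⟩ := exists_schwartzSup_map_le
    (FourierTransform.fourierInvCLM ℂ 𝓢(E d, V)) (k + M, 0)
  refine ⟨m.2, (m.1 + M, m.2), 2 ^ (k + M) * (C * (2 ^ m.2 * 2 ^ (m.1 + M))), by positivity,
    fun b hb A hA g x => ?_⟩
  have hA0 := hA.nonneg
  rw [oscInt_eq_fourierInv hb]
  have h1 := one_add_pow_mul_norm_le_schwartzSup (k + M) (𝓕⁻ (slice hb g x)) x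
  have h2 := h (slice hb g x)
  have h3 := schwartzSup_slice_le hb m hA g x
  have hx : 0 < (1 + ‖x‖) ^ M := by positivity
  rw [← mul_le_mul_iff_right₀ hx]
  calc _ = (1 + ‖x‖) ^ (k + M) * ‖𝓕⁻ (slice hb g x) x‖ := by ring
    _ ≤ 2 ^ (k + M) * (C * (2 ^ m.2 * 2 ^ (m.1 + M) * (A * (1 + ‖x‖) ^ M) *
        schwartzSup (E d) ℂ (m.1 + M, m.2) g)) := by
      refine h1.trans (mul_le_mul_of_nonneg_left (h2.trans ?_) (by positivity))
      gcongr
    _ = _ := by ring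

end OscillatoryOperator

end FourierBanach

namespace FourierBanach

/-! ### Derivatives of oscillatory integrals -/

section OscillatoryOperatorDeriv

variable {d : ℕ} {V : Type} [NormedAddCommGroup V] [NormedSpace ℂ V]

/-- The amplitude of the derivative of an oscillatory integral. -/
noncomputable def derivAmplitude (b : E d × E d → V) (z : E d × E d) : E d →L[ℝ] V :=
  (fderiv ℝ b z).comp (ContinuousLinearMap.inl ℝ (E d) (E d)) +
    (2 * Real.pi * Complex.I) • (innerSL ℝ z.2).smulRight (b z)

theorem norm_iteratedFDeriv_clm_le {X Y : Type*} [NormedAddCommGroup X] [NormedSpace ℝ X]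
    [NormedAddCommGroup Y] [NormedSpace ℝ Y] (L : X →L[ℝ] Y) (hL : ‖L‖ ≤ 1) (i : ℕ) (z : X) :
    ‖iteratedFDeriv ℝ i L z‖ ≤ 1 + ‖L z‖ := by
  have h1 : fderiv ℝ (⇑L) = fun _ => L := by
    ext1 z
    exact ContinuousLinearMap.fderiv _
  match i with
  | 0 => simp
  | 1 =>
    rw [← norm_iteratedFDeriv_fderiv, norm_iteratedFDeriv_zero, h1]
    linarith [norm_nonneg (L z)]
  | i + 2 =>
    rw [← norm_iteratedFDeriv_fderiv, ← norm_iteratedFDeriv_fderiv]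
    have : fderiv ℝ (fderiv ℝ L) = 0 := by
      ext1 z
      rw [h1]; simp
    rw [this]
    simp only [iteratedFDeriv_zero, Pi.zero_apply, norm_zero]
    positivity

theorem norm_iteratedFDeriv_innerSL_snd_le (i : ℕ) (x ξ : E d) :
    ‖iteratedFDeriv ℝ i (fun z : E d × E d => innerSL ℝ z.2) (x, ξ)‖ ≤ 1 + ‖ξ‖ := by
  have h := norm_iteratedFDeriv_clm_le
    ((innerSL ℝ).comp (ContinuousLinearMap.snd ℝ (E d) (E d))) ?_ i (x, ξ)
  · simpa using! h
  · refine ContinuousLinearMap.opNorm_le_bound _ zero_le_one fun z => ?_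
    simpa using! norm_snd_le z

theorem contDiff_inner_smulRight {D W X : Type*} [NormedAddCommGroup D] [InnerProductSpace ℝ D]
    [NormedAddCommGroup W] [NormedSpace ℝ W] [NormedAddCommGroup X] [NormedSpace ℝ X]
    {l : X → D} {b : X → W} {n : WithTop ℕ∞} (hl : ContDiff ℝ n l) (hb : ContDiff ℝ n b) :
    ContDiff ℝ n (fun z => (innerSL ℝ (l z)).smulRight (b z)) := by
  have h : ContDiff ℝ n (fun z => innerSL ℝ (l z)) := (innerSL ℝ).contDiff.comp hl
  fun_prop

theorem norm_iteratedFDeriv_smulRight_le {D W X : Type*} [NormedAddCommGroup D]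
    [NormedSpace ℝ D] [NormedAddCommGroup W] [NormedSpace ℝ W] [NormedAddCommGroup X]
    [NormedSpace ℝ X] (n : ℕ) {l : X → StrongDual ℝ D} {b : X → W} (hl : ContDiff ℝ n l)
    (hb : ContDiff ℝ n b) (z : X) :
    ‖iteratedFDeriv ℝ n (fun z => (l z).smulRight (b z)) z‖ ≤
      ∑ j ∈ Finset.range (n + 1), (n.choose j : ℝ) * ‖iteratedFDeriv ℝ j l z‖ *
          ‖iteratedFDeriv ℝ (n - j) b z‖ :=
  ContinuousLinearMap.norm_iteratedFDeriv_le_of_bilinear_of_le_one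
    (ContinuousLinearMap.smulRightL ℝ D W) hl hb z le_rfl ContinuousLinearMap.norm_smulRightL_le

/-- Restriction of linear maps on `E × E` to the first factor. -/
noncomputable def compInl (d : ℕ) (V : Type) [NormedAddCommGroup V] [NormedSpace ℂ V] :
    (E d × E d →L[ℝ] V) →L[ℝ] (E d →L[ℝ] V) :=
  (ContinuousLinearMap.compL ℝ (E d) (E d × E d) V).flip (ContinuousLinearMap.inl ℝ (E d) (E d))

theorem derivAmplitude_eq (b : E d × E d → V) :
    derivAmplitude b = (⇑(compInl d V) ∘ fderiv ℝ b) + (2 * Real.pi * Complex.I) •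
      (fun z => (innerSL ℝ z.2).smulRight (b z)) := rfl

theorem contDiff_fderiv_of_contDiff_top {F G : Type*} [NormedAddCommGroup F] [NormedSpace ℝ F]
    [NormedAddCommGroup G] [NormedSpace ℝ G] {f : F → G} (hf : ContDiff ℝ (⊤ : ℕ∞) f) :
    ContDiff ℝ (⊤ : ℕ∞) (fderiv ℝ f) :=
  hf.fderiv_right (m := (⊤ : ℕ∞)) (by exact_mod_cast le_top)

theorem contDiff_derivAmplitude {b : E d × E d → V} (hb : ContDiff ℝ (⊤ : ℕ∞) b) :
    ContDiff ℝ (⊤ : ℕ∞) (derivAmplitude b) := by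
  rw [derivAmplitude_eq]
  have h2 := contDiff_inner_smulRight contDiff_snd hb
  exact ((compInl d V).contDiff.comp (contDiff_fderiv_of_contDiff_top hb)).add
    (h2.const_smul (2 * Real.pi * Complex.I : ℂ))

/-- Differentiating in x costs one derivative of b and, when it hits the phase, one factor ξ. This
is why r + 1 drops to r and M rises to M + 1. -/
theorem exists_symBound_derivAmplitude (d : ℕ) (V : Type) [NormedAddCommGroup V] [NormedSpace ℂ V]
    (M r : ℕ) : ∃ K : ℝ, 0 ≤ K ∧ ∀ (b : E d × E d → V) (_ : ContDiff ℝ (⊤ : ℕ∞) b) (A : ℝ),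
      SymBound M (r + 1) A b → SymBound (M + 1) r (K * A) (derivAmplitude b) := by
  refine ⟨‖compInl d V‖ + ‖(2 * Real.pi * Complex.I : ℂ)‖ * 2 ^ r,
    by positivity, fun b hb A hA i hi x ξ => ?_⟩
  have hA0 := hA.nonneg
  have hb' := contDiff_fderiv_of_contDiff_top hb
  have c1 : ContDiff ℝ (⊤ : ℕ∞) (⇑(compInl d V) ∘ fderiv ℝ b) := (compInl d V).contDiff.comp hb'
  have c2 : ContDiff ℝ (⊤ : ℕ∞) (fun z : E d × E d =>
      (innerSL ℝ z.2).smulRight (b z)) :=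
    contDiff_inner_smulRight contDiff_snd hb
  have hi' : ((i : ℕ∞) : WithTop ℕ∞) ≤ ((⊤ : ℕ∞) : WithTop ℕ∞) := by exact_mod_cast le_top
  have c1' : ContDiff ℝ i (⇑(compInl d V) ∘ fderiv ℝ b) := c1.of_le hi'
  have c2' : ContDiff ℝ i (fun z : E d × E d =>
      (innerSL ℝ z.2).smulRight (b z)) := c2.of_le hi'
  set P := (1 + ‖x‖) ^ M * (1 + ‖ξ‖) ^ M with hP
  have hPP : P * (1 + ‖ξ‖) ≤ (1 + ‖x‖) ^ (M + 1) * (1 + ‖ξ‖) ^ (M + 1) := by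
    rw [hP, pow_succ, pow_succ]
    have : (1 + ‖x‖) ^ M * 1 ≤ (1 + ‖x‖) ^ M * (1 + ‖x‖) := by
      gcongr; linarith [norm_nonneg x]
    calc _ = ((1 + ‖x‖) ^ M * 1) * ((1 + ‖ξ‖) ^ M * (1 + ‖ξ‖)) := by ring
      _ ≤ _ := by gcongr
  have hP1 : P ≤ P * (1 + ‖ξ‖) := le_mul_of_one_le_right (by positivity) (by linarith [norm_nonneg ξ])
  have e1 : ‖iteratedFDeriv ℝ i (⇑(compInl d V) ∘ fderiv ℝ b) (x, ξ)‖ ≤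
      ‖compInl d V‖ * (A * (P * (1 + ‖ξ‖))) := by
    refine ((compInl d V).norm_iteratedFDeriv_comp_left hb'.contDiffAt hi').trans ?_
    rw [norm_iteratedFDeriv_fderiv]
    have := hA (i + 1) (by omega) x ξ
    gcongr
    exact this.trans (by gcongr)
  have e2 : ‖iteratedFDeriv ℝ i (fun z : E d × E d =>
      (innerSL ℝ z.2).smulRight (b z)) (x, ξ)‖ ≤
      2 ^ r * (A * (P * (1 + ‖ξ‖))) := by
    refine (norm_iteratedFDeriv_smulRight_le i ((innerSL ℝ).contDiff.comp contDiff_snd)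
      (hb.of_le hi') (x, ξ)).trans ?_
    calc _ ≤ ∑ j ∈ Finset.range (i + 1), (i.choose j : ℝ) * (1 + ‖ξ‖) * (A * P) := by
          refine Finset.sum_le_sum fun j _ => ?_
          gcongr
          · exact norm_iteratedFDeriv_innerSL_snd_le j x ξ
          · exact hA _ (by omega) x ξ
      _ = 2 ^ i * (A * (P * (1 + ‖ξ‖))) := by
          rw [← Finset.sum_mul, ← Finset.sum_mul, ← Nat.cast_sum, Nat.sum_range_choose]
          push_cast; ring
      _ ≤ _ := by gcongr; norm_num
  have c3 : ContDiff ℝ i ((2 * Real.pi * Complex.I : ℂ) •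
      fun z : E d × E d => (innerSL ℝ z.2).smulRight (b z)) :=
    c2'.const_smul (2 * Real.pi * Complex.I : ℂ)
  rw [derivAmplitude_eq, iteratedFDeriv_add_apply c1'.contDiffAt c3.contDiffAt,
    iteratedFDeriv_const_smul_apply c2'.contDiffAt]
  refine (norm_add_le _ _).trans ?_
  rw [norm_smul]
  calc _ ≤ ‖compInl d V‖ * (A * (P * (1 + ‖ξ‖))) + ‖(2 * Real.pi * Complex.I : ℂ)‖ *
        (2 ^ r * (A * (P * (1 + ‖ξ‖)))) := by gcongr
    _ = (‖compInl d V‖ + ‖(2 * Real.pi * Complex.I : ℂ)‖ * 2 ^ r) * A *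
        (P * (1 + ‖ξ‖)) := by ring
    _ ≤ _ := by gcongr

theorem IsAmplitude.derivAmplitude {M : ℕ} {b : E d × E d → V} (hb : IsAmplitude M b) :
    IsAmplitude (M + 1) (derivAmplitude b) where
  smooth := contDiff_derivAmplitude hb.smooth
  bound r := by
    obtain ⟨K, -, hK⟩ := exists_symBound_derivAmplitude d V M r
    obtain ⟨A, hA⟩ := hb.bound (r + 1)
    exact ⟨_, hK b hb.smooth A hA⟩

theorem integrable_oscInt {M : ℕ} {b : E d × E d → V} (hb : IsAmplitude M b) (g : 𝓢(E d, ℂ))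
    (x : E d) : Integrable (fun ξ => (𝐞 (inner ℝ ξ x) : ℂ) • (g ξ • b (x, ξ))) := by
  have : Continuous fun ξ : E d => (𝐞 (inner ℝ ξ x) : ℂ) • (g ξ • b (x, ξ)) := by
    have := hb.smooth.continuous
    have h2 := Real.continuous_fourierChar
    fun_prop
  refine (slice hb g x).integrable.mono this.aestronglyMeasurable (Filter.Eventually.of_forall ?_)
  intro ξ
  rw [norm_smul, Circle.norm_coe, one_mul]
  rfl

theorem hasFDerivAt_oscInt_integrand {b : E d × E d → V} (hb : ContDiff ℝ (⊤ : ℕ∞) b)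
    (g : 𝓢(E d, ℂ)) (x ξ : E d) :
    HasFDerivAt (fun x => (𝐞 (inner ℝ ξ x) : ℂ) • (g ξ • b (x, ξ)))
      ((𝐞 (inner ℝ ξ x) : ℂ) • (g ξ • derivAmplitude b (x, ξ))) x := by
  have h1 : HasFDerivAt (fun x => b (x, ξ))
      ((fderiv ℝ b (x, ξ)).comp (ContinuousLinearMap.inl ℝ (E d) (E d))) x := by
    have hbd : HasFDerivAt b (fderiv ℝ b (x, ξ)) (x, ξ) :=
      ((hb.differentiable (by simp)) (x, ξ)).hasFDerivAt
    exact hbd.comp x (hasFDerivAt_prodMk_left x ξ)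
  have h2 : HasFDerivAt (fun x : E d => (𝐞 (inner ℝ ξ x) : ℂ))
      ((2 * Real.pi * Complex.I * (𝐞 (inner ℝ ξ x) : ℂ)) •
        Complex.ofRealCLM.comp (innerSL ℝ ξ)) x := by
    have h3 := Real.hasDerivAt_fourierChar (inner ℝ ξ x : ℝ)
    have h4 : HasFDerivAt (fun x : E d => (inner ℝ ξ x : ℝ)) (innerSL ℝ ξ) x :=
      (innerSL ℝ ξ).hasFDerivAt
    have h5 := h3.hasFDerivAt.comp x h4
    convert! h5 using 1
    ext h
    simp [mul_comm]
  have h6 := h2.smul (h1.fun_const_smul (g ξ))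
  convert! h6 using 1
  ext h
  have e : ∀ (c : ℂ) (r : ℝ) (w : V), c • (r • w) = (c * r) • w := fun c r w => by
    rw [← Complex.coe_smul, smul_smul]
  simp only [derivAmplitude, smul_apply,
    add_apply, ContinuousLinearMap.comp_apply,
    ContinuousLinearMap.smulRight_apply, Complex.ofRealCLM_apply, innerSL_apply_apply, smul_add,
    e, smul_smul, smul_eq_mul]
  congr 2
  ring

theorem integrable_one_add_pow_mul (g : 𝓢(E d, ℂ)) (k : ℕ) :
    Integrable (fun ξ => (1 + ‖ξ‖) ^ k * ‖g ξ‖) := by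
  have h := (((g.integrable (μ := volume)).norm).add (g.integrable_pow_mul volume k)).const_mul
    (2 ^ (k - 1))
  refine h.mono' (by have := g.continuous; fun_prop) (Filter.Eventually.of_forall fun ξ => ?_)
  rw [Real.norm_of_nonneg (by positivity)]
  have := add_pow_le (zero_le_one' ℝ) (norm_nonneg ξ) k
  calc (1 + ‖ξ‖) ^ k * ‖g ξ‖ ≤ (2 ^ (k - 1) * (1 ^ k + ‖ξ‖ ^ k)) * ‖g ξ‖ := by gcongr
    _ = _ := by simp; ring

/-- Differentiation under the integral: for x' in the unit ball around x, the differentiated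
integrand is dominated by a power of 1 + |ξ| times |g|. -/
theorem hasFDerivAt_oscInt {M : ℕ} {b : E d × E d → V} (hb : IsAmplitude M b) (g : 𝓢(E d, ℂ))
    (x : E d) : HasFDerivAt (oscInt b g) (oscInt (derivAmplitude b) g x) x := by
  obtain ⟨A, hA⟩ := hb.derivAmplitude.bound 0
  have hA0 := hA.nonneg
  refine hasFDerivAt_integral_of_dominated_of_fderiv_le (s := Metric.ball x 1)
    (bound := fun ξ => A * (1 + (‖x‖ + 1)) ^ (M + 1) * ((1 + ‖ξ‖) ^ (M + 1) * ‖g ξ‖))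
    (F := fun x ξ => (𝐞 (inner ℝ ξ x) : ℂ) • (g ξ • b (x, ξ)))
    (F' := fun x ξ => (𝐞 (inner ℝ ξ x) : ℂ) • (g ξ • derivAmplitude b (x, ξ)))
    (Metric.ball_mem_nhds x one_pos)
    (Filter.Eventually.of_forall fun x => (integrable_oscInt hb g x).aestronglyMeasurable)
    (integrable_oscInt hb g x) (integrable_oscInt hb.derivAmplitude g x).aestronglyMeasurable
    (Filter.Eventually.of_forall fun ξ x' hx' => ?_)
    ((integrable_one_add_pow_mul g (M + 1)).const_mul _)
    (Filter.Eventually.of_forall fun ξ x' _ => hasFDerivAt_oscInt_integrand hb.smooth g x' ξ)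
  have hx'' : ‖x'‖ ≤ ‖x‖ + 1 := by
    rw [Metric.mem_ball, dist_eq_norm] at hx'
    have := norm_le_norm_add_norm_sub' x' x
    linarith
  calc ‖(𝐞 (inner ℝ ξ x') : ℂ) • (g ξ • derivAmplitude b (x', ξ))‖
      = ‖g ξ • derivAmplitude b (x', ξ)‖ := by rw [norm_smul, Circle.norm_coe, one_mul]
    _ = ‖g ξ‖ * ‖derivAmplitude b (x', ξ)‖ := norm_smul _ _
    _ ≤ ‖g ξ‖ * (A * ((1 + ‖x'‖) ^ (M + 1) * (1 + ‖ξ‖) ^ (M + 1))) := by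
        gcongr; exact hA.norm_le x' ξ
    _ ≤ ‖g ξ‖ * (A * ((1 + (‖x‖ + 1)) ^ (M + 1) * (1 + ‖ξ‖) ^ (M + 1))) := by gcongr
    _ = _ := by ring

theorem fderiv_oscInt {M : ℕ} {b : E d × E d → V} (hb : IsAmplitude M b) (g : 𝓢(E d, ℂ)) :
    fderiv ℝ (oscInt b g) = oscInt (derivAmplitude b) g :=
  funext fun x => (hasFDerivAt_oscInt hb g x).fderiv

/-- The derivative is again an oscillatory integral, with values in `E d →L[ℝ] V`; hence the
induction runs over all target spaces simultaneously. -/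
theorem contDiff_nat_oscInt (n : ℕ) : ∀ {V : Type} [NormedAddCommGroup V] [NormedSpace ℂ V] {M : ℕ}
    {b : E d × E d → V} (_ : IsAmplitude M b) (g : 𝓢(E d, ℂ)), ContDiff ℝ n (oscInt b g) := by
  induction n with
  | zero =>
    intro V _ _ M b hb g
    rw [Nat.cast_zero, contDiff_zero, continuous_iff_continuousAt]
    exact fun x => (hasFDerivAt_oscInt hb g x).continuousAt
  | succ n ih =>
    intro V _ _ M b hb g
    rw [Nat.cast_succ, contDiff_succ_iff_fderiv]
    refine ⟨fun x => (hasFDerivAt_oscInt hb g x).differentiableAt, by simp, ?_⟩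
    rw [fderiv_oscInt hb]
    exact ih hb.derivAmplitude g

theorem contDiff_oscInt {M : ℕ} {b : E d × E d → V} (hb : IsAmplitude M b) (g : 𝓢(E d, ℂ)) :
    ContDiff ℝ (⊤ : ℕ∞) (oscInt b g) :=
  contDiff_infty.2 fun n => contDiff_nat_oscInt n hb g

theorem norm_iteratedFDeriv_oscInt_le (d n : ℕ) : ∀ (V : Type) [NormedAddCommGroup V]
    [NormedSpace ℂ V] [CompleteSpace V] (k M : ℕ), ∃ r : ℕ, ∃ m : ℕ × ℕ, ∃ K : ℝ, 0 ≤ K ∧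
    ∀ (b : E d × E d → V) (_ : IsAmplitude M b) (A : ℝ), SymBound M r A b → ∀ (g : 𝓢(E d, ℂ)) x,
      (1 + ‖x‖) ^ k * ‖iteratedFDeriv ℝ n (oscInt b g) x‖ ≤
        K * A * schwartzSup (E d) ℂ m g := by
  induction n with
  | zero =>
    intro V _ _ _ k M
    simpa only [norm_iteratedFDeriv_zero] using norm_oscInt_le (d := d) (V := V) k M
  | succ n ih =>
    intro V _ _ _ k M
    obtain ⟨r, m, K, hK0, hK⟩ := ih (E d →L[ℝ] V) k (M + 1)
    obtain ⟨K', hK'0, hK'⟩ := exists_symBound_derivAmplitude d V M r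
    refine ⟨r + 1, m, K * K', by positivity, fun b hb A hA g x => ?_⟩
    have := hK _ hb.derivAmplitude _ (hK' b hb.smooth A hA) g x
    rw [← norm_iteratedFDeriv_fderiv, fderiv_oscInt hb, mul_assoc K]
    exact this

/-- The oscillatory integral as a Schwartz function. -/
noncomputable def oscSchwartz [CompleteSpace V] {M : ℕ} {b : E d × E d → V} (hb : IsAmplitude M b)
    (g : 𝓢(E d, ℂ)) : 𝓢(E d, V) where
  toFun := oscInt b g
  smooth' := contDiff_oscInt hb g
  decay' k n := by
    obtain ⟨r, m, K, hK0, hK⟩ := norm_iteratedFDeriv_oscInt_le d n V k M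
    obtain ⟨A, hA⟩ := hb.bound r
    refine ⟨_, fun x => le_trans ?_ (hK b hb A hA g x)⟩
    gcongr
    linarith [norm_nonneg x]

theorem schwartzSup_oscSchwartz_le (V : Type) [NormedAddCommGroup V] [NormedSpace ℂ V]
    [CompleteSpace V] (M : ℕ) (l : ℕ × ℕ) : ∃ r : ℕ, ∃ m : ℕ × ℕ, ∃ K : ℝ, 0 ≤ K ∧
    ∀ (b : E d × E d → V) (hb : IsAmplitude M b) (A : ℝ), SymBound M r A b → ∀ (g : 𝓢(E d, ℂ)),
      schwartzSup (E d) V l (oscSchwartz hb g) ≤ K * A * schwartzSup (E d) ℂ m g := by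
  choose r m K hK0 hK using fun n => norm_iteratedFDeriv_oscInt_le d n V l.1 M
  have hle : ∀ n ≤ l.2, n ∈ Finset.range (l.2 + 1) := fun n hn => by simpa [Nat.lt_succ_iff] using hn
  refine ⟨(Finset.range (l.2 + 1)).sup r, (Finset.range (l.2 + 1)).sup m,
    ∑ n ∈ Finset.range (l.2 + 1), K n, Finset.sum_nonneg fun n _ => hK0 n,
    fun b hb A hA g => ?_⟩
  have hA0 := hA.nonneg
  refine schwartzSup_le (mul_nonneg (mul_nonneg (Finset.sum_nonneg fun n _ => hK0 n) hA0)
    (apply_nonneg _ _)) fun k hk n hn x => ?_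
  have h1 : ‖x‖ ^ k ≤ (1 + ‖x‖) ^ l.1 :=
    (pow_le_pow_left₀ (norm_nonneg x) (by linarith) k).trans
      (pow_le_pow_right₀ (by linarith [norm_nonneg x]) hk)
  calc _ ≤ (1 + ‖x‖) ^ l.1 * ‖iteratedFDeriv ℝ n (oscInt b g) x‖ := by gcongr; exact le_rfl
    _ ≤ K n * A * schwartzSup (E d) ℂ (m n) g :=
        hK n b hb A (hA.mono (Finset.le_sup (f := r) (hle n hn))) g x
    _ ≤ _ := by
        have h2 : K n ≤ ∑ n ∈ Finset.range (l.2 + 1), K n :=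
          Finset.single_le_sum (fun n _ => hK0 n) (hle n hn)
        have h3 := schwartzSup_mono (Finset.le_sup (f := m) (hle n hn)) g
        have h4 : 0 ≤ ∑ n ∈ Finset.range (l.2 + 1), K n := Finset.sum_nonneg fun n _ => hK0 n
        have h5 := mul_nonneg h4 hA0
        gcongr

end OscillatoryOperatorDeriv
end FourierBanach

namespace FourierBanach

/-! ### Mixed partial derivatives control total derivatives -/

section MixedDerivatives

variable {d : ℕ} {G : Type} [NormedAddCommGroup G] [NormedSpace ℝ G]

theorem exists_norm_iteratedFDeriv_comp_left_le {D X Y : Type*} [NormedAddCommGroup D]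
    [NormedSpace ℝ D] [NormedAddCommGroup X] [NormedSpace ℝ X] [NormedAddCommGroup Y]
    [NormedSpace ℝ Y] (L : X →L[ℝ] Y) : ∃ C : ℝ, 0 ≤ C ∧ ∀ (n : ℕ) (f : D → X),
      ContDiff ℝ (⊤ : ℕ∞) f → ∀ z,
      ‖iteratedFDeriv ℝ n (L ∘ f) z‖ ≤ C * ‖iteratedFDeriv ℝ n f z‖ :=
  ⟨‖L‖, norm_nonneg _, fun _ _ hf z =>
    L.norm_iteratedFDeriv_comp_left (hf.contDiffAt (x := z)) (by exact_mod_cast le_top)⟩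

theorem norm_iteratedFDeriv_isometry_comp {D X Y : Type*} [NormedAddCommGroup D]
    [NormedSpace ℝ D] [NormedAddCommGroup X] [NormedSpace ℝ X] [NormedAddCommGroup Y]
    [NormedSpace ℝ Y] (L : X ≃ₗᵢ[ℝ] Y) (n : ℕ) (f : D → X) (z : D) :
    ‖iteratedFDeriv ℝ n (fun z => L (f z)) z‖ = ‖iteratedFDeriv ℝ n f z‖ :=
  L.norm_iteratedFDeriv_comp_left f z n

theorem fderiv_isometry_comp {D X Y : Type*} [NormedAddCommGroup D]
    [NormedSpace ℝ D] [NormedAddCommGroup X] [NormedSpace ℝ X] [NormedAddCommGroup Y]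
    [NormedSpace ℝ Y] (L : X ≃ₗᵢ[ℝ] Y) (f : D → X) (z h : D) :
    fderiv ℝ (⇑L ∘ f) z h = L (fderiv ℝ f z h) := by
  rw [LinearIsometryEquiv.comp_fderiv]
  rfl

/-- The partial derivative in the second variable. -/
noncomputable def sndFDeriv (a : E d × E d → G) (z : E d × E d) : E d →L[ℝ] G :=
  (fderiv ℝ a z).comp (ContinuousLinearMap.inr ℝ (E d) (E d))

/-- The partial derivative in the first variable. -/
noncomputable def fstFDeriv (a : E d × E d → G) (z : E d × E d) : E d →L[ℝ] G :=
  (fderiv ℝ a z).comp (ContinuousLinearMap.inl ℝ (E d) (E d))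

/-- The iterated partial derivative in the second variable. -/
noncomputable def sndIteratedFDeriv (l : ℕ) (a : E d × E d → G) (z : E d × E d) :
    E d [×l]→L[ℝ] G :=
  iteratedFDeriv ℝ l (fun y => a (z.1, y)) z.2

theorem contDiff_sndFDeriv {a : E d × E d → G} (ha : ContDiff ℝ (⊤ : ℕ∞) a) :
    ContDiff ℝ (⊤ : ℕ∞) (sndFDeriv a) :=
  (contDiff_fderiv_of_contDiff_top ha).clm_comp contDiff_const

theorem contDiff_fstFDeriv {a : E d × E d → G} (ha : ContDiff ℝ (⊤ : ℕ∞) a) :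
    ContDiff ℝ (⊤ : ℕ∞) (fstFDeriv a) :=
  (contDiff_fderiv_of_contDiff_top ha).clm_comp contDiff_const

theorem hasFDerivAt_slice_snd {a : E d × E d → G} (ha : ContDiff ℝ (⊤ : ℕ∞) a) (x y : E d) :
    HasFDerivAt (fun y => a (x, y)) (sndFDeriv a (x, y)) y :=
  ((ha.differentiable (by simp)) (x, y)).hasFDerivAt.comp y (hasFDerivAt_prodMk_right x y)

theorem hasFDerivAt_slice_fst {a : E d × E d → G} (ha : ContDiff ℝ (⊤ : ℕ∞) a) (x y : E d) :
    HasFDerivAt (fun x => a (x, y)) (fstFDeriv a (x, y)) x :=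
  ((ha.differentiable (by simp)) (x, y)).hasFDerivAt.comp x (hasFDerivAt_prodMk_left x y)

theorem sndIteratedFDeriv_succ (l : ℕ) {a : E d × E d → G} (ha : ContDiff ℝ (⊤ : ℕ∞) a) :
    sndIteratedFDeriv (l + 1) a =
      (continuousMultilinearCurryRightEquiv' ℝ l (E d) G).symm ∘
        sndIteratedFDeriv l (sndFDeriv a) := by
  ext1 z
  rw [sndIteratedFDeriv, iteratedFDeriv_succ_eq_comp_right]
  simp only [Function.comp_apply, sndIteratedFDeriv]
  congr 2
  ext1 y
  exact (hasFDerivAt_slice_snd ha z.1 y).fderiv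

/-- Symmetry of the second derivative, applied to the vectors (0, k) and (h, 0). -/
theorem sndFDeriv_fstFDeriv_apply {a : E d × E d → G} (ha : ContDiff ℝ (⊤ : ℕ∞) a)
    (h : E d) (z : E d × E d) :
    sndFDeriv (fun z => fstFDeriv a z h) z = fstFDeriv (sndFDeriv a) z h := by
  have hd : DifferentiableAt ℝ (fderiv ℝ a) z :=
    (contDiff_fderiv_of_contDiff_top ha).differentiable (by simp) z
  have hs := (ha.contDiffAt (x := z)).isSymmSndFDerivAt
    (by rw [minSmoothness_of_isRCLikeNormedField]; exact WithTop.coe_le_coe.2 (le_top : (2 : ℕ∞) ≤ ⊤))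
  ext1 k
  have h1 : HasFDerivAt (fun z => fstFDeriv a z h)
      ((fderiv ℝ (fderiv ℝ a) z).flip (h, 0)) z := by
    have := hd.hasFDerivAt.clm_apply (hasFDerivAt_const ((h, 0) : E d × E d) z)
    simpa [fstFDeriv] using! this
  have h2 : HasFDerivAt (sndFDeriv a)
      (((ContinuousLinearMap.compL ℝ (E d) (E d × E d) G).flip
        (ContinuousLinearMap.inr ℝ (E d) (E d))).comp (fderiv ℝ (fderiv ℝ a) z)) z :=
    (((ContinuousLinearMap.compL ℝ (E d) (E d × E d) G).flip
        (ContinuousLinearMap.inr ℝ (E d) (E d))).hasFDerivAt).comp z hd.hasFDerivAt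
  rw [sndFDeriv, h1.fderiv, fstFDeriv, h2.fderiv]
  simpa using! hs (0, k) (h, 0)

theorem contDiff_sndIteratedFDeriv (l : ℕ) : ∀ {G : Type} [NormedAddCommGroup G]
    [NormedSpace ℝ G] {a : E d × E d → G} (_ : ContDiff ℝ (⊤ : ℕ∞) a),
    ContDiff ℝ (⊤ : ℕ∞) (sndIteratedFDeriv l a) := by
  induction l with
  | zero =>
    intro G _ _ a ha
    exact (continuousMultilinearCurryFin0 ℝ (E d) G).symm.contDiff.comp ha
  | succ l ih =>
    intro G _ _ a ha
    rw [sndIteratedFDeriv_succ l ha]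
    exact (continuousMultilinearCurryRightEquiv' ℝ l (E d) G).symm.contDiff.comp
      (ih (contDiff_sndFDeriv ha))

theorem sndIteratedFDeriv_fstFDeriv_apply (l : ℕ) : ∀ {G : Type} [NormedAddCommGroup G]
    [NormedSpace ℝ G] {a : E d × E d → G} (_ : ContDiff ℝ (⊤ : ℕ∞) a) (h : E d) (z : E d × E d),
    sndIteratedFDeriv l (fun z => fstFDeriv a z h) z = fstFDeriv (sndIteratedFDeriv l a) z h := by
  induction l with
  | zero =>
    intro G _ _ a ha h z
    have h1 : sndIteratedFDeriv 0 a =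
        (continuousMultilinearCurryFin0 ℝ (E d) G).symm ∘ a := rfl
    rw [h1]
    exact (fderiv_isometry_comp (continuousMultilinearCurryFin0 ℝ (E d) G).symm a z (h, 0)).symm
  | succ l ih =>
    intro G _ _ a ha h z
    have hh : ContDiff ℝ (⊤ : ℕ∞) (fun z => fstFDeriv a z h) :=
      (contDiff_fstFDeriv ha).clm_apply contDiff_const
    rw [sndIteratedFDeriv_succ l hh, sndIteratedFDeriv_succ l ha]
    have e : sndFDeriv (fun z => fstFDeriv a z h) = fun z => fstFDeriv (sndFDeriv a) z h :=
      funext (sndFDeriv_fstFDeriv_apply ha h)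
    rw [e, Function.comp_apply, ih (contDiff_sndFDeriv ha)]
    exact (fderiv_isometry_comp (continuousMultilinearCurryRightEquiv' ℝ l (E d) G).symm
      (sndIteratedFDeriv l (sndFDeriv a)) z (h, 0)).symm

theorem sndIteratedFDeriv_fstFDeriv (l : ℕ) {a : E d × E d → G} (ha : ContDiff ℝ (⊤ : ℕ∞) a) :
    sndIteratedFDeriv l (fstFDeriv a) =
      ContinuousLinearMap.flipMultilinearEquiv ℝ (fun _ : Fin l => E d) (E d) G ∘
        fstFDeriv (sndIteratedFDeriv l a) := by
  ext z m h
  have := congrArg (fun t => t m) (sndIteratedFDeriv_fstFDeriv_apply l ha h z)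
  have h2 : sndIteratedFDeriv l (fun z => fstFDeriv a z h) z m =
      sndIteratedFDeriv l (fstFDeriv a) z m h := by
    have hc : ContDiff ℝ (⊤ : ℕ∞) (fun y => fstFDeriv a (z.1, y)) :=
      (contDiff_fstFDeriv ha).comp (by fun_prop)
    have := (ContinuousLinearMap.apply ℝ G h).iteratedFDeriv_comp_left (hc.contDiffAt (x := z.2))
      (i := l) (by exact_mod_cast le_top)
    exact congrArg (fun t => t m) this
  rw [← h2]
  exact this

theorem mixedDeriv_eq (k l : ℕ) (a : E d × E d → G) (x y : E d) :
    mixedDeriv k l a x y = ‖iteratedFDeriv ℝ k (fun x' => sndIteratedFDeriv l a (x', y)) x‖ := rfl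

theorem mixedDeriv_sndFDeriv (k l : ℕ) {a : E d × E d → G} (ha : ContDiff ℝ (⊤ : ℕ∞) a)
    (x y : E d) : mixedDeriv k l (sndFDeriv a) x y = mixedDeriv k (l + 1) a x y := by
  rw [mixedDeriv_eq, mixedDeriv_eq, sndIteratedFDeriv_succ l ha]
  have h := norm_iteratedFDeriv_isometry_comp (X := E d [×l]→L[ℝ] E d →L[ℝ] G)
    (Y := E d [×(l + 1)]→L[ℝ] G) (continuousMultilinearCurryRightEquiv' ℝ l (E d) G).symm k
    (fun x' => sndIteratedFDeriv l (sndFDeriv a) (x', y)) x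
  rw [← h]
  rfl

/-- In `mixedDeriv` the ξ-derivatives are taken first, so the extra x-derivative must be moved past
them. This exchange flips the arguments of a multilinear map, which costs only a constant. -/
theorem exists_mixedDeriv_fstFDeriv_le (d k l : ℕ) (G : Type) [NormedAddCommGroup G]
    [NormedSpace ℝ G] : ∃ C : ℝ, 0 ≤ C ∧ ∀ (a : E d × E d → G), ContDiff ℝ (⊤ : ℕ∞) a → ∀ x y,
      mixedDeriv k l (fstFDeriv a) x y ≤ C * mixedDeriv (k + 1) l a x y := by
  obtain ⟨C, hC0, hC⟩ := exists_norm_iteratedFDeriv_comp_left_le (D := E d)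
    (X := E d →L[ℝ] E d [×l]→L[ℝ] G) (Y := E d [×l]→L[ℝ] E d →L[ℝ] G)
    (ContinuousLinearMap.flipMultilinearEquiv ℝ (fun _ : Fin l => E d) (E d)
      G).toContinuousLinearMap
  refine ⟨C, hC0, fun a ha x y => ?_⟩
  have hs := contDiff_sndIteratedFDeriv l ha
  rw [mixedDeriv_eq, mixedDeriv_eq, sndIteratedFDeriv_fstFDeriv l ha, ← norm_iteratedFDeriv_fderiv]
  have e : fderiv ℝ (fun x' => sndIteratedFDeriv l a (x', y)) =
      fun x' => fstFDeriv (sndIteratedFDeriv l a) (x', y) :=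
    funext fun x' => (hasFDerivAt_slice_fst hs x' y).fderiv
  rw [e]
  have hc : ContDiff ℝ (⊤ : ℕ∞) (fun x' => fstFDeriv (sndIteratedFDeriv l a) (x', y)) :=
    (contDiff_fstFDeriv hs).comp (by fun_prop)
  exact hC k _ hc x

/-- Symbol classes are defined by mixed partial derivatives, oscillatory integrals are estimated by
total ones. The first total derivative is the sum of the two partial derivatives, and the induction
hypothesis applies to each, with the target enlarged to linear maps. -/
theorem exists_norm_iteratedFDeriv_le_of_mixedDeriv_le (d n : ℕ) : ∀ (G : Type)
    [NormedAddCommGroup G] [NormedSpace ℝ G], ∃ C : ℝ, 0 ≤ C ∧ ∀ (a : E d × E d → G),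
      ContDiff ℝ (⊤ : ℕ∞) a → ∀ x y R, (∀ k ≤ n, ∀ l ≤ n, mixedDeriv k l a x y ≤ R) →
      ‖iteratedFDeriv ℝ n a (x, y)‖ ≤ C * R := by
  induction n with
  | zero =>
    intro G _ _
    refine ⟨1, zero_le_one, fun a _ x y R h => ?_⟩
    have := h 0 le_rfl 0 le_rfl
    simpa [mixedDeriv] using this
  | succ n ih =>
    intro G _ _
    obtain ⟨C, hC0, hC⟩ := ih (E d →L[ℝ] G)
    choose K hK0 hK using fun k l => exists_mixedDeriv_fstFDeriv_le d k l G
    obtain ⟨C₁, hC₁0, hC₁⟩ := exists_norm_iteratedFDeriv_comp_left_le (D := E d × E d)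
      ((ContinuousLinearMap.compL ℝ (E d × E d) (E d) G).flip
        (ContinuousLinearMap.fst ℝ (E d) (E d)))
    obtain ⟨C₂, hC₂0, hC₂⟩ := exists_norm_iteratedFDeriv_comp_left_le (D := E d × E d)
      ((ContinuousLinearMap.compL ℝ (E d × E d) (E d) G).flip
        (ContinuousLinearMap.snd ℝ (E d) (E d)))
    set S := ∑ k ∈ Finset.range (n + 1), ∑ l ∈ Finset.range (n + 1), K k l with hS
    have hS0 : 0 ≤ S := Finset.sum_nonneg fun k _ => Finset.sum_nonneg fun l _ => hK0 k l
    have hKS : ∀ k ≤ n, ∀ l ≤ n, K k l ≤ S := fun k hk l hl =>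
      (Finset.single_le_sum (f := fun l => K k l) (fun l _ => hK0 k l)
        (Finset.mem_range.2 (Nat.lt_succ_of_le hl))).trans
      (Finset.single_le_sum (f := fun k => ∑ l ∈ Finset.range (n + 1), K k l)
        (fun k _ => Finset.sum_nonneg fun l _ => hK0 k l)
        (Finset.mem_range.2 (Nat.lt_succ_of_le hk)))
    refine ⟨C₁ * (C * S) + C₂ * C, by positivity, fun a ha x y R h => ?_⟩
    have h1 := hC _ (contDiff_fstFDeriv ha) x y (S * R) fun k hk l hl =>
      (hK k l a ha x y).trans <| by
        have h0 := h (k + 1) (by omega) l (by omega)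
        have hR : 0 ≤ mixedDeriv (k + 1) l a x y := norm_nonneg _
        exact mul_le_mul (hKS k hk l hl) h0 hR hS0
    have h2 := hC _ (contDiff_sndFDeriv ha) x y R fun k hk l hl =>
      (mixedDeriv_sndFDeriv k l ha x y).trans_le (h k (by omega) (l + 1) (by omega))
    have h3 := hC₁ n _ (contDiff_fstFDeriv ha) (x, y)
    have h4 := hC₂ n _ (contDiff_sndFDeriv ha) (x, y)
    set f₁ := ⇑((ContinuousLinearMap.compL ℝ (E d × E d) (E d) G).flip
        (ContinuousLinearMap.fst ℝ (E d) (E d))) ∘ fstFDeriv a with hf₁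
    set f₂ := ⇑((ContinuousLinearMap.compL ℝ (E d × E d) (E d) G).flip
        (ContinuousLinearMap.snd ℝ (E d) (E d))) ∘ sndFDeriv a with hf₂
    have c1 : ContDiff ℝ (⊤ : ℕ∞) f₁ := ContinuousLinearMap.contDiff _ |>.comp (contDiff_fstFDeriv ha)
    have c2 : ContDiff ℝ (⊤ : ℕ∞) f₂ := ContinuousLinearMap.contDiff _ |>.comp (contDiff_sndFDeriv ha)
    have e : fderiv ℝ a = f₁ + f₂ := by
      ext1 z
      refine ContinuousLinearMap.ext fun p => ?_
      have hp : p = (p.1, 0) + (0, p.2) := by simp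
      rw [hp, map_add]
      simp [hf₁, hf₂, fstFDeriv, sndFDeriv]
    rw [← norm_iteratedFDeriv_fderiv, e, iteratedFDeriv_add_apply
      (contDiff_infty.1 c1 n).contDiffAt (contDiff_infty.1 c2 n).contDiffAt]
    calc _ ≤ _ := norm_add_le _ _
      _ ≤ C₁ * (C * (S * R)) + C₂ * (C * R) := add_le_add (h3.trans (by gcongr)) (h4.trans (by gcongr))
      _ = _ := by ring

end MixedDerivatives
end FourierBanach

namespace FourierBanach

/-! ### Weak-* density of Schwartz functions in the tempered distributions -/

section WeakDensity

variable {d : ℕ}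

/-- Schwartz functions, as tempered distributions. -/
noncomputable abbrev toTD (d : ℕ) : 𝓢(E d, ℂ) →L[ℂ] 𝓢'(E d, ℂ) :=
  SchwartzMap.toTemperedDistributionCLM (E d) ℂ volume

theorem toTD_apply (ψ φ : 𝓢(E d, ℂ)) : toTD d ψ φ = ∫ x, φ x * ψ x :=
  SchwartzMap.toTemperedDistributionCLM_apply_apply volume ψ φ

theorem eq_zero_of_forall_integral_eq_zero {Φ : 𝓢(E d, ℂ)}
    (h : ∀ ψ : 𝓢(E d, ℂ), ∫ x, ψ x * Φ x = 0) : Φ = 0 := by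
  have h1 : ∀ᵐ x, Φ x = 0 := by
    refine ae_eq_zero_of_integral_contDiff_smul_eq_zero Φ.integrable.locallyIntegrable
      fun g hg hgc => ?_
    have hc : HasCompactSupport (fun x => (g x : ℂ)) := hgc.comp_left (g := ((↑) : ℝ → ℂ)) rfl
    simp_rw [← Complex.coe_smul, smul_eq_mul]
    exact h (hc.toSchwartzMap (Complex.ofRealCLM.contDiff.comp hg))
  have h2 : (Φ : E d → ℂ) = fun _ => 0 :=
    Continuous.ae_eq_iff_eq (μ := (volume : Measure (E d))) Φ.continuous continuous_const |>.1 h1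
  ext x
  exact congrFun h2 x

/-- Continuous functionals on `𝓢'` with its weak-* topology are evaluations. -/
theorem exists_eq_apply_of_continuous (ℓ : 𝓢'(E d, ℂ) →L[ℂ] ℂ) :
    ∃ φ : 𝓢(E d, ℂ), ∀ u, ℓ u = u φ := by
  let ev : 𝓢(E d, ℂ) →ₗ[ℂ] (𝓢'(E d, ℂ) →ₗ[ℂ] ℂ) :=
    LinearMap.mk₂ ℂ (fun φ u => u φ) (fun _ _ _ => map_add _ _ _) (fun _ _ _ => map_smul _ _ _)
      (fun _ _ _ => rfl) (fun _ _ _ => rfl)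
  have h : (ℓ : 𝓢'(E d, ℂ) →ₗ[ℂ] ℂ) ∈ Submodule.span ℂ (Set.range ev) := by
    -- Weak-* continuity means a bound by finitely many |u φᵢ|, and such a bound forces a linear
    -- combination of these evaluations. The evaluations already form a subspace, so one φ suffices.
    rw [LinearMap.mem_span_iff_bound]
    obtain ⟨s, C, -, hC⟩ := Seminorm.bound_of_continuous
      (PointwiseConvergenceCLM.withSeminorms (σ := RingHom.id ℂ) (E := 𝓢(E d, ℂ)) (F := ℂ))
      (ℓ : 𝓢'(E d, ℂ) →ₗ[ℂ] ℂ).toSeminorm (continuous_norm.comp ℓ.continuous)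
    exact ⟨s, C, hC⟩
  rw [← LinearMap.coe_range, Submodule.span_eq, LinearMap.mem_range] at h
  obtain ⟨φ, hφ⟩ := h
  exact ⟨φ, fun u => (DFunLike.congr_fun hφ u).symm⟩

/-- For fixed φ, the functional u ↦ (A₁ u - A₂ u) φ is evaluation at some Schwartz function Φ. It
vanishes on Schwartz functions, so Φ integrates to zero against each of them and is itself zero. -/
theorem clm_ext_of_schwartz {A₁ A₂ : 𝓢'(E d, ℂ) →L[ℂ] 𝓢'(E d, ℂ)}
    (h : ∀ φ, A₁ (toTD d φ) = A₂ (toTD d φ)) : A₁ = A₂ := by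
  ext u φ
  obtain ⟨Φ, hΦ⟩ := exists_eq_apply_of_continuous
    ((PointwiseConvergenceCLM.evalCLM (RingHom.id ℂ) ℂ φ).comp (A₁ - A₂))
  have h0 : Φ = 0 := eq_zero_of_forall_integral_eq_zero fun ψ => by
    have := hΦ (toTD d ψ)
    rw [toTD_apply] at this
    simp_rw [mul_comm (Φ _)] at this
    rw [← this]
    simp [h]
  have := hΦ u
  rw [h0, map_zero] at this
  exact sub_eq_zero.1 this

end WeakDensity

/-! ### Modulations -/

section Modulation

variable {d : ℕ}

/-- The character `x ↦ e^{i⟨x, η⟩}`. -/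
noncomputable def char (η x : E d) : ℂ := Complex.exp (Complex.I * (inner ℝ x η : ℝ))

theorem norm_char (η x : E d) : ‖char η x‖ = 1 := by
  rw [char, mul_comm, Complex.norm_exp_ofReal_mul_I]

theorem char_add_left (η η' x : E d) : char (η + η') x = char η x * char η' x := by
  rw [char, char, char, ← Complex.exp_add, inner_add_right]
  push_cast
  ring_nf

theorem char_zero_left (x : E d) : char 0 x = 1 := by simp [char]

theorem char_neg_mul (η x : E d) : char (-η) x * char η x = 1 := by
  rw [← char_add_left, neg_add_cancel, char_zero_left]

theorem fourierChar_inner (ζ x : E d) : (𝐞 (inner ℝ ζ x) : ℂ) = char ((2 * Real.pi) • ζ) x := by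
  rw [Real.fourierChar_apply, char, inner_smul_right, real_inner_comm]
  push_cast
  ring_nf

/-- Multiplication by `e^{i⟨x, η⟩}` on `𝓢`. -/
noncomputable def modulation (η : E d) : 𝓢(E d, ℂ) →L[ℂ] 𝓢(E d, ℂ) :=
  (FourierTransform.fourierInvCLM ℂ 𝓢(E d, ℂ)).comp
    ((compSubConstCLM ℂ ((2 * Real.pi)⁻¹ • η)).comp (FourierTransform.fourierCLM ℂ 𝓢(E d, ℂ)))

theorem fourier_modulation (η : E d) (φ : 𝓢(E d, ℂ)) :
    𝓕 (modulation η φ) = compSubConstCLM ℂ ((2 * Real.pi)⁻¹ • η) (𝓕 φ) := by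
  simp [modulation]

theorem modulation_apply (η : E d) (φ : 𝓢(E d, ℂ)) (x : E d) :
    modulation η φ x = char η x * φ x := by
  have h1 : modulation η φ x =
      ∫ ξ, (𝐞 (inner ℝ ξ x) : ℂ) • 𝓕 φ (ξ - (2 * Real.pi)⁻¹ • η) := by
    have : modulation η φ x = 𝓕⁻ (compSubConstCLM ℂ ((2 * Real.pi)⁻¹ • η) (𝓕 φ)) x := rfl
    rw [this, SchwartzMap.fourierInv_coe, Real.fourierInv_eq]
    rfl
  have h2 : φ x = ∫ ξ, (𝐞 (inner ℝ ξ x) : ℂ) • 𝓕 φ ξ := by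
    conv_lhs => rw [← FourierTransform.fourierInv_fourier_eq (F := 𝓢(E d, ℂ)) φ]
    rw [SchwartzMap.fourierInv_coe, Real.fourierInv_eq]
    rfl
  rw [h1, h2, ← integral_const_mul,
    ← integral_add_right_eq_self (μ := (volume : Measure (E d))) _ ((2 * Real.pi)⁻¹ • η)]
  refine integral_congr_ae (Filter.Eventually.of_forall fun ξ => ?_)
  simp only [add_sub_cancel_right, smul_eq_mul, fourierChar_inner, smul_add, char_add_left]
  rw [smul_inv_smul₀ (by positivity)]
  ring

theorem schwartzSup_compSubConstCLM_le (m : ℕ × ℕ) (h : E d) (φ : 𝓢(E d, ℂ)) :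
    schwartzSup (E d) ℂ m (compSubConstCLM ℂ h φ) ≤
      2 ^ m.1 * (1 + ‖h‖) ^ m.1 * schwartzSup (E d) ℂ m φ := by
  refine schwartzSup_le (by positivity) fun k hk n hn x => ?_
  have h1 : iteratedFDeriv ℝ n (compSubConstCLM ℂ h φ) x = iteratedFDeriv ℝ n φ (x - h) :=
    iteratedFDeriv_comp_sub n h x
  have h2 := one_add_pow_mul_le_schwartzSup (m := m) le_rfl hn φ (x - h)
  rw [h1]
  have h3 : ‖x‖ ≤ (1 + ‖h‖) * (1 + ‖x - h‖) := by
    have : ‖x‖ ≤ ‖x - h‖ + ‖h‖ := by simpa using norm_add_le (x - h) h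
    nlinarith [norm_nonneg h, norm_nonneg (x - h)]
  calc ‖x‖ ^ k * ‖iteratedFDeriv ℝ n φ (x - h)‖
      ≤ ((1 + ‖h‖) * (1 + ‖x - h‖)) ^ k * ‖iteratedFDeriv ℝ n φ (x - h)‖ := by gcongr
    _ ≤ ((1 + ‖h‖) * (1 + ‖x - h‖)) ^ m.1 * ‖iteratedFDeriv ℝ n φ (x - h)‖ := by
        have : 1 ≤ (1 + ‖h‖) * (1 + ‖x - h‖) := by
          nlinarith [norm_nonneg h, norm_nonneg (x - h)]
        gcongr
    _ = (1 + ‖h‖) ^ m.1 * ((1 + ‖x - h‖) ^ m.1 * ‖iteratedFDeriv ℝ n φ (x - h)‖) := by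
        rw [mul_pow]; ring
    _ ≤ (1 + ‖h‖) ^ m.1 * (2 ^ m.1 * schwartzSup (E d) ℂ m φ) := by gcongr
    _ = _ := by ring

/-- On the Fourier side a modulation is a translation, whose effect on a Schwartz norm is polynomial
in η; the inverse Fourier transform is continuous. -/
theorem exists_schwartzSup_modulation_le (m : ℕ × ℕ) (φ : 𝓢(E d, ℂ)) : ∃ k : ℕ, ∃ C : ℝ, 0 ≤ C ∧
    ∀ η, schwartzSup (E d) ℂ m (modulation η φ) ≤ C * (1 + ‖η‖) ^ k := by
  obtain ⟨m', C, hC, h⟩ := exists_schwartzSup_map_le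
    (FourierTransform.fourierInvCLM ℂ 𝓢(E d, ℂ)) m
  refine ⟨m'.1, C * (2 ^ m'.1 * schwartzSup (E d) ℂ m' (𝓕 φ)), by positivity, fun η => ?_⟩
  refine (h _).trans ?_
  rw [mul_assoc]
  refine mul_le_mul_of_nonneg_left ((schwartzSup_compSubConstCLM_le m' _ (𝓕 φ)).trans ?_) hC
  have : ‖(2 * Real.pi)⁻¹ • η‖ ≤ ‖η‖ := by
    rw [norm_smul, Real.norm_of_nonneg (by positivity)]
    refine mul_le_of_le_one_left (norm_nonneg _) (inv_le_one_of_one_le₀ ?_)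
    nlinarith [Real.pi_gt_three]
  calc _ ≤ 2 ^ m'.1 * (1 + ‖η‖) ^ m'.1 * schwartzSup (E d) ℂ m' (𝓕 φ) := by gcongr
    _ = _ := by ring

theorem fourierS_eq (φ : 𝓢(E d, ℂ)) (ξ : E d) : fourierS d φ ξ =
    (((2 * Real.pi) ^ (-(d : ℝ) / 2) : ℝ) : ℂ) * 𝓕 φ ((2 * Real.pi)⁻¹ • ξ) := rfl

theorem fourierS_modulation (η : E d) (φ : 𝓢(E d, ℂ)) (ξ : E d) :
    fourierS d (modulation η φ) ξ = fourierS d φ (ξ - η) := by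
  rw [fourierS_eq, fourierS_eq, fourier_modulation, compSubConstCLM_apply, smul_sub]

end Modulation

/-! ### Kohn-Nirenberg operators on wave packets -/

section KohnNirenberg

variable {d : ℕ}

/-- The symbol `a`, dilated and translated in the frequency variable. -/
noncomputable def shiftSymbol (a : E d × E d → ℂ) (η : E d) (z : E d × E d) : ℂ :=
  a (z.1, (2 * Real.pi) • z.2 + η)

/-- Substitute ξ = 2πζ + η. The Jacobian cancels the normalization (2π)^{-d}, and the modulation of
φ combines with the phase to e^{i⟨x, η⟩} e^{2πi⟨x - y, ζ⟩}. Modulating the function thus amounts to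
translating the symbol in frequency. -/
theorem opSchwartz_eq_oscInt (a : E d × E d → ℂ) (η : E d) (χ φ : 𝓢(E d, ℂ))
    (hφ : ∀ y, φ y = char η y * χ y) (x : E d) :
    opSchwartz a φ x = char η x * oscInt (shiftSymbol a η) (𝓕 χ) x := by
  set G : E d → ℂ := fun ξ => ∫ y, a (x, ξ) * φ y *
    Complex.exp (Complex.I * (inner ℝ (x - y) ξ : ℝ)) with hG
  have h1 : ∫ ξ, G ξ = ((2 * Real.pi) ^ d : ℝ) * ∫ ζ, G ((2 * Real.pi) • ζ + η) := by
    rw [← integral_add_right_eq_self (μ := (volume : Measure (E d))) G η,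
      Measure.integral_comp_smul volume (fun ξ => G (ξ + η)) (2 * Real.pi), finrank_euclideanSpace,
      Fintype.card_fin, abs_of_nonneg (by positivity), Complex.real_smul, ← mul_assoc]
    rw [← Complex.ofReal_mul, mul_inv_cancel₀ (by positivity), Complex.ofReal_one, one_mul]
  have h2 : ∀ ζ, G ((2 * Real.pi) • ζ + η) =
      char η x * ((𝐞 (inner ℝ ζ x) : ℂ) • (𝓕 χ ζ • shiftSymbol a η (x, ζ))) := by
    intro ζ
    have e : 𝓕 χ ζ = ∫ y, char (-((2 * Real.pi) • ζ)) y * χ y := by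
      rw [SchwartzMap.fourier_coe, Real.fourier_eq]
      refine integral_congr_ae (Filter.Eventually.of_forall fun y => ?_)
      simp only [Circle.smul_def, smul_eq_mul]
      rw [← inner_neg_right, real_inner_comm, fourierChar_inner, smul_neg]
    rw [hG, e, fourierChar_inner, shiftSymbol]
    simp only [smul_eq_mul]
    rw [← integral_mul_const, ← integral_const_mul, ← integral_const_mul]
    refine integral_congr_ae (Filter.Eventually.of_forall fun y => ?_)
    simp only
    have e2 : Complex.exp (Complex.I * (inner ℝ (x - y) ((2 * Real.pi) • ζ + η) : ℝ)) =
        char ((2 * Real.pi) • ζ) x * char η x * (char (-((2 * Real.pi) • ζ)) y * char (-η) y) := by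
      rw [← char_add_left, ← char_add_left, ← neg_add, char, char, ← Complex.exp_add,
        inner_sub_left, inner_neg_right]
      push_cast
      ring_nf
    rw [e2, hφ]
    have := char_neg_mul η y
    linear_combination (a (x, (2 * Real.pi) • ζ + η) * χ y * char ((2 * Real.pi) • ζ) x *
      char η x * char (-((2 * Real.pi) • ζ)) y) * this
  have h3 : opSchwartz a φ x = ((((2 * Real.pi) ^ d)⁻¹ : ℝ) : ℂ) * ∫ ξ, G ξ := rfl
  have h4 : ∫ ζ, G ((2 * Real.pi) • ζ + η) = char η x * oscInt (shiftSymbol a η) (𝓕 χ) x := by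
    simp_rw [h2]
    exact integral_const_mul _ _
  rw [h3, h1, h4, ← mul_assoc, ← Complex.ofReal_mul, inv_mul_cancel₀ (by positivity),
    Complex.ofReal_one, one_mul]

end KohnNirenberg
end FourierBanach

namespace FourierBanach

/-! ### Weights and uniform bounds for translated symbols -/

section Weights

variable {d : ℕ}

theorem IsWeight.exists_moderate {F : Type*} [NormedAddCommGroup F] [MeasurableSpace F] {ω : F → ℝ}
    (hω : IsWeight ω) : ∃ C : ℝ, ∃ N : ℕ, 0 ≤ C ∧ ∀ x y, ω (x + y) ≤ C * ω x * (1 + ‖y‖) ^ N := by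
  obtain ⟨N, C, h⟩ := hω.moderate
  have hC : 0 ≤ C := by
    have h0 := h 0 0
    have := hω.pos 0
    simp only [add_zero, norm_zero, ne_eq, OfNat.ofNat_ne_zero, not_false_eq_true, zero_pow,
      one_pow, mul_one] at h0
    nlinarith
  refine ⟨C, 2 * N, hC, fun x y => (h x y).trans ?_⟩
  have := (hω.pos x).le
  refine mul_le_mul_of_nonneg_left ?_ (by positivity)
  rw [pow_mul]
  refine pow_le_pow_left₀ (by positivity) ?_ N
  nlinarith [norm_nonneg y]

theorem one_le_bracket (ξ : E d) : 1 ≤ bracket ξ := by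
  rw [bracket, Real.one_le_sqrt]
  nlinarith [sq_nonneg ‖ξ‖]

/-- The factor ⟨ξ⟩^{-ρn} is at most 1 and is discarded here. Its decay becomes essential only for
pseudo-locality, in `IsSymbol.exists_norm_iteratedFDeriv_slice_le`. -/
theorem IsSymbol.mixedDeriv_le {ρ : ℝ} (hρ : 0 < ρ) {ω₀ : E d × E d → ℝ} (hω₀ : IsWeight ω₀)
    {a : E d × E d → ℂ} (ha : IsSymbol ρ 0 ω₀ a) (m n : ℕ) :
    ∃ C : ℝ, 0 ≤ C ∧ ∀ x ξ, mixedDeriv m n a x ξ ≤ C * ω₀ (x, ξ) := by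
  obtain ⟨C, hC⟩ := ha.bound m n
  refine ⟨|C|, abs_nonneg C, fun x ξ => (hC x ξ).trans ?_⟩
  have h1 : bracket ξ ^ (-ρ * n + 0 * m) ≤ 1 :=
    Real.rpow_le_one_of_one_le_of_nonpos (one_le_bracket ξ) (by
      have : 0 ≤ ρ * n := by positivity
      linarith)
  have h2 : 0 ≤ bracket ξ ^ (-ρ * n + 0 * m) :=
    Real.rpow_nonneg (zero_le_one.trans (one_le_bracket ξ)) _
  have h3 := (hω₀.pos (x, ξ)).le
  calc C * ω₀ (x, ξ) * bracket ξ ^ (-ρ * n + 0 * m)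
      ≤ |C| * ω₀ (x, ξ) * bracket ξ ^ (-ρ * n + 0 * m) := by gcongr; exact le_abs_self C
    _ ≤ |C| * ω₀ (x, ξ) * 1 := by gcongr
    _ = _ := mul_one _

theorem IsSymbol.norm_iteratedFDeriv_le {ρ : ℝ} (hρ : 0 < ρ) {ω₀ : E d × E d → ℝ}
    (hω₀ : IsWeight ω₀) {a : E d × E d → ℂ} (ha : IsSymbol ρ 0 ω₀ a) (r : ℕ) :
    ∃ C : ℝ, 0 ≤ C ∧ ∀ i ≤ r, ∀ x ξ, ‖iteratedFDeriv ℝ i a (x, ξ)‖ ≤ C * ω₀ (x, ξ) := by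
  choose K hK0 hK using fun m n => ha.mixedDeriv_le hρ hω₀ m n
  choose D hD0 hD using fun i => exists_norm_iteratedFDeriv_le_of_mixedDeriv_le d i ℂ
  set S := ∑ k ∈ Finset.range (r + 1), ∑ l ∈ Finset.range (r + 1), K k l with hS
  have hS0 : 0 ≤ S := Finset.sum_nonneg fun k _ => Finset.sum_nonneg fun l _ => hK0 k l
  have hKS : ∀ k ≤ r, ∀ l ≤ r, K k l ≤ S := fun k hk l hl =>
    (Finset.single_le_sum (f := fun l => K k l) (fun l _ => hK0 k l)
      (Finset.mem_range.2 (Nat.lt_succ_of_le hl))).trans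
    (Finset.single_le_sum (f := fun k => ∑ l ∈ Finset.range (r + 1), K k l)
      (fun k _ => Finset.sum_nonneg fun l _ => hK0 k l)
      (Finset.mem_range.2 (Nat.lt_succ_of_le hk)))
  refine ⟨(∑ i ∈ Finset.range (r + 1), D i) * S,
    mul_nonneg (Finset.sum_nonneg fun i _ => hD0 i) hS0, fun i hi x ξ => ?_⟩
  have hp := (hω₀.pos (x, ξ)).le
  refine (hD i a ha.smooth x ξ (S * ω₀ (x, ξ)) fun k hk l hl => (hK k l x ξ).trans ?_).trans ?_
  · have := hKS k (hk.trans hi) l (hl.trans hi)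
    gcongr
  · rw [← mul_assoc]
    gcongr
    exact Finset.single_le_sum (f := D) (fun i _ => hD0 i) (Finset.mem_range.2 (Nat.lt_succ_of_le hi))

theorem contDiff_shiftSymbol {a : E d × E d → ℂ} (ha : ContDiff ℝ (⊤ : ℕ∞) a) (η : E d) :
    ContDiff ℝ (⊤ : ℕ∞) (shiftSymbol a η) := by
  unfold shiftSymbol
  fun_prop

theorem one_add_norm_prod_le {F G : Type*} [NormedAddCommGroup F] [NormedAddCommGroup G] (x : F)
    (y : G) : 1 + ‖(x, y)‖ ≤ (1 + ‖x‖) * (1 + ‖y‖) := by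
  rw [Prod.norm_mk]
  have := norm_nonneg x
  have := norm_nonneg y
  have := max_le_add_of_nonneg (norm_nonneg x) (norm_nonneg y)
  nlinarith [mul_nonneg (norm_nonneg x) (norm_nonneg y)]

theorem norm_iteratedFDeriv_shiftSymbol_le {a : E d × E d → ℂ} (ha : ContDiff ℝ (⊤ : ℕ∞) a)
    (η : E d) (i : ℕ) (x ζ : E d) : ‖iteratedFDeriv ℝ i (shiftSymbol a η) (x, ζ)‖ ≤
      (2 * Real.pi) ^ i * ‖iteratedFDeriv ℝ i a (x, (2 * Real.pi) • ζ + η)‖ := by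
  set L : E d × E d →L[ℝ] E d × E d := (ContinuousLinearMap.fst ℝ (E d) (E d)).prod
    ((2 * Real.pi) • ContinuousLinearMap.snd ℝ (E d) (E d)) with hL
  have h1 : shiftSymbol a η = (fun z => a (z + (0, η))) ∘ L := by
    ext z
    simp [shiftSymbol, hL]
  have h2 : ContDiff ℝ (⊤ : ℕ∞) (fun z : E d × E d => a (z + (0, η))) := by fun_prop
  have hn : ‖L‖ ≤ 2 * Real.pi := by
    refine ContinuousLinearMap.opNorm_le_bound _ (by positivity) fun z => ?_
    have h1 := norm_fst_le z
    have h2 := norm_snd_le z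
    have hp := Real.pi_gt_three
    have : L z = (z.1, (2 * Real.pi) • z.2) := by simp [hL]
    rw [this, Prod.norm_mk, norm_smul, Real.norm_of_nonneg (by positivity)]
    refine max_le ?_ (by gcongr)
    nlinarith [norm_nonneg z]
  rw [h1, ContinuousLinearMap.iteratedFDeriv_comp_right _ h2 _ (i := i) (by exact_mod_cast le_top),
    iteratedFDeriv_comp_add_right]
  refine (ContinuousMultilinearMap.norm_compContinuousLinearMap_le _ _).trans ?_
  rw [Finset.prod_const, Finset.card_univ, Fintype.card_fin, mul_comm]
  have e : L (x, ζ) + (0, η) = (x, (2 * Real.pi) • ζ + η) := by simp [hL]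
  rw [e]
  gcongr

/-- The symbol class is translation invariant, uniformly up to the size of the weight. -/
theorem IsSymbol.exists_symBound {ρ : ℝ} (hρ : 0 < ρ) {ω₀ : E d × E d → ℝ}
    (hω₀ : IsWeight ω₀) {a : E d × E d → ℂ} (ha : IsSymbol ρ 0 ω₀ a) :
    ∃ M : ℕ, ∀ r : ℕ, ∃ C : ℝ, 0 ≤ C ∧ ∀ η, SymBound M r (C * ω₀ (0, η)) (shiftSymbol a η) := by
  obtain ⟨C, N, hC0, hC⟩ := hω₀.exists_moderate
  refine ⟨N, fun r => ?_⟩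
  obtain ⟨D, hD0, hD⟩ := ha.norm_iteratedFDeriv_le hρ hω₀ r
  refine ⟨(2 * Real.pi) ^ r * (D * (C * (2 * Real.pi) ^ N)), by positivity, fun η i hi x ζ => ?_⟩
  have hp := Real.pi_gt_three
  have h0 := (hω₀.pos (0, η)).le
  have h1 : ω₀ (x, (2 * Real.pi) • ζ + η) ≤
      C * ω₀ (0, η) * ((2 * Real.pi) ^ N * ((1 + ‖x‖) ^ N * (1 + ‖ζ‖) ^ N)) := by
    have := hC (0, η) (x, (2 * Real.pi) • ζ)
    rw [Prod.mk_add_mk, zero_add, add_comm η] at this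
    refine this.trans ?_
    have h3 : 1 + ‖((x, (2 * Real.pi) • ζ) : E d × E d)‖ ≤
        (2 * Real.pi) * ((1 + ‖x‖) * (1 + ‖ζ‖)) := by
      refine (one_add_norm_prod_le _ _).trans ?_
      rw [norm_smul, Real.norm_of_nonneg (by positivity)]
      have : 1 + 2 * Real.pi * ‖ζ‖ ≤ 2 * Real.pi * (1 + ‖ζ‖) := by nlinarith [norm_nonneg ζ]
      calc (1 + ‖x‖) * (1 + 2 * Real.pi * ‖ζ‖) ≤ (1 + ‖x‖) * (2 * Real.pi * (1 + ‖ζ‖)) := by gcongr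
        _ = _ := by ring
    rw [← mul_pow, ← mul_pow]
    gcongr
  have h4 : (2 * Real.pi) ^ i ≤ (2 * Real.pi) ^ r := by
    gcongr
    linarith
  calc ‖iteratedFDeriv ℝ i (shiftSymbol a η) (x, ζ)‖
      ≤ (2 * Real.pi) ^ i * ‖iteratedFDeriv ℝ i a (x, (2 * Real.pi) • ζ + η)‖ :=
        norm_iteratedFDeriv_shiftSymbol_le ha.smooth η i x ζ
    _ ≤ (2 * Real.pi) ^ r * (D * (C * ω₀ (0, η) *
          ((2 * Real.pi) ^ N * ((1 + ‖x‖) ^ N * (1 + ‖ζ‖) ^ N)))) := by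
        gcongr
        exact (hD i hi _ _).trans (by gcongr)
    _ = _ := by ring

end Weights

/-! ### Extension to tempered distributions by duality -/

section Extension

variable {d : ℕ} {V : Type} [NormedAddCommGroup V] [NormedSpace ℂ V]

theorem IsAmplitude.swap {M : ℕ} {b : E d × E d → V} (hb : IsAmplitude M b) :
    IsAmplitude M (b ∘ Prod.swap) where
  smooth := hb.smooth.comp (contDiff_snd.prodMk contDiff_fst)
  bound r := by
    obtain ⟨A, hA⟩ := hb.bound r
    refine ⟨A, fun i hi x ξ => ?_⟩
    have h := (LinearIsometryEquiv.prodComm ℝ (E d) (E d)).norm_iteratedFDeriv_comp_right b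
      (x, ξ) i
    rw [mul_comm (_ ^ M)]
    exact h.le.trans (hA i hi ξ x)

theorem schwartzSup_eq (m : ℕ × ℕ) (f : 𝓢(E d, V)) :
    schwartzSup (E d) V m f = (Finset.Iic m).sup (schwartzSeminormFamily ℂ (E d) V) f := by
  rw [schwartzSup, Seminorm.finset_sup_apply, Seminorm.finset_sup_apply]
  rfl

/-- `g ↦ oscSchwartz hb g` as a continuous linear map. -/
noncomputable def oscCLM [CompleteSpace V] {M : ℕ} {b : E d × E d → V} (hb : IsAmplitude M b) :
    𝓢(E d, ℂ) →L[ℂ] 𝓢(E d, V) :=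
  mkCLM (oscInt b)
    (fun f g x => by
      rw [oscInt, oscInt, oscInt, ← integral_add (integrable_oscInt hb f x)
        (integrable_oscInt hb g x)]
      simp [add_smul])
    (fun c f x => by
      rw [oscInt, oscInt, RingHom.id_apply, ← integral_smul]
      simp only [smul_apply, smul_smul, smul_eq_mul]
      congr 1
      ext1 ξ
      ring_nf)
    (fun g => contDiff_oscInt hb g)
    (fun n => by
      obtain ⟨r, m, K, hK0, hK⟩ := norm_iteratedFDeriv_oscInt_le d n.2 V n.1 M
      obtain ⟨A, hA⟩ := hb.bound r
      have hA0 := hA.nonneg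
      refine ⟨Finset.Iic m, K * A, by positivity, fun f x => ?_⟩
      rw [← schwartzSup_eq]
      refine le_trans ?_ (hK b hb A hA f x)
      gcongr
      linarith [norm_nonneg x])

theorem oscCLM_apply [CompleteSpace V] {M : ℕ} {b : E d × E d → V} (hb : IsAmplitude M b)
    (g : 𝓢(E d, ℂ)) (x : E d) : oscCLM hb g x = oscInt b g x := rfl

/-- Fubini: the phase is symmetric in the two variables, so transposition only exchanges the
variables of the amplitude, and the class of amplitudes is invariant under this exchange. -/
theorem integral_mul_oscInt {M : ℕ} {b : E d × E d → ℂ} (hb : IsAmplitude M b)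
    (g h : 𝓢(E d, ℂ)) :
    ∫ x, g x * oscInt b h x = ∫ ζ, h ζ * oscInt (b ∘ Prod.swap) g ζ := by
  obtain ⟨A, hA⟩ := hb.bound 0
  have hint : Integrable (Function.uncurry fun x ζ : E d =>
      g x * ((𝐞 (inner ℝ ζ x) : ℂ) • (h ζ • b (x, ζ)))) (volume.prod volume) := by
    refine (((integrable_one_add_pow_mul g M).mul_prod (integrable_one_add_pow_mul h M)).const_mul
      A).mono' ?_ (Filter.Eventually.of_forall fun p => ?_)
    · have : Continuous (Function.uncurry fun x ζ : E d =>
          g x * ((𝐞 (inner ℝ ζ x) : ℂ) • (h ζ • b (x, ζ)))) := by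
        have := hb.smooth.continuous
        have h2 := Real.continuous_fourierChar
        have h3 : Continuous fun p : E d × E d => g p.1 := g.continuous.comp continuous_fst
        have h4 : Continuous fun p : E d × E d => h p.2 := h.continuous.comp continuous_snd
        have h5 : Continuous fun p : E d × E d => (𝐞 (inner ℝ p.2 p.1) : ℂ) := by fun_prop
        exact h3.mul (h5.smul (h4.smul this))
      exact this.aestronglyMeasurable
    · simp only [Function.uncurry, norm_mul, norm_smul, Circle.norm_coe, one_mul]
      have := hA.norm_le p.1 p.2
      calc ‖g p.1‖ * (‖h p.2‖ * ‖b (p.1, p.2)‖)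
          ≤ ‖g p.1‖ * (‖h p.2‖ * (A * ((1 + ‖p.1‖) ^ M * (1 + ‖p.2‖) ^ M))) := by gcongr
        _ = _ := by ring
  calc ∫ x, g x * oscInt b h x
      = ∫ x, ∫ ζ, g x * ((𝐞 (inner ℝ ζ x) : ℂ) • (h ζ • b (x, ζ))) := by
        simp_rw [oscInt, ← integral_const_mul]
    _ = ∫ ζ, ∫ x, g x * ((𝐞 (inner ℝ ζ x) : ℂ) • (h ζ • b (x, ζ))) := integral_integral_swap hint
    _ = _ := by
        simp_rw [oscInt, ← integral_const_mul]
        refine integral_congr_ae (Filter.Eventually.of_forall fun ζ =>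
          integral_congr_ae (Filter.Eventually.of_forall fun x => ?_))
        simp only [Function.comp_apply, Prod.swap_prod_mk, smul_eq_mul, real_inner_comm]
        ring

theorem opSchwartz_eq_oscInt_zero (a : E d × E d → ℂ) (φ : 𝓢(E d, ℂ)) (x : E d) :
    opSchwartz a φ x = oscInt (shiftSymbol a 0) (𝓕 φ) x := by
  simpa [char_zero_left] using opSchwartz_eq_oscInt a 0 φ φ (fun y => by simp [char_zero_left]) x

/-- Pseudo-differential operators with polynomially bounded symbols extend uniquely to `𝓢'`. -/
theorem existsUnique_extendsOp {M : ℕ} {a : E d × E d → ℂ} (hb : IsAmplitude M (shiftSymbol a 0)) :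
    ∃! A : 𝓢'(E d, ℂ) →L[ℂ] 𝓢'(E d, ℂ), ExtendsOp a A := by
  -- On 𝓢 the operator is the Fourier transform followed by the oscillatory integral. Its transpose
  -- is the swapped oscillatory integral followed by the Fourier transform, and the extension is
  -- precomposition with that transpose.
  refine ⟨PointwiseConvergenceCLM.precomp ℂ
    ((FourierTransform.fourierCLM ℂ 𝓢(E d, ℂ)).comp (oscCLM hb.swap)), fun φ => ?_, ?_⟩
  · refine ⟨oscCLM hb (𝓕 φ), fun x => (opSchwartz_eq_oscInt_zero a φ x).symm, ?_⟩
    ext θ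
    have e1 : PointwiseConvergenceCLM.precomp ℂ ((FourierTransform.fourierCLM ℂ 𝓢(E d, ℂ)).comp
        (oscCLM hb.swap)) (toTD d φ) θ = toTD d φ (𝓕 (oscCLM hb.swap θ)) := rfl
    rw [e1, toTD_apply, toTD_apply, SchwartzMap.integral_fourier_mul_eq]
    simp_rw [oscCLM_apply]
    rw [integral_mul_oscInt hb]
    simp_rw [mul_comm (oscInt _ _ _)]
  · intro A hA
    refine clm_ext_of_schwartz fun φ => ?_
    obtain ⟨ψ, hψ, h⟩ := hA φ
    rw [h]
    ext θ
    have e1 : PointwiseConvergenceCLM.precomp ℂ ((FourierTransform.fourierCLM ℂ 𝓢(E d, ℂ)).comp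
        (oscCLM hb.swap)) (toTD d φ) θ = toTD d φ (𝓕 (oscCLM hb.swap θ)) := rfl
    rw [e1, toTD_apply, toTD_apply, SchwartzMap.integral_fourier_mul_eq]
    simp_rw [oscCLM_apply, hψ, opSchwartz_eq_oscInt_zero]
    rw [integral_mul_oscInt hb]
    simp_rw [mul_comm (oscInt _ _ _)]

theorem IsSymbol.isAmplitude {ρ : ℝ} (hρ : 0 < ρ) {ω₀ : E d × E d → ℝ}
    (hω₀ : IsWeight ω₀) {a : E d × E d → ℂ} (ha : IsSymbol ρ 0 ω₀ a) :
    ∃ M : ℕ, (∀ r : ℕ, ∃ C : ℝ, 0 ≤ C ∧ ∀ η, SymBound M r (C * ω₀ (0, η)) (shiftSymbol a η)) ∧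
      ∀ η, IsAmplitude M (shiftSymbol a η) := by
  obtain ⟨M, hM⟩ := ha.exists_symBound hρ hω₀
  exact ⟨M, hM, fun η => ⟨contDiff_shiftSymbol ha.smooth η, fun r => by
    obtain ⟨C, -, hC⟩ := hM r
    exact ⟨_, hC η⟩⟩⟩

end Extension
end FourierBanach

namespace FourierBanach

/-! ### Summation over lattices -/

section Lattice

variable {d : ℕ}

/-- The points of the lattice `c ℤ^d`. -/
noncomputable def latticePt (c : ℝ) (m : Fin d → ℤ) : E d := WithLp.toLp 2 fun i => c * m i

theorem latticePt_apply (c : ℝ) (m : Fin d → ℤ) (i : Fin d) : latticePt c m i = c * m i := rfl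

theorem summable_prod_pi {f : ℤ → ℝ} (hf0 : ∀ j, 0 ≤ f j) (hf : Summable f) (d : ℕ) :
    Summable fun m : Fin d → ℤ => ∏ i, f (m i) := by
  refine summable_of_sum_le (c := ∏ _i : Fin d, ∑' j, f j)
    (fun m => Finset.prod_nonneg fun i _ => hf0 _) fun s => ?_
  let t : Fin d → Finset ℤ := fun i => s.image fun m => m i
  have hs : s ⊆ Fintype.piFinset t := fun m hm =>
    Fintype.mem_piFinset.2 fun i => Finset.mem_image_of_mem _ hm
  have h1 : ∑ m ∈ s, ∏ i, f (m i) ≤ ∑ m ∈ Fintype.piFinset t, ∏ i, f (m i) :=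
    Finset.sum_le_sum_of_subset_of_nonneg hs fun m _ _ => Finset.prod_nonneg fun i _ => hf0 _
  have h2 : ∏ i, ∑ j ∈ t i, f j = ∑ m ∈ Fintype.piFinset t, ∏ i, f (m i) :=
    Finset.prod_univ_sum t fun _ j => f j
  rw [← h2] at h1
  exact h1.trans (Finset.prod_le_prod (fun i _ => Finset.sum_nonneg fun j _ => hf0 j)
    fun i _ => hf.sum_le_tsum _ fun j _ => hf0 j)

/-- The power 2d dominates the product of the factors (1 + |xᵢ|)² over the coordinates, which
reduces the claim to a product of one-dimensional series. -/
theorem summable_latticePt {c : ℝ} (hc : 0 < c) {K : ℕ} (hK : 2 * d ≤ K) :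
    Summable fun m : Fin d → ℤ => ((1 + ‖latticePt c m‖) ^ K)⁻¹ := by
  have h1 : Summable fun j : ℤ => ((1 + |c * j|) ^ 2)⁻¹ := by
    have h := (Real.summable_one_div_int_pow.2 one_lt_two).mul_left (c ^ 2)⁻¹
    refine Summable.of_norm_bounded_eventually h ?_
    filter_upwards [(Set.finite_singleton (0 : ℤ)).compl_mem_cofinite] with j hj
    have hj : (j : ℝ) ≠ 0 := by simpa using hj
    rw [Real.norm_of_nonneg (by positivity), one_div, ← mul_inv, ← mul_pow]
    rw [← sq_abs (c * j)]
    have : 0 < |c * j| := by positivity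
    gcongr
    linarith
  refine (summable_prod_pi (fun j => by positivity) h1 d).of_nonneg_of_le
    (fun m => by positivity) fun m => ?_
  rw [Finset.prod_inv_distrib]
  refine inv_anti₀ (Finset.prod_pos fun i _ => by positivity) ?_
  calc ∏ i, (1 + |c * m i|) ^ 2 ≤ ∏ _i : Fin d, (1 + ‖latticePt c m‖) ^ 2 := by
        refine Finset.prod_le_prod (fun i _ => by positivity) fun i _ => ?_
        have : |c * m i| ≤ ‖latticePt c m‖ := PiLp.norm_apply_le (latticePt c m) i
        gcongr
    _ = (1 + ‖latticePt c m‖) ^ (2 * d) := by simp [pow_mul]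
    _ ≤ _ := pow_le_pow_right₀ (by linarith [norm_nonneg (latticePt c m)]) hK

end Lattice

/-! ### Fourier series of functions supported in a cube -/

section FourierSeries

/-- The representative in `(-1/2, 1/2]`. -/
noncomputable def centralRep (t : UnitAddCircle) : ℝ := (AddCircle.equivIoc (1 : ℝ) (-(1 / 2)) t : ℝ)

theorem coe_centralRep (t : UnitAddCircle) : (centralRep t : UnitAddCircle) = t :=
  AddCircle.coe_equivIoc

theorem centralRep_coe {x : ℝ} (hx : x ∈ Set.Ioc (-(1 / 2) : ℝ) (1 / 2)) :
    centralRep (x : UnitAddCircle) = x := by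
  rw [centralRep, AddCircle.equivIoc_coe_of_mem]
  norm_num at hx ⊢
  exact hx

theorem continuousAt_centralRep {t : UnitAddCircle} (ht : t ≠ ((-(1 / 2) : ℝ) : UnitAddCircle)) :
    ContinuousAt centralRep t :=
  continuous_subtype_val.continuousAt.comp (AddCircle.continuousAt_equivIoc 1 (-(1 / 2)) ht)

/-- The representative jumps only at the class of 1/2. Near a point of the torus with such a
coordinate the function vanishes, because u lives in the cube |xᵢ| ≤ 1/4. -/
theorem continuous_comp_centralRep {d : ℕ} {u : (Fin d → ℝ) → ℂ} (hu : Continuous u)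
    (hsupp : ∀ x, u x ≠ 0 → ∀ i, |x i| ≤ 1 / 4) :
    Continuous fun t : UnitAddTorus (Fin d) => u fun i => centralRep (t i) := by
  rw [continuous_iff_continuousAt]
  intro t
  by_cases ht : ∀ i, t i ≠ ((-(1 / 2) : ℝ) : UnitAddCircle)
  · refine hu.continuousAt.comp (continuousAt_pi.2 fun i => ?_)
    exact ContinuousAt.comp (x := t) (f := fun s : UnitAddTorus (Fin d) => s i)
      (continuousAt_centralRep (ht i)) (continuous_apply i).continuousAt
  · push Not at ht
    obtain ⟨i, hi⟩ := ht
    set K : Set UnitAddCircle := (fun x : ℝ => (x : UnitAddCircle)) '' Set.Icc (-(1 / 4)) (1 / 4)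
    have hK : IsClosed K := (isCompact_Icc.image (AddCircle.continuous_mk' 1)).isClosed
    have htK : t i ∉ K := by
      rintro ⟨x, hx, hxt⟩
      have h1 := centralRep_coe (x := x) ⟨by linarith [hx.1], by linarith [hx.2]⟩
      have h2 : ((-(1 / 2) : ℝ) : UnitAddCircle) = ((1 / 2 : ℝ) : UnitAddCircle) := by
        have := AddCircle.coe_add_period (1 : ℝ) (-(1 / 2))
        rw [← this]
        norm_num
      have h3 := centralRep_coe (x := 1 / 2) ⟨by norm_num, le_rfl⟩
      simp only at hxt
      rw [hxt, hi, h2, h3] at h1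
      linarith [hx.2]
    have hev : ∀ᶠ s in nhds t, s i ∉ K :=
      (continuous_apply i).continuousAt.eventually (hK.isOpen_compl.mem_nhds htK)
    have h0 : ∀ᶠ s in nhds t, u (fun i => centralRep (s i)) = 0 := by
      filter_upwards [hev] with s hs
      by_contra hne
      refine hs ⟨centralRep (s i), abs_le.1 (hsupp _ hne i), coe_centralRep _⟩
    exact (continuousAt_const (y := (0 : ℂ))).congr (h0.mono fun s hs => hs.symm)

theorem mFourier_coe {d : ℕ} (n : Fin d → ℤ) (x : Fin d → ℝ) :
    UnitAddTorus.mFourier n (fun i => (x i : UnitAddCircle)) =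
      Complex.exp (2 * Real.pi * Complex.I * ∑ i, (n i : ℂ) * x i) := by
  rw [UnitAddTorus.mFourier, ContinuousMap.coe_mk, Finset.mul_sum, Complex.exp_sum]
  refine Finset.prod_congr rfl fun i _ => ?_
  rw [fourier_coe_apply]
  congr 1
  push_cast
  ring

/-- The function u is transplanted to the torus, where its Fourier coefficients are the integrals
over ℝ^d. Their summability upgrades convergence of the Fourier series from L² to pointwise. -/
theorem hasSum_fourier_pi {d : ℕ} {u : (Fin d → ℝ) → ℂ} (hu : Continuous u)
    (hsupp : ∀ x, u x ≠ 0 → ∀ i, |x i| ≤ 1 / 4)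
    (hsum : Summable fun n : Fin d → ℤ =>
      ∫ y, Complex.exp (-(2 * Real.pi * Complex.I * ∑ i, (n i : ℂ) * y i)) * u y)
    {x : Fin d → ℝ} (hx : ∀ i, |x i| ≤ 1 / 4) :
    HasSum (fun n : Fin d → ℤ =>
      (∫ y, Complex.exp (-(2 * Real.pi * Complex.I * ∑ i, (n i : ℂ) * y i)) * u y) *
        Complex.exp (2 * Real.pi * Complex.I * ∑ i, (n i : ℂ) * x i)) (u x) := by
  let f : C(UnitAddTorus (Fin d), ℂ) :=
    ⟨fun t => u fun i => centralRep (t i), continuous_comp_centralRep hu hsupp⟩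
  have hf : ∀ y : Fin d → ℝ, (∀ i, y i ∈ Set.Ioc (-(1 / 2) : ℝ) (-(1 / 2) + 1)) →
      f (fun i => (y i : UnitAddCircle)) = u y := fun y hy => by
    change u (fun i => centralRep (y i : UnitAddCircle)) = u y
    congr 1
    ext1 i
    exact centralRep_coe (by have := hy i; norm_num at this ⊢; exact this)
  have hcoef : ∀ n, UnitAddTorus.mFourierCoeff f n =
      ∫ y, Complex.exp (-(2 * Real.pi * Complex.I * ∑ i, (n i : ℂ) * y i)) * u y := fun n => by
    rw [UnitAddTorus.mFourierCoeff_eq_integral f n fun _ => -(1 / 2)]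
    have hm : MeasurableSet {y : Fin d → ℝ | ∀ i, y i ∈ Set.Ioc (-(1 / 2) : ℝ) (-(1 / 2) + 1)} :=
      MeasurableSet.univ_pi' fun i => measurableSet_Ioc
    rw [← setIntegral_eq_integral_of_forall_compl_eq_zero (μ := volume)
      (s := {y : Fin d → ℝ | ∀ i, y i ∈ Set.Ioc (-(1 / 2) : ℝ) (-(1 / 2) + 1)})]
    · refine setIntegral_congr_fun hm fun y hy => ?_
      rw [hf y hy, mFourier_coe, smul_eq_mul]
      congr 2
      simp
    · intro y hy
      rw [mul_eq_zero]
      right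
      by_contra hne
      refine hy fun i => ?_
      have := abs_le.1 (hsupp y hne i)
      constructor <;> linarith [this.1, this.2]
  have hs : Summable (UnitAddTorus.mFourierCoeff f) := by
    simpa only [funext hcoef] using hsum
  have h := UnitAddTorus.hasSum_mFourier_series_apply_of_summable hs
    (fun i => (x i : UnitAddCircle))
  rw [hf x fun i => by have := abs_le.1 (hx i); constructor <;> linarith [this.1, this.2]] at h
  simpa only [hcoef, mFourier_coe, smul_eq_mul] using h

/-- The Fourier series of a function supported well inside a cube of side `L`. -/
theorem hasSum_fourier_cube {d : ℕ} {L : ℝ} (hL : 0 < L) (θ : 𝓢(E d, ℂ))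
    (hsupp : ∀ x, θ x ≠ 0 → ∀ i, |x i| ≤ L / 4) {x : E d} (hx : ∀ i, |x i| ≤ L / 4) :
    HasSum (fun n : Fin d → ℤ => ((L ^ d)⁻¹ : ℝ) *
      (∫ y, char (-latticePt (2 * Real.pi / L) n) y * θ y) *
        char (latticePt (2 * Real.pi / L) n) x) (θ x) := by
  set u : (Fin d → ℝ) → ℂ := fun y => θ (L • WithLp.toLp 2 y) with hu
  have huc : Continuous u := θ.continuous.comp (by fun_prop)
  have hchar : ∀ (n : Fin d → ℤ) (y : Fin d → ℝ),
      Complex.exp (2 * Real.pi * Complex.I * ∑ i, (n i : ℂ) * y i) =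
        char (latticePt (2 * Real.pi / L) n) (L • WithLp.toLp 2 y) := fun n y => by
    rw [char, PiLp.inner_apply]
    congr 1
    push_cast
    rw [Finset.mul_sum, Finset.mul_sum]
    refine Finset.sum_congr rfl fun i _ => ?_
    simp only [latticePt_apply, PiLp.smul_apply, smul_eq_mul]
    have : (L : ℂ) ≠ 0 := by exact_mod_cast hL.ne'
    simp only [RCLike.inner_apply, conj_trivial]
    push_cast
    field_simp
  have hchar' : ∀ (n : Fin d → ℤ) (y : Fin d → ℝ),
      Complex.exp (-(2 * Real.pi * Complex.I * ∑ i, (n i : ℂ) * y i)) =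
        char (-latticePt (2 * Real.pi / L) n) (L • WithLp.toLp 2 y) := fun n y => by
    rw [Complex.exp_neg, hchar, char, char, ← Complex.exp_neg, inner_neg_right]
    push_cast
    ring_nf
  have hcoef : ∀ n : Fin d → ℤ,
      ∫ y, Complex.exp (-(2 * Real.pi * Complex.I * ∑ i, (n i : ℂ) * y i)) * u y =
        ((L ^ d)⁻¹ : ℝ) * ∫ y, char (-latticePt (2 * Real.pi / L) n) y * θ y := fun n => by
    simp_rw [hchar', hu]
    have h1 := (EuclideanSpace.volume_preserving_symm_measurableEquiv_toLp (Fin d)).symm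
    have h2 := h1.integral_comp (MeasurableEquiv.measurableEmbedding _)
      (fun y : E d => char (-latticePt (2 * Real.pi / L) n) (L • y) * θ (L • y))
    refine h2.trans ?_
    rw [Measure.integral_comp_smul volume
      (fun y => char (-latticePt (2 * Real.pi / L) n) y * θ y) L, finrank_euclideanSpace,
      Fintype.card_fin, abs_of_nonneg (by positivity), Complex.real_smul]
  have hsum : Summable fun n : Fin d → ℤ => ((L ^ d)⁻¹ : ℝ) *
      ∫ y, char (-latticePt (2 * Real.pi / L) n) y * θ y := by
    refine Summable.mul_left _ ?_
    have hF : ∀ n : Fin d → ℤ, ∫ y, char (-latticePt (2 * Real.pi / L) n) y * θ y =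
        𝓕 θ ((2 * Real.pi)⁻¹ • latticePt (2 * Real.pi / L) n) := fun n => by
      rw [SchwartzMap.fourier_coe, Real.fourier_eq]
      refine integral_congr_ae (Filter.Eventually.of_forall fun y => ?_)
      simp only [Circle.smul_def, smul_eq_mul]
      rw [← inner_neg_right, real_inner_comm, fourierChar_inner, smul_neg,
        smul_inv_smul₀ (by positivity)]
    simp_rw [hF]
    have hp : (0 : ℝ) < 2 * Real.pi := by positivity
    have hs := (summable_latticePt (d := d) (c := 1 / L) (by positivity) le_rfl).mul_left
      (2 ^ (2 * d) * schwartzSup (E d) ℂ (2 * d, 0) (𝓕 θ))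
    refine Summable.of_norm_bounded hs fun n => ?_
    have e : (2 * Real.pi)⁻¹ • latticePt (2 * Real.pi / L) n = latticePt (1 / L) n := by
      ext i
      simp only [PiLp.smul_apply, latticePt_apply, smul_eq_mul]
      field_simp
    rw [e, ← div_eq_mul_inv, le_div_iff₀ (by positivity), mul_comm]
    exact one_add_pow_mul_norm_le_schwartzSup (2 * d) (𝓕 θ) _
  have hx' : (L • WithLp.toLp 2 fun i => L⁻¹ * x i) = x := by
    ext i
    simp only [PiLp.smul_apply, smul_eq_mul]
    field_simp
  have h := hasSum_fourier_pi (u := u) huc (fun y hy i => ?_) (by simpa only [hcoef] using hsum)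
    (x := fun i => L⁻¹ * x i) (fun i => ?_)
  · have hux : u (fun i => L⁻¹ * x i) = θ x := congrArg θ hx'
    simp only [hcoef, hchar, hux, hx'] at h
    exact h
  · have h := hsupp _ hy i
    simp only [PiLp.smul_apply, smul_eq_mul, abs_mul, abs_of_pos hL] at h
    rw [show L / 4 = L * (1 / 4) by ring] at h
    exact le_of_mul_le_mul_left h hL
  · rw [abs_mul, abs_of_pos (inv_pos.2 hL), inv_mul_le_iff₀ hL]
    linarith [hx i]

end FourierSeries
end FourierBanach

namespace FourierBanach

/-! ### Convergent series in the Schwartz space -/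

section SchwartzSeries

variable {D V ι : Type*} [NormedAddCommGroup D] [NormedSpace ℝ D] [NormedAddCommGroup V]
  [NormedSpace ℂ V]

theorem hasSum_of_forall_schwartzSup_sub_le {u : ι → 𝓢(D, V)} {ψ : 𝓢(D, V)}
    (h : ∀ k n : ℕ, Filter.Tendsto (fun s : Finset ι => SchwartzMap.seminorm ℝ k n
      (∑ i ∈ s, u i - ψ)) Filter.atTop (nhds 0)) : HasSum u ψ := by
  rw [HasSum, (schwartz_withSeminorms ℝ D V).tendsto_nhds]
  intro m ε hε
  exact (h m.1 m.2).eventually (gt_mem_nhds hε)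

/-- Summability of all norms permits termwise differentiation. Each seminorm of the remainder is
then at most the tail of a convergent numerical series. -/
theorem hasSum_schwartz [CompleteSpace V] {u : ι → 𝓢(D, V)} {ψ : 𝓢(D, V)}
    (hs : ∀ m : ℕ × ℕ, Summable fun i => schwartzSup D V m (u i))
    (hu : ∀ x, HasSum (fun i => u i x) (ψ x)) : HasSum u ψ := by
  have hbd : ∀ (n : ℕ) (i : ι) (x : D),
      ‖iteratedFDeriv ℝ n (u i) x‖ ≤ schwartzSup D V (0, n) (u i) := fun n i x => by
    simpa using pow_mul_le_schwartzSup (m := (0, n)) le_rfl le_rfl (u i) x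
  have hψ : (ψ : D → V) = fun x => ∑' i, u i x := funext fun x => (hu x).tsum_eq.symm
  have hder : ∀ n x, iteratedFDeriv ℝ n ψ x = ∑' i, iteratedFDeriv ℝ n (u i) x := fun n x => by
    rw [hψ]
    exact iteratedFDeriv_tsum_apply (𝕜 := ℝ) (N := (⊤ : ℕ∞)) (fun i => (u i).smooth ⊤)
      (fun k _ => hs (0, k)) (fun k i x _ => hbd k i x) le_top x
  refine hasSum_of_forall_schwartzSup_sub_le fun k n => ?_
  refine squeeze_zero (fun s => apply_nonneg _ _) (fun s => ?_)
    (tendsto_tsum_compl_atTop_zero fun i => schwartzSup D V (k, n) (u i))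
  refine SchwartzMap.seminorm_le_bound ℝ k n _
    (tsum_nonneg fun i => apply_nonneg _ _) fun x => ?_
  have hsum : Summable fun i => iteratedFDeriv ℝ n (u i) x :=
    .of_norm_bounded (hs (0, n)) fun i => hbd n i x
  have e : iteratedFDeriv ℝ n (∑ i ∈ s, u i - ψ) x =
      -∑' i : {i // i ∉ s}, iteratedFDeriv ℝ n (u i) x := by
    have e1 : (⇑(∑ i ∈ s, u i - ψ) : D → V) = (fun x => ∑ i ∈ s, u i x) - ⇑ψ := by
      ext x
      simp
    have c1 : ContDiff ℝ (⊤ : ℕ∞) fun x => ∑ i ∈ s, u i x := ContDiff.sum fun i _ => (u i).smooth ⊤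
    rw [e1, iteratedFDeriv_sub_apply (contDiff_infty.1 c1 n).contDiffAt
      (contDiff_infty.1 (ψ.smooth ⊤) n).contDiffAt, hder,
      iteratedFDeriv_fun_sum_apply (fun i _ => (contDiff_infty.1 ((u i).smooth ⊤) n).contDiffAt),
      ← hsum.sum_add_tsum_subtype_compl s]
    simp
  rw [e, norm_neg]
  have hsc := (hs (k, n)).subtype fun i => i ∉ s
  have hsn : Summable fun i : {i // i ∉ s} => ‖iteratedFDeriv ℝ n (u i) x‖ :=
    ((hs (0, n)).of_nonneg_of_le (fun i => norm_nonneg _) fun i => hbd n i x).subtype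
      fun i => i ∉ s
  calc ‖x‖ ^ k * ‖∑' i : {i // i ∉ s}, iteratedFDeriv ℝ n (u i) x‖
      ≤ ‖x‖ ^ k * ∑' i : {i // i ∉ s}, ‖iteratedFDeriv ℝ n (u i) x‖ := by
        gcongr
        exact norm_tsum_le_tsum_norm hsn
    _ = ∑' i : {i // i ∉ s}, ‖x‖ ^ k * ‖iteratedFDeriv ℝ n (u i) x‖ := tsum_mul_left.symm
    _ ≤ _ := (hsn.mul_left _).tsum_le_tsum
        (fun i => pow_mul_le_schwartzSup (m := (k, n)) le_rfl le_rfl (u i) x) hsc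

end SchwartzSeries

/-! ### Dilated cutoffs -/

section Cutoff

variable {d : ℕ}

/-- A smooth function equal to `1` on the unit ball and supported in the ball of radius `2`. -/
noncomputable def unitBump (d : ℕ) : ContDiffBump (0 : E d) := ⟨1, 2, one_pos, one_lt_two⟩

/-- A smooth function equal to `1` on the ball of radius `R` and supported in that of radius
`2 R`. -/
noncomputable def cutoff (R : ℝ) (x : E d) : ℂ := ((unitBump d (R⁻¹ • x) : ℝ) : ℂ)

theorem contDiff_cutoff (R : ℝ) : ContDiff ℝ (⊤ : ℕ∞) (cutoff R : E d → ℂ) :=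
  Complex.ofRealCLM.contDiff.comp ((unitBump d).contDiff.comp (contDiff_const_smul R⁻¹))

theorem cutoff_eq_one {R : ℝ} (hR : 0 < R) {x : E d} (hx : ‖x‖ ≤ R) : cutoff R x = 1 := by
  rw [cutoff, (unitBump d).one_of_mem_closedBall, Complex.ofReal_one]
  rw [mem_closedBall_zero_iff, norm_smul, norm_inv, Real.norm_of_nonneg hR.le,
    inv_mul_le_iff₀ hR]
  simpa [unitBump] using hx

theorem cutoff_eq_zero {R : ℝ} (hR : 0 < R) {x : E d} (hx : 2 * R ≤ ‖x‖) : cutoff R x = 0 := by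
  rw [cutoff, (unitBump d).zero_of_le_dist, Complex.ofReal_zero]
  rw [dist_zero_right, norm_smul, norm_inv, Real.norm_of_nonneg hR.le, le_inv_mul_iff₀ hR]
  simp only [unitBump]
  linarith

theorem hasCompactSupport_cutoff {R : ℝ} (hR : 0 < R) : HasCompactSupport (cutoff R : E d → ℂ) :=
  HasCompactSupport.intro (isCompact_closedBall (0 : E d) (2 * R)) fun x hx =>
    cutoff_eq_zero hR (by simpa using (not_le.1 (fun h => hx (by simpa using h))).le)

theorem hasTemperateGrowth_cutoff {R : ℝ} (hR : 0 < R) :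
    (cutoff R : E d → ℂ).HasTemperateGrowth :=
  (hasCompactSupport_cutoff hR).hasTemperateGrowth (contDiff_cutoff R)

theorem cutoff_mul_cutoff {R : ℝ} (hR : 0 < R) (x : E d) :
    cutoff (2 * R) x * cutoff R x = cutoff R x := by
  rcases le_total ‖x‖ (2 * R) with h | h
  · rw [cutoff_eq_one (by positivity) h, one_mul]
  · rw [cutoff_eq_zero hR h, mul_zero]

/-- The cutoff as a Schwartz function. -/
noncomputable def cutoffS {R : ℝ} (hR : 0 < R) : 𝓢(E d, ℂ) :=
  (hasCompactSupport_cutoff hR).toSchwartzMap (contDiff_cutoff R)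

theorem cutoffS_apply {R : ℝ} (hR : 0 < R) (x : E d) : cutoffS hR x = cutoff R x := rfl

theorem smulLeftCLM_cutoff_apply {R : ℝ} (hR : 0 < R) (φ : 𝓢(E d, ℂ)) (x : E d) :
    SchwartzMap.smulLeftCLM ℂ (cutoff R : E d → ℂ) φ x = cutoff R x * φ x := by
  rw [SchwartzMap.smulLeftCLM_apply_apply (hasTemperateGrowth_cutoff hR), smul_eq_mul]

theorem exists_norm_iteratedFDeriv_cutoff_le (d n : ℕ) : ∃ C : ℝ, 0 ≤ C ∧ ∀ R : ℝ, 1 ≤ R →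
    ∀ i ≤ n, ∀ x : E d, ‖iteratedFDeriv ℝ i (fun x => cutoff R x - 1) x‖ ≤ C := by
  have h1 : ∀ i, ∃ C : ℝ, ∀ x : E d, ‖iteratedFDeriv ℝ i (cutoff 1 : E d → ℂ) x‖ ≤ C := fun i => by
    refine ⟨SchwartzMap.seminorm ℝ 0 i (cutoffS (d := d) one_pos), fun x => ?_⟩
    simpa using! SchwartzMap.le_seminorm ℝ 0 i (cutoffS (d := d) one_pos) x
  choose C hC using h1
  have hC0 : ∀ i, 0 ≤ C i := fun i => (norm_nonneg _).trans (hC i 0)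
  refine ⟨∑ i ∈ Finset.range (n + 1), C i + 1,
    add_nonneg (Finset.sum_nonneg fun i _ => hC0 i) zero_le_one, fun R hR i hi x => ?_⟩
  have hR0 : 0 < R := by linarith
  have h2 : ‖iteratedFDeriv ℝ i (cutoff R : E d → ℂ) x‖ ≤ C i := by
    have e : (cutoff R : E d → ℂ) = fun x => cutoff 1 (R⁻¹ • x) := by
      ext x
      simp [cutoff]
    rw [e, iteratedFDeriv_comp_const_smul R⁻¹ (contDiff_infty.1 (contDiff_cutoff 1) i), norm_smul]
    have : ‖R⁻¹ ^ i‖ ≤ 1 := by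
      rw [Real.norm_of_nonneg (by positivity)]
      exact pow_le_one₀ (by positivity) (inv_le_one_of_one_le₀ hR)
    exact (mul_le_of_le_one_left (norm_nonneg _) this).trans (hC i _)
  have h3 : C i ≤ ∑ i ∈ Finset.range (n + 1), C i :=
    Finset.single_le_sum (f := C) (fun i _ => hC0 i) (Finset.mem_range.2 (Nat.lt_succ_of_le hi))
  have e2 : (fun x : E d => cutoff R x - 1) = cutoff R - fun _ => (1 : ℂ) := rfl
  rw [e2, iteratedFDeriv_sub_apply (contDiff_infty.1 (contDiff_cutoff R) i).contDiffAt
    contDiff_const.contDiffAt]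
  refine (norm_sub_le _ _).trans (add_le_add (h2.trans h3) ?_)
  rcases i with _ | i
  · simp
  · rw [iteratedFDeriv_const_of_ne (by omega)]
    simp

/-- The difference lives in |x| ≥ R, where one extra power of |x| from the decay of φ yields a
factor 1/R. The derivatives of the cutoffs are bounded uniformly in R ≥ 1. -/
theorem tendsto_smulLeftCLM_cutoff (φ : 𝓢(E d, ℂ)) :
    Filter.Tendsto (fun R : ℝ => SchwartzMap.smulLeftCLM ℂ (cutoff R : E d → ℂ) φ)
      Filter.atTop (nhds φ) := by
  rw [(schwartz_withSeminorms ℝ (E d) ℂ).tendsto_nhds]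
  rintro ⟨k, n⟩ ε hε
  obtain ⟨C, hC0, hC⟩ := exists_norm_iteratedFDeriv_cutoff_le d n
  set K := 2 ^ n * C * (2 ^ (k + 1) * schwartzSup (E d) ℂ (k + 1, n) φ) with hK
  have hK0 : 0 ≤ K := by positivity
  filter_upwards [Filter.eventually_ge_atTop 1, Filter.eventually_gt_atTop (K / ε)] with R hR1 hRK
  have hR : 0 < R := by linarith
  refine lt_of_le_of_lt (b := K / R) ?_ (by rw [div_lt_iff₀ hε] at hRK; rw [div_lt_iff₀ hR]; linarith)
  refine SchwartzMap.seminorm_le_bound ℝ k n _ (by positivity) fun x => ?_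
  have e : (⇑(SchwartzMap.smulLeftCLM ℂ (cutoff R : E d → ℂ) φ - φ) : E d → ℂ) =
      fun x => (cutoff R x - 1) • φ x := by
    ext x
    rw [sub_apply, smulLeftCLM_cutoff_apply hR, smul_eq_mul]
    ring
  rw [e, le_div_iff₀ hR]
  rcases lt_or_ge ‖x‖ R with hx | hx
  · have h0 : iteratedFDeriv ℝ n (fun x => (cutoff R x - 1) • φ x) x = 0 := by
      have : (fun x => (cutoff R x - 1) • φ x) =ᶠ[nhds x] fun _ => 0 := by
        filter_upwards [(isOpen_lt continuous_norm continuous_const).mem_nhds hx] with y hy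
        rw [cutoff_eq_one hR (le_of_lt hy), sub_self, zero_smul]
      rw [(Filter.EventuallyEq.iteratedFDeriv ℝ this n).eq_of_nhds]
      simp
    rw [h0, norm_zero, mul_zero, zero_mul]
    exact hK0
  · have h1 := norm_iteratedFDeriv_smul_le ((contDiff_cutoff (d := d) R).sub (contDiff_const (c := (1 : ℂ))))
      (φ.smooth ⊤) x (n := n) (by exact_mod_cast le_top)
    calc ‖x‖ ^ k * ‖iteratedFDeriv ℝ n (fun x => (cutoff R x - 1) • φ x) x‖ * R
        ≤ ‖x‖ ^ k * (∑ i ∈ Finset.range (n + 1), (n.choose i : ℝ) *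
            ‖iteratedFDeriv ℝ i (fun x => cutoff R x - 1) x‖ * ‖iteratedFDeriv ℝ (n - i) φ x‖) *
            ‖x‖ := by gcongr
      _ = ∑ i ∈ Finset.range (n + 1), (n.choose i : ℝ) *
            ‖iteratedFDeriv ℝ i (fun x => cutoff R x - 1) x‖ *
            (‖x‖ ^ (k + 1) * ‖iteratedFDeriv ℝ (n - i) φ x‖) := by
          rw [Finset.mul_sum, Finset.sum_mul]
          exact Finset.sum_congr rfl fun i _ => by ring
      _ ≤ ∑ i ∈ Finset.range (n + 1), (n.choose i : ℝ) * C *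
            (2 ^ (k + 1) * schwartzSup (E d) ℂ (k + 1, n) φ) := by
          refine Finset.sum_le_sum fun i hi => ?_
          have hi : i ≤ n := Nat.lt_succ_iff.1 (Finset.mem_range.1 hi)
          have h2 := hC R hR1 i hi x
          have h3 := pow_mul_le_schwartzSup (m := (k + 1, n)) le_rfl (Nat.sub_le n i) φ x
          have h4 : schwartzSup (E d) ℂ (k + 1, n) φ ≤
              2 ^ (k + 1) * schwartzSup (E d) ℂ (k + 1, n) φ :=
            le_mul_of_one_le_left (apply_nonneg _ _) (one_le_pow₀ one_le_two)
          exact mul_le_mul (by gcongr) (h3.trans h4) (by positivity) (by positivity)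
      _ = K := by
          rw [← Finset.sum_mul, ← Finset.sum_mul, ← Nat.cast_sum, Nat.sum_range_choose]
          push_cast
          ring

end Cutoff

/-! ### Compactly supported distributions -/

section Support

variable {d : ℕ}

/-- Every point of the support of φ has a neighbourhood where f vanishes. A subordinate partition of
unity writes φ as a sum of test functions supported in such neighbourhoods; compactness makes the
sum finite. -/
theorem apply_eq_zero_of_hasCompactSupport {f : 𝓢'(E d, ℂ)} {φ : 𝓢(E d, ℂ)}
    (hc : HasCompactSupport φ) (h : tsupport φ ⊆ (Distribution.dsupport f)ᶜ) : f φ = 0 := by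
  have hx : ∀ x : {x // x ∈ tsupport φ}, ∃ s : Set (E d),
      Distribution.IsVanishingOn f s ∧ IsOpen s ∧ x.1 ∈ s := fun x =>
    (Distribution.notMem_dsupport_iff x.1).1 (h x.2)
  choose U hU hUo hxU using hx
  obtain ⟨ρ, hρ⟩ := SmoothPartitionOfUnity.exists_isSubordinate (modelWithCornersSelf ℝ (E d))
    (isClosed_tsupport φ) U hUo fun x hx => Set.mem_iUnion.2 ⟨⟨x, hx⟩, hxU _⟩
  have hfin := ρ.locallyFinite.finite_nonempty_inter_compact hc
  have hρs : ∀ i, ContDiff ℝ (⊤ : ℕ∞) fun x => ((ρ i x : ℝ) : ℂ) := fun i =>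
    Complex.ofRealCLM.contDiff.comp (ρ i).contMDiff.contDiff
  have hcs : ∀ i, HasCompactSupport fun x => ((ρ i x : ℝ) : ℂ) * φ x := fun i => hc.mul_left
  have e : φ = ∑ i ∈ hfin.toFinset, (hcs i).toSchwartzMap ((hρs i).mul (φ.smooth ⊤)) := by
    ext x
    rw [sum_apply]
    simp only [HasCompactSupport.toSchwartzMap_toFun]
    change _ = ∑ i ∈ hfin.toFinset, ((ρ i x : ℝ) : ℂ) * φ x
    rw [← Finset.sum_mul]
    by_cases hxs : x ∈ tsupport φ
    · have h1 := ρ.sum_eq_one hxs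
      rw [finsum_eq_sum_of_support_subset (s := hfin.toFinset)] at h1
      · rw [← Complex.ofReal_sum, h1, Complex.ofReal_one, one_mul]
      · intro i hi
        simp only [Set.Finite.coe_toFinset, Set.mem_ofPred_eq]
        exact ⟨x, hi, hxs⟩
    · rw [image_eq_zero_of_notMem_tsupport hxs, mul_zero]
  rw [e, map_sum]
  refine Finset.sum_eq_zero fun i _ => hU i _ ?_
  refine Set.Subset.trans ?_ (hρ i)
  refine closure_mono fun x hx => ?_
  rw [Function.mem_support] at hx ⊢
  intro h0
  exact hx (by simp [h0])

/-- A distribution with compact support is not affected by multiplication by a suitable cutoff. -/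
theorem exists_apply_cutoff {f : 𝓢'(E d, ℂ)} (hf : IsCompact (Distribution.dsupport f)) :
    ∃ R : ℝ, 0 < R ∧ ∀ φ, f (SchwartzMap.smulLeftCLM ℂ (cutoff R : E d → ℂ) φ) = f φ := by
  obtain ⟨R, hR0, hR⟩ := hf.isBounded.subset_ball_lt 0 0
  refine ⟨R, hR0, fun φ => ?_⟩
  rw [← sub_eq_zero, ← map_sub]
  set ψ := SchwartzMap.smulLeftCLM ℂ (cutoff R : E d → ℂ) φ - φ with hψ
  have h1 : ∀ x, ψ x = (cutoff R x - 1) * φ x := fun x => by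
    rw [hψ, sub_apply, smulLeftCLM_cutoff_apply hR0]
    ring
  have hts : tsupport ψ ⊆ (Metric.ball 0 R)ᶜ := by
    refine closure_minimal (fun x hx hxR => hx ?_) Metric.isOpen_ball.isClosed_compl
    rw [h1, cutoff_eq_one hR0 (by simpa using (mem_ball_zero_iff.1 hxR).le), sub_self, zero_mul]
  -- The function ψ vanishes near the support of f but need not have compact support, so it is
  -- approximated by its truncations, each of which f annihilates.
  have h2 : Filter.Tendsto (fun T : ℝ => f (SchwartzMap.smulLeftCLM ℂ (cutoff T : E d → ℂ) ψ))
      Filter.atTop (nhds (f ψ)) :=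
    (f.continuous.tendsto ψ).comp (tendsto_smulLeftCLM_cutoff ψ)
  refine tendsto_nhds_unique h2 (tendsto_const_nhds.congr' ?_)
  filter_upwards [Filter.eventually_gt_atTop 0] with T hT
  refine (apply_eq_zero_of_hasCompactSupport ?_ ?_).symm
  · rw [SchwartzMap.smulLeftCLM_apply (hasTemperateGrowth_cutoff hT)]
    exact (hasCompactSupport_cutoff hT).smul_right
  · rw [SchwartzMap.smulLeftCLM_apply (hasTemperateGrowth_cutoff hT)]
    exact ((tsupport_smul_subset_right _ _).trans hts).trans (Set.compl_subset_compl.2 hR)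

end Support
end FourierBanach

namespace FourierBanach

/-! ### Sampling in frequency -/

section Sampling

variable {d : ℕ}

theorem integral_char_mul_eq_fourier (θ : 𝓢(E d, ℂ)) (η : E d) :
    ∫ y, char (-η) y * θ y = 𝓕 θ ((2 * Real.pi)⁻¹ • η) := by
  rw [SchwartzMap.fourier_coe, Real.fourier_eq]
  refine integral_congr_ae (Filter.Eventually.of_forall fun y => ?_)
  simp only [Circle.smul_def, smul_eq_mul]
  rw [← inner_neg_right, real_inner_comm, fourierChar_inner, smul_neg,
    smul_inv_smul₀ (by positivity)]

theorem exists_norm_integral_char_mul_le (θ : 𝓢(E d, ℂ)) (K : ℕ) : ∃ C : ℝ, 0 ≤ C ∧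
    ∀ η, (1 + ‖η‖) ^ K * ‖∫ y, char (-η) y * θ y‖ ≤ C := by
  refine ⟨(2 * Real.pi) ^ K * (2 ^ K * schwartzSup (E d) ℂ (K, 0) (𝓕 θ)), by positivity,
    fun η => ?_⟩
  rw [integral_char_mul_eq_fourier]
  have h := one_add_pow_mul_norm_le_schwartzSup K (𝓕 θ) ((2 * Real.pi)⁻¹ • η)
  have h1 : 1 + ‖η‖ ≤ 2 * Real.pi * (1 + ‖(2 * Real.pi)⁻¹ • η‖) := by
    rw [norm_smul, Real.norm_of_nonneg (by positivity), mul_add, mul_inv_cancel_left₀ (by positivity)]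
    linarith [Real.pi_gt_three]
  calc _ ≤ (2 * Real.pi * (1 + ‖(2 * Real.pi)⁻¹ • η‖)) ^ K * ‖𝓕 θ ((2 * Real.pi)⁻¹ • η)‖ := by
        gcongr
    _ = (2 * Real.pi) ^ K * ((1 + ‖(2 * Real.pi)⁻¹ • η‖) ^ K * ‖𝓕 θ ((2 * Real.pi)⁻¹ • η)‖) := by
        rw [mul_pow]; ring
    _ ≤ _ := by gcongr

theorem one_add_norm_add_le {F : Type*} [NormedAddCommGroup F] (x y : F) :
    1 + ‖x + y‖ ≤ (1 + ‖x‖) * (1 + ‖y‖) := by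
  nlinarith [norm_add_le x y, mul_nonneg (norm_nonneg x) (norm_nonneg y)]

theorem one_add_norm_sub_le {F : Type*} [NormedAddCommGroup F] (x y : F) :
    1 + ‖x - y‖ ≤ (1 + ‖x‖) * (1 + ‖y‖) := by
  simpa [sub_eq_add_neg] using one_add_norm_add_le x (-y)

/-- The sampling lattice attached to functions supported in the ball of radius `2 R`. -/
noncomputable def samplePt (R : ℝ) (m : Fin d → ℤ) : E d := latticePt (2 * Real.pi / (16 * R)) m

theorem summable_samplePt {R : ℝ} (hR : 0 < R) {K : ℕ} (hK : 2 * d ≤ K) :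
    Summable fun m : Fin d → ℤ => ((1 + ‖samplePt R m‖) ^ K)⁻¹ :=
  summable_latticePt (by positivity) hK

/-- The smooth function `f̂`, up to normalization, of a distribution supported in a ball. -/
noncomputable def cutFourier {R : ℝ} (hR : 0 < R) (f : 𝓢'(E d, ℂ)) (η : E d) : ℂ :=
  f (modulation (-η) (cutoffS hR))

theorem exists_norm_cutFourier_le {R : ℝ} (hR : 0 < R) (f : 𝓢'(E d, ℂ)) :
    ∃ k : ℕ, ∃ C : ℝ, 0 ≤ C ∧ ∀ η, ‖cutFourier hR f η‖ ≤ C * (1 + ‖η‖) ^ k := by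
  obtain ⟨m, C, hC0, hC⟩ := exists_norm_map_le (D := E d) (V := ℂ) (V' := ℂ)
    (f : 𝓢(E d, ℂ) →L[ℂ] ℂ)
  obtain ⟨k, C', hC'0, hC'⟩ := exists_schwartzSup_modulation_le m (cutoffS (d := d) hR)
  refine ⟨k, C * C', by positivity, fun η => (hC _).trans ?_⟩
  rw [mul_assoc]
  have := hC' (-η)
  rw [norm_neg] at this
  gcongr

/-- The frequency samples do not depend on the test cutoff, provided that it equals 1 wherever the
cutoff R is nonzero. -/
theorem apply_modulation_eq_cutFourier {R : ℝ} (hR : 0 < R) {f : 𝓢'(E d, ℂ)}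
    (hf : ∀ φ, f (SchwartzMap.smulLeftCLM ℂ (cutoff R : E d → ℂ) φ) = f φ) (η : E d)
    (χ : 𝓢(E d, ℂ)) (hχ : ∀ x, cutoff R x * χ x = cutoff R x) :
    f (modulation (-η) χ) = cutFourier hR f η := by
  rw [← hf, cutFourier]
  congr 1
  ext x
  rw [smulLeftCLM_cutoff_apply hR, modulation_apply, modulation_apply, cutoffS_apply]
  linear_combination char (-η) x * hχ x

/-- The sampling theorem, in its dual form: a distribution supported in a ball is the series of its
frequency samples. -/
theorem hasSum_sampling {R : ℝ} (hR : 0 < R) (hR2 : 0 < 2 * R) {f : 𝓢'(E d, ℂ)}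
    (hf : ∀ φ, f (SchwartzMap.smulLeftCLM ℂ (cutoff R : E d → ℂ) φ) = f φ) (ξ₀ : E d)
    (φ : 𝓢(E d, ℂ)) :
    HasSum (fun m => ((((16 * R) ^ d)⁻¹ : ℝ) : ℂ) * cutFourier hR f (ξ₀ - samplePt R m) *
      toTD d (modulation (ξ₀ - samplePt R m) (cutoffS hR2)) φ) (f φ) := by
  -- This θ lives in |x| ≤ 4R, a quarter of the side 16R of the cube, as the Fourier series
  -- requires. The cutoff at scale 2R equals 1 on the support of the one at scale R, so multiplying
  -- the series of θ by that smaller cutoff and e^{-i⟨x, ξ₀⟩} recovers the localized φ. The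
  -- modulation shifts the sampling lattice to the arbitrary origin ξ₀.
  set θ : 𝓢(E d, ℂ) := modulation ξ₀ (SchwartzMap.smulLeftCLM ℂ (cutoff (2 * R) : E d → ℂ) φ)
    with hθdef
  have hθ : ∀ x, θ x = char ξ₀ x * (cutoff (2 * R) x * φ x) := fun x => by
    rw [hθdef, modulation_apply, smulLeftCLM_cutoff_apply hR2]
  set c : (Fin d → ℤ) → ℂ := fun m =>
    ((((16 * R) ^ d)⁻¹ : ℝ) : ℂ) * ∫ y, char (-samplePt R m) y * θ y with hc
  have hc' : ∀ m, c m = ((((16 * R) ^ d)⁻¹ : ℝ) : ℂ) *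
      toTD d (modulation (ξ₀ - samplePt R m) (cutoffS hR2)) φ := fun m => by
    rw [hc, toTD_apply]
    simp only
    refine congrArg _ ?_
    refine integral_congr_ae (Filter.Eventually.of_forall fun x => ?_)
    simp only
    rw [hθ, modulation_apply, sub_eq_add_neg, char_add_left, cutoffS_apply]
    ring
  -- The series must converge in 𝓢, so that f can be applied termwise. The coefficients decay
  -- rapidly in m, whereas the norms of the modulated cutoffs grow polynomially.
  have hsum : HasSum (fun m => c m • modulation (-(ξ₀ - samplePt R m)) (cutoffS hR))
      (SchwartzMap.smulLeftCLM ℂ (cutoff R : E d → ℂ) φ) := by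
    refine hasSum_schwartz (fun n => ?_) fun x => ?_
    · obtain ⟨k, C, hC0, hC⟩ := exists_schwartzSup_modulation_le n (cutoffS (d := d) hR)
      obtain ⟨C', hC'0, hC'⟩ := exists_norm_integral_char_mul_le θ (k + 2 * d)
      have hs := (summable_samplePt (d := d) hR le_rfl).mul_left
        (((16 * R) ^ d)⁻¹ * C' * (C * (1 + ‖ξ₀‖) ^ k))
      refine hs.of_nonneg_of_le (fun m => apply_nonneg _ _) fun m => ?_
      have e : schwartzSup (E d) ℂ n (c m • modulation (-(ξ₀ - samplePt R m)) (cutoffS hR)) =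
          ‖c m‖ * schwartzSup (E d) ℂ n (modulation (-(ξ₀ - samplePt R m)) (cutoffS hR)) := by
        rw [schwartzSup_eq, schwartzSup_eq, map_smul_eq_mul]
      have h1 := hC (-(ξ₀ - samplePt R m))
      have h2 := hC' (samplePt R m)
      rw [norm_neg] at h1
      have h3 : (1 + ‖ξ₀ - samplePt R m‖) ^ k ≤ (1 + ‖ξ₀‖) ^ k * (1 + ‖samplePt R m‖) ^ k := by
        rw [← mul_pow]
        have := one_add_norm_sub_le ξ₀ (samplePt R m)
        gcongr
      have hnc : ‖c m‖ = ((16 * R) ^ d)⁻¹ * ‖∫ y, char (-samplePt R m) y * θ y‖ := by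
        rw [hc, norm_mul, Complex.norm_real, Real.norm_of_nonneg (by positivity)]
      rw [e, hnc, ← div_eq_mul_inv, le_div_iff₀ (by positivity)]
      calc _ ≤ ((16 * R) ^ d)⁻¹ * ‖∫ y, char (-samplePt R m) y * θ y‖ *
            (C * ((1 + ‖ξ₀‖) ^ k * (1 + ‖samplePt R m‖) ^ k)) * (1 + ‖samplePt R m‖) ^ (2 * d) := by
            gcongr
            exact h1.trans (by gcongr)
        _ = ((16 * R) ^ d)⁻¹ * ((1 + ‖samplePt R m‖) ^ (k + 2 * d) *
            ‖∫ y, char (-samplePt R m) y * θ y‖) * (C * (1 + ‖ξ₀‖) ^ k) := by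
            rw [pow_add]; ring
        _ ≤ _ := by gcongr
    · have hterm : ∀ m, (c m • modulation (-(ξ₀ - samplePt R m)) (cutoffS hR)) x =
          (cutoff R x * char (-ξ₀) x) * (c m * char (samplePt R m) x) := fun m => by
        rw [smul_apply, modulation_apply, cutoffS_apply, neg_sub, sub_eq_add_neg,
          char_add_left, smul_eq_mul]
        ring
      simp_rw [hterm]
      rw [smulLeftCLM_cutoff_apply hR]
      rcases le_total (2 * R) ‖x‖ with hx | hx
      · rw [cutoff_eq_zero hR hx]
        simp [hasSum_zero]
      · have hxi : ∀ i, |x i| ≤ 16 * R / 4 := fun i => by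
          have : |x i| ≤ ‖x‖ := PiLp.norm_apply_le x i
          linarith
        have hsupp : ∀ x, θ x ≠ 0 → ∀ i, |x i| ≤ 16 * R / 4 := fun x hx i => by
          have h1 : |x i| ≤ ‖x‖ := PiLp.norm_apply_le x i
          by_contra h
          refine hx ?_
          rw [hθ, cutoff_eq_zero hR2 (by linarith [not_le.1 h])]
          simp
        have h := (hasSum_fourier_cube (L := 16 * R) (by positivity) θ hsupp hxi).mul_left
          (cutoff R x * char (-ξ₀) x)
        have e : cutoff R x * char (-ξ₀) x * θ x = cutoff R x * φ x := by
          rw [hθ, cutoff_eq_one hR2 hx]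
          linear_combination (cutoff R x * φ x) * char_neg_mul ξ₀ x
        rw [e] at h
        exact h
  have h := hsum.mapL (f : 𝓢(E d, ℂ) →L[ℂ] ℂ)
  have h2 : HasSum (fun m => f (c m • modulation (-(ξ₀ - samplePt R m)) (cutoffS hR)))
      (f (SchwartzMap.smulLeftCLM ℂ (cutoff R : E d → ℂ) φ)) := h
  rw [hf] at h2
  refine h2.congr_fun fun m => ?_
  rw [map_smul, hc', smul_eq_mul, cutFourier]
  ring

theorem hasSum_sampling_distribution {R : ℝ} (hR : 0 < R) (hR2 : 0 < 2 * R) {f : 𝓢'(E d, ℂ)}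
    (hf : ∀ φ, f (SchwartzMap.smulLeftCLM ℂ (cutoff R : E d → ℂ) φ) = f φ) (ξ₀ : E d) :
    HasSum (fun m => (((((16 * R) ^ d)⁻¹ : ℝ) : ℂ) * cutFourier hR f (ξ₀ - samplePt R m)) •
      toTD d (modulation (ξ₀ - samplePt R m) (cutoffS hR2))) f := by
  refine PointwiseConvergenceCLM.tendsto_iff_forall_tendsto.2 fun φ => ?_
  refine (hasSum_sampling hR hR2 hf ξ₀ φ).congr fun s => ?_
  rw [sum_apply]
  rfl

end Sampling
end FourierBanach

namespace FourierBanach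

/-! ### Frequency localized operators -/

section FrequencyLocalization

variable {d : ℕ}

theorem integral_fourierS_mul_eq (φ ψ : 𝓢(E d, ℂ)) :
    ∫ ξ, fourierS d φ ξ * ψ ξ = ∫ x, φ x * fourierS d ψ x := by
  have hint : Integrable (Function.uncurry fun ξ x : E d =>
      φ x * Complex.exp (-(Complex.I * (inner ℝ x ξ : ℝ))) * ψ ξ) (volume.prod volume) := by
    refine ((ψ.integrable (μ := volume)).norm.mul_prod
      (φ.integrable (μ := volume)).norm).mono' ?_ (Filter.Eventually.of_forall fun p => ?_)
    · have h3 : Continuous fun p : E d × E d => φ p.2 := φ.continuous.comp continuous_snd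
      have h4 : Continuous fun p : E d × E d => ψ p.1 := ψ.continuous.comp continuous_fst
      have : Continuous (Function.uncurry fun ξ x : E d =>
          φ x * Complex.exp (-(Complex.I * (inner ℝ x ξ : ℝ))) * ψ ξ) := by
        unfold Function.uncurry
        fun_prop
      exact this.aestronglyMeasurable
    · have : ‖Complex.exp (-(Complex.I * (inner ℝ p.2 p.1 : ℝ)))‖ = 1 := by
        have := Complex.norm_exp_ofReal_mul_I (-(inner ℝ p.2 p.1))
        rwa [Complex.ofReal_neg, neg_mul, mul_comm] at this
      simp only [Function.uncurry, norm_mul, this]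
      exact (by ring : _ = _).le
  simp_rw [fourierS_apply]
  calc ∫ ξ, (((2 * Real.pi) ^ (-(d : ℝ) / 2) : ℝ) : ℂ) *
        (∫ x, φ x * Complex.exp (-(Complex.I * (inner ℝ x ξ : ℝ)))) * ψ ξ
      = (((2 * Real.pi) ^ (-(d : ℝ) / 2) : ℝ) : ℂ) *
        ∫ ξ, ∫ x, φ x * Complex.exp (-(Complex.I * (inner ℝ x ξ : ℝ))) * ψ ξ := by
        rw [← integral_const_mul]
        simp_rw [integral_mul_const, mul_assoc]
    _ = (((2 * Real.pi) ^ (-(d : ℝ) / 2) : ℝ) : ℂ) *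
        ∫ x, ∫ ξ, φ x * Complex.exp (-(Complex.I * (inner ℝ x ξ : ℝ))) * ψ ξ := by
        rw [integral_integral_swap hint]
    _ = _ := by
        rw [← integral_const_mul]
        refine integral_congr_ae (Filter.Eventually.of_forall fun x => ?_)
        simp only
        rw [mul_left_comm, ← integral_const_mul (φ x)]
        congr 2
        ext ξ
        rw [real_inner_comm]
        ring

theorem IsGivenBy.ae_eq {u : 𝓢'(E d, ℂ)} {g h : E d → ℂ} (hg : IsGivenBy u g)
    (hh : IsGivenBy u h) : g =ᵐ[volume] h := by
  refine ae_eq_of_integral_contDiff_smul_eq hg.1 hh.1 fun θ hθ hθc => ?_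
  have hc : HasCompactSupport (fun x => (θ x : ℂ)) := hθc.comp_left (g := ((↑) : ℝ → ℂ)) rfl
  have h1 := hg.2 (hc.toSchwartzMap (Complex.ofRealCLM.contDiff.comp hθ)) hc
  have h2 := hh.2 (hc.toSchwartzMap (Complex.ofRealCLM.contDiff.comp hθ)) hc
  rw [h1] at h2
  simp_rw [← Complex.coe_smul, smul_eq_mul, mul_comm ((θ _ : ℝ) : ℂ)]
  exact h2

/-- `A` maps functions with frequencies near `η` to functions with frequencies near `η`, with an
amplification controlled by `w`. -/
def FreqLocal (A : 𝓢'(E d, ℂ) →L[ℂ] 𝓢'(E d, ℂ)) (w : E d → ℝ) : Prop :=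
  ∀ χ : 𝓢(E d, ℂ), HasCompactSupport χ → ∃ ψ : E d → 𝓢(E d, ℂ),
    (∀ η, A (toTD d (modulation η χ)) = toTD d (ψ η)) ∧
    ∀ N : ℕ, ∃ C : ℝ, 0 ≤ C ∧ ∀ η ξ, (1 + ‖ξ - η‖) ^ N * ‖fourierS d (ψ η) ξ‖ ≤ C * w η

theorem exists_norm_fourierS_le (χ : 𝓢(E d, ℂ)) (N : ℕ) : ∃ C : ℝ, 0 ≤ C ∧
    ∀ ξ, (1 + ‖ξ‖) ^ N * ‖fourierS d χ ξ‖ ≤ C :=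
  ⟨2 ^ N * schwartzSup (E d) ℂ (N, 0) (fourierS d χ), by positivity,
    one_add_pow_mul_norm_le_schwartzSup N (fourierS d χ)⟩

theorem freqLocal_id : FreqLocal (ContinuousLinearMap.id ℂ 𝓢'(E d, ℂ)) fun _ => 1 := by
  refine fun χ _ => ⟨fun η => modulation η χ, fun η => rfl, fun N => ?_⟩
  obtain ⟨C, hC0, hC⟩ := exists_norm_fourierS_le χ N
  refine ⟨C, hC0, fun η ξ => ?_⟩
  rw [fourierS_modulation, mul_one]
  exact hC _

/-- A nonnegative function growing at most polynomially under translations. -/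
structure IsPolyModerate (w : E d → ℝ) : Prop where
  nonneg : ∀ ξ, 0 ≤ w ξ
  moderate : ∃ C : ℝ, ∃ M : ℕ, 0 ≤ C ∧ ∀ ξ η, w (ξ + η) ≤ C * w ξ * (1 + ‖η‖) ^ M

/-- The Fourier transform of the image of a compactly supported distribution under a frequency
localized operator, in terms of frequency samples. -/
theorem FreqLocal.exists_isGivenBy {A : 𝓢'(E d, ℂ) →L[ℂ] 𝓢'(E d, ℂ)} {w : E d → ℝ}
    (hA : FreqLocal A w) (hw : IsPolyModerate w) {R : ℝ} (hR : 0 < R) (hR2 : 0 < 2 * R)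
    {f : 𝓢'(E d, ℂ)} (hf : ∀ φ, f (SchwartzMap.smulLeftCLM ℂ (cutoff R : E d → ℂ) φ) = f φ) :
    ∃ ψ : E d → 𝓢(E d, ℂ), (∀ η, A (toTD d (modulation η (cutoffS hR2))) = toTD d (ψ η)) ∧
      (∀ N : ℕ, ∃ C : ℝ, 0 ≤ C ∧ ∀ η ξ, (1 + ‖ξ - η‖) ^ N * ‖fourierS d (ψ η) ξ‖ ≤ C * w η) ∧
      Continuous (fun ξ => ∑' m, ((((16 * R) ^ d)⁻¹ : ℝ) : ℂ) *
        cutFourier hR f (ξ - samplePt R m) * fourierS d (ψ (ξ - samplePt R m)) ξ) ∧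
      IsGivenBy (fourierT (A f)) fun ξ => ∑' m, ((((16 * R) ^ d)⁻¹ : ℝ) : ℂ) *
        cutFourier hR f (ξ - samplePt R m) * fourierS d (ψ (ξ - samplePt R m)) ξ := by
  obtain ⟨ψ, hψ, hb⟩ := hA (cutoffS hR2) (hasCompactSupport_cutoff hR2)
  refine ⟨ψ, hψ, hb, ?_⟩
  obtain ⟨k, C₁, hC₁0, hC₁⟩ := exists_norm_cutFourier_le hR f
  obtain ⟨C₂, M, hC₂0, hC₂⟩ := hw.moderate
  -- The off-diagonal decay has to beat the growth k of the samples and the growth M of w, and to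
  -- leave 2d powers for summation over the lattice.
  obtain ⟨C₃, hC₃0, hC₃⟩ := hb (k + M + 2 * d)
  set K := k + M + 2 * d with hK
  set a : E d → (Fin d → ℤ) → ℂ := fun ξ₀ m => ((((16 * R) ^ d)⁻¹ : ℝ) : ℂ) *
    cutFourier hR f (ξ₀ - samplePt R m) with ha
  set G : E d → E d → ℂ := fun ξ₀ ξ => ∑' m, a ξ₀ m * fourierS d (ψ (ξ₀ - samplePt R m)) ξ with hG
  have hbd : ∀ ξ₀, ∃ D : ℝ, 0 ≤ D ∧ ∀ m ξ, ‖a ξ₀ m * fourierS d (ψ (ξ₀ - samplePt R m)) ξ‖ ≤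
      D * (1 + ‖ξ‖) ^ K * ((1 + ‖samplePt R m‖) ^ (2 * d))⁻¹ := fun ξ₀ => by
    have hw0 := hw.nonneg ξ₀
    refine ⟨((16 * R) ^ d)⁻¹ * (C₁ * (1 + ‖ξ₀‖) ^ k) * (C₃ * (C₂ * w ξ₀) * (1 + ‖ξ₀‖) ^ K),
      by positivity, fun m ξ => ?_⟩
    set s := samplePt R m with hs
    have h1 : ‖a ξ₀ m‖ ≤ ((16 * R) ^ d)⁻¹ * (C₁ * ((1 + ‖ξ₀‖) ^ k * (1 + ‖s‖) ^ k)) := by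
      rw [ha, norm_mul, Complex.norm_real, Real.norm_of_nonneg (by positivity), ← mul_pow]
      have := one_add_norm_sub_le ξ₀ s
      gcongr
      exact (hC₁ _).trans (by gcongr)
    have h2 : w (ξ₀ - s) ≤ C₂ * w ξ₀ * (1 + ‖s‖) ^ M := by
      have := hC₂ ξ₀ (-s)
      rwa [norm_neg, ← sub_eq_add_neg] at this
    have h3 : 1 + ‖s‖ ≤ (1 + ‖ξ - (ξ₀ - s)‖) * ((1 + ‖ξ‖) * (1 + ‖ξ₀‖)) := by
      have e : s = (ξ - (ξ₀ - s)) - (ξ - ξ₀) := by abel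
      calc 1 + ‖s‖ = 1 + ‖(ξ - (ξ₀ - s)) - (ξ - ξ₀)‖ := by rw [← e]
        _ ≤ (1 + ‖ξ - (ξ₀ - s)‖) * (1 + ‖ξ - ξ₀‖) := one_add_norm_sub_le _ _
        _ ≤ _ := by gcongr; exact one_add_norm_sub_le _ _
    have h4 := hC₃ (ξ₀ - s) ξ
    rw [← div_eq_mul_inv, le_div_iff₀ (by positivity), norm_mul]
    have h5 : (1 + ‖s‖) ^ K * ‖fourierS d (ψ (ξ₀ - s)) ξ‖ ≤
        ((1 + ‖ξ‖) ^ K * (1 + ‖ξ₀‖) ^ K) * (C₃ * (C₂ * w ξ₀ * (1 + ‖s‖) ^ M)) := by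
      calc (1 + ‖s‖) ^ K * ‖fourierS d (ψ (ξ₀ - s)) ξ‖
          ≤ ((1 + ‖ξ - (ξ₀ - s)‖) * ((1 + ‖ξ‖) * (1 + ‖ξ₀‖))) ^ K *
            ‖fourierS d (ψ (ξ₀ - s)) ξ‖ := by gcongr
        _ = ((1 + ‖ξ‖) ^ K * (1 + ‖ξ₀‖) ^ K) *
            ((1 + ‖ξ - (ξ₀ - s)‖) ^ K * ‖fourierS d (ψ (ξ₀ - s)) ξ‖) := by
            rw [mul_pow, mul_pow]; ring
        _ ≤ _ := by
            exact mul_le_mul_of_nonneg_left (h4.trans (by gcongr)) (by positivity)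
    have hpos : 0 < (1 + ‖s‖) ^ M := by positivity
    have h6 : (1 + ‖s‖) ^ (k + 2 * d) * ‖fourierS d (ψ (ξ₀ - s)) ξ‖ ≤
        ((1 + ‖ξ‖) ^ K * (1 + ‖ξ₀‖) ^ K) * (C₃ * (C₂ * w ξ₀)) := by
      refine le_of_mul_le_mul_right ?_ hpos
      calc _ = (1 + ‖s‖) ^ K * ‖fourierS d (ψ (ξ₀ - s)) ξ‖ := by rw [hK]; ring
        _ ≤ _ := h5
        _ = _ := by ring
    calc ‖a ξ₀ m‖ * ‖fourierS d (ψ (ξ₀ - s)) ξ‖ * (1 + ‖s‖) ^ (2 * d)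
        ≤ ((16 * R) ^ d)⁻¹ * (C₁ * ((1 + ‖ξ₀‖) ^ k * (1 + ‖s‖) ^ k)) *
          ‖fourierS d (ψ (ξ₀ - s)) ξ‖ * (1 + ‖s‖) ^ (2 * d) := by gcongr
      _ = ((16 * R) ^ d)⁻¹ * (C₁ * (1 + ‖ξ₀‖) ^ k) *
          ((1 + ‖s‖) ^ (k + 2 * d) * ‖fourierS d (ψ (ξ₀ - s)) ξ‖) := by rw [pow_add]; ring
      _ ≤ ((16 * R) ^ d)⁻¹ * (C₁ * (1 + ‖ξ₀‖) ^ k) *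
          (((1 + ‖ξ‖) ^ K * (1 + ‖ξ₀‖) ^ K) * (C₃ * (C₂ * w ξ₀))) := by gcongr
      _ = _ := by ring
  have hs2 := summable_samplePt (d := d) hR le_rfl
  have hcont : ∀ ξ₀, Continuous (G ξ₀) := fun ξ₀ => by
    obtain ⟨D, hD0, hD⟩ := hbd ξ₀
    rw [continuous_iff_continuousAt]
    intro ξ
    have hc : ContinuousOn (G ξ₀) (Metric.ball 0 (‖ξ‖ + 1)) := by
      refine continuousOn_tsum (u := fun m => D * (1 + (‖ξ‖ + 1)) ^ K *
        ((1 + ‖samplePt R m‖) ^ (2 * d))⁻¹) (fun m => ?_) (hs2.mul_left _) fun m ξ' hξ' => ?_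
      · exact (continuous_const.mul (fourierS d (ψ (ξ₀ - samplePt R m))).continuous).continuousOn
      · refine (hD m ξ').trans ?_
        have := (mem_ball_zero_iff.1 hξ').le
        gcongr
    exact hc.continuousAt (Metric.isOpen_ball.mem_nhds (by simp))
  have hgiven : ∀ ξ₀, IsGivenBy (fourierT (A f)) (G ξ₀) := fun ξ₀ => by
    obtain ⟨D, hD0, hD⟩ := hbd ξ₀
    refine ⟨(hcont ξ₀).locallyIntegrable, fun φ _ => ?_⟩
    have h1 : HasSum (fun m => a ξ₀ m • (toTD d (ψ (ξ₀ - samplePt R m)))) (A f) := by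
      simpa only [map_smul, hψ] using (hasSum_sampling_distribution hR hR2 hf ξ₀).mapL A
    have h2 : HasSum (fun m => a ξ₀ m * ∫ ξ, fourierS d (ψ (ξ₀ - samplePt R m)) ξ * φ ξ)
        (A f (fourierS d φ)) := by
      have h := h1.mapL (PointwiseConvergenceCLM.evalCLM (RingHom.id ℂ) ℂ (fourierS d φ))
      refine h.congr_fun fun m => ?_
      have e : PointwiseConvergenceCLM.evalCLM (RingHom.id ℂ) ℂ (fourierS d φ)
          (a ξ₀ m • toTD d (ψ (ξ₀ - samplePt R m))) =
          a ξ₀ m * toTD d (ψ (ξ₀ - samplePt R m)) (fourierS d φ) := rfl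
      rw [e, toTD_apply, integral_fourierS_mul_eq φ]
      simp_rw [mul_comm (φ _)]
    have h3 : HasSum (fun m => ∫ ξ, a ξ₀ m * fourierS d (ψ (ξ₀ - samplePt R m)) ξ * φ ξ)
        (∫ ξ, ∑' m, a ξ₀ m * fourierS d (ψ (ξ₀ - samplePt R m)) ξ * φ ξ) := by
      have hmono : ∀ m ξ, ‖a ξ₀ m * fourierS d (ψ (ξ₀ - samplePt R m)) ξ * φ ξ‖ ≤
          D * ((1 + ‖samplePt R m‖) ^ (2 * d))⁻¹ * ((1 + ‖ξ‖) ^ K * ‖φ ξ‖) := fun m ξ => by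
        rw [norm_mul]
        calc _ ≤ D * (1 + ‖ξ‖) ^ K * ((1 + ‖samplePt R m‖) ^ (2 * d))⁻¹ * ‖φ ξ‖ := by
              gcongr; exact hD m ξ
          _ = _ := by ring
      have hint := integrable_one_add_pow_mul φ K
      have hI : ∀ m, Integrable fun ξ =>
          a ξ₀ m * fourierS d (ψ (ξ₀ - samplePt R m)) ξ * φ ξ := fun m => by
        refine (hint.const_mul (D * ((1 + ‖samplePt R m‖) ^ (2 * d))⁻¹)).mono' ?_
          (Filter.Eventually.of_forall fun ξ => hmono m ξ)
        exact ((continuous_const.mul (fourierS d (ψ (ξ₀ - samplePt R m))).continuous).mul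
          φ.continuous).aestronglyMeasurable
      refine hasSum_integral_of_summable_integral_norm hI ?_
      refine ((hs2.mul_left D).mul_right (∫ ξ, (1 + ‖ξ‖) ^ K * ‖φ ξ‖)).of_nonneg_of_le
        (fun m => integral_nonneg fun ξ => norm_nonneg _) fun m => ?_
      rw [← integral_const_mul]
      exact integral_mono (hI m).norm (hint.const_mul _) fun ξ => hmono m ξ
    have e1 : fourierT (A f) φ = A f (fourierS d φ) := rfl
    have h4 : HasSum (fun m => a ξ₀ m * ∫ ξ, fourierS d (ψ (ξ₀ - samplePt R m)) ξ * φ ξ)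
        (∫ ξ, ∑' m, a ξ₀ m * fourierS d (ψ (ξ₀ - samplePt R m)) ξ * φ ξ) :=
      h3.congr_fun fun m => by simp_rw [mul_assoc, integral_const_mul]
    rw [e1, h2.unique h4]
    exact integral_congr_ae (Filter.Eventually.of_forall fun ξ => tsum_mul_right)
  -- All G ξ₀ are continuous and represent the same distribution, hence they coincide at every
  -- point. Therefore ξ₀ may be chosen to depend on ξ, in particular ξ₀ = ξ.
  have hdiag : (fun ξ => G ξ ξ) = G 0 := by
    ext ξ
    have := (hcont ξ).ae_eq_iff_eq (μ := (volume : Measure (E d))) (hcont 0) |>.1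
      ((hgiven ξ).ae_eq (hgiven 0))
    rw [this]
  change Continuous (fun ξ => G ξ ξ) ∧ IsGivenBy (fourierT (A f)) fun ξ => G ξ ξ
  rw [hdiag]
  exact ⟨hcont 0, hgiven 0⟩

end FrequencyLocalization
end FourierBanach

namespace FourierBanach

/-! ### Domination by elements of a BF-space -/

section Domination

variable {d : ℕ} {B : Type*} [NormedAddCommGroup B] [NormedSpace ℂ B]
  {ι : B →ₗ[ℂ] (E d →ₘ[volume] ℂ)}

/-- `u` is dominated by the absolute value of an element of the BF-space. -/
def IsDominated (ι : B →ₗ[ℂ] (E d →ₘ[volume] ℂ)) (u : E d → ℝ) : Prop :=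
  ∃ b : B, ∀ᵐ ξ, u ξ ≤ ‖ι b ξ‖

theorem IsDominated.mono
    {u u' : E d → ℝ} (h : IsDominated ι u) (hle : ∀ᵐ ξ, u' ξ ≤ u ξ) :
    IsDominated ι u' := by
  obtain ⟨b, hb⟩ := h
  exact ⟨b, by filter_upwards [hb, hle] with ξ h1 h2 using h2.trans h1⟩

theorem IsDominated.const_mul {u : E d → ℝ} (h : IsDominated ι u) {c : ℝ} (hc : 0 ≤ c) :
    IsDominated ι fun ξ => c * u ξ := by
  obtain ⟨b, hb⟩ := h
  refine ⟨(c : ℂ) • b, ?_⟩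
  rw [map_smul]
  filter_upwards [hb, AEEqFun.coeFn_smul (c : ℂ) (ι b)] with ξ h1 h2
  rw [h2, Pi.smul_apply, norm_smul, Complex.norm_real, Real.norm_of_nonneg hc]
  gcongr

end Domination

/-! ### Solidity, absolutely convergent series and lattice translates in BF-spaces -/

section BFSpace

variable {d : ℕ} {B : Type*} [NormedAddCommGroup B] [NormedSpace ℂ B] [CompleteSpace B]
  {ι : B →ₗ[ℂ] (E d →ₘ[volume] ℂ)} {v : E d → ℝ}

theorem IsInvariantBFSpace.locallyIntegrable (hB : IsInvariantBFSpace ι v) (b : B) :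
    LocallyIntegrable (ι b) := by
  obtain ⟨T, hT⟩ := hB.tempered_embedding
  exact (hT b).1

/-- Elements of ℬ are locally integrable by the embedding into 𝓢', so the local integrability
demanded by solidity comes from the domination itself. -/
theorem IsInvariantBFSpace.exists_of_norm_le (hB : IsInvariantBFSpace ι v) :
    ∃ C : ℝ, 0 ≤ C ∧ ∀ (g : E d → ℂ) (b : B), AEStronglyMeasurable g volume →
      (∀ᵐ ξ, ‖g ξ‖ ≤ ‖ι b ξ‖) → ∃ b' : B, ι b' =ᵐ[volume] g ∧ ‖b'‖ ≤ C * ‖b‖ := by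
  obtain ⟨C, hC⟩ := hB.solid
  refine ⟨|C|, abs_nonneg C, fun g b hg hle => ?_⟩
  have hloc := (hB.locallyIntegrable b).mono hg hle
  have e := AEEqFun.coeFn_mk g hg
  have hloc' : LocallyIntegrable (AEEqFun.mk g hg) :=
    hloc.mono (AEEqFun.aestronglyMeasurable _) (e.mono fun ξ hξ => by rw [hξ])
  obtain ⟨b', hb', hn⟩ := hC (AEEqFun.mk g hg) b hloc' (by
    filter_upwards [e, hle] with ξ h1 h2
    rwa [h1])
  refine ⟨b', by rw [hb']; exact e, hn.trans ?_⟩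
  gcongr
  exact le_abs_self C

theorem IsInvariantBFSpace.exists_abs (hB : IsInvariantBFSpace ι v) :
    ∃ C : ℝ, 0 ≤ C ∧ ∀ b : B, ∃ b' : B, (ι b' =ᵐ[volume] fun ξ => ((‖ι b ξ‖ : ℝ) : ℂ)) ∧
      ‖b'‖ ≤ C * ‖b‖ := by
  obtain ⟨C, hC0, hC⟩ := hB.exists_of_norm_le
  refine ⟨C, hC0, fun b => hC _ b ?_ ?_⟩
  · exact Complex.continuous_ofReal.comp_aestronglyMeasurable
      (AEEqFun.aestronglyMeasurable (ι b)).norm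
  · exact Filter.Eventually.of_forall fun ξ => by simp

/-- ℬ embeds continuously in L¹ on balls: by solidity |b| is in ℬ as well, and its pairing with a
nonnegative bump equal to 1 on the ball is controlled by the continuity of ℬ → 𝓢'. -/
theorem IsInvariantBFSpace.exists_lintegral_le (hB : IsInvariantBFSpace ι v) {r : ℝ}
    (hr : 0 < r) : ∃ C : ℝ, 0 ≤ C ∧ ∀ b : B,
      ∫⁻ ξ in Metric.ball 0 r, ‖ι b ξ‖ₑ ≤ ENNReal.ofReal (C * ‖b‖) := by
  obtain ⟨C, hC0, hC⟩ := hB.exists_abs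
  obtain ⟨T, hT⟩ := hB.tempered_embedding
  set ℓ : B →L[ℂ] ℂ := (PointwiseConvergenceCLM.evalCLM (RingHom.id ℂ) ℂ (cutoffS hr)).comp T
    with hℓ
  refine ⟨‖ℓ‖ * C, by positivity, fun b => ?_⟩
  obtain ⟨b', hb', hn⟩ := hC b
  set β : E d → ℝ := fun ξ => unitBump d (r⁻¹ • ξ) with hβ
  have hβc : Continuous β := (unitBump d).continuous.comp (continuous_const_smul _)
  have hβ0 : ∀ ξ, 0 ≤ β ξ := fun ξ => (unitBump d).nonneg
  have hβs : HasCompactSupport β := by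
    have := (hasCompactSupport_cutoff (d := d) hr).comp_left (g := Complex.re) rfl
    exact this
  have hint : Integrable fun ξ => ‖ι b ξ‖ * β ξ := by
    have h := (LocallyIntegrable.integrable_smul_left_of_hasCompactSupport
      (hB.locallyIntegrable b) hβc hβs).norm
    refine h.congr (Filter.Eventually.of_forall fun ξ => ?_)
    simp only
    rw [norm_smul, Real.norm_of_nonneg (hβ0 ξ), mul_comm]
  have h1 : ℓ b' = ((∫ ξ, ‖ι b ξ‖ * β ξ : ℝ) : ℂ) := by
    have e : ℓ b' = T b' (cutoffS hr) := rfl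
    have h0 := (hT b').2 (cutoffS hr) (hasCompactSupport_cutoff hr)
    rw [e, h0, ← integral_complex_ofReal]
    refine integral_congr_ae ?_
    filter_upwards [hb'] with ξ hξ
    rw [hξ, cutoffS_apply, cutoff, Complex.ofReal_mul]
  have h2 : ∫ ξ, ‖ι b ξ‖ * β ξ ≤ ‖ℓ‖ * C * ‖b‖ := by
    calc ∫ ξ, ‖ι b ξ‖ * β ξ ≤ ‖ℓ b'‖ := by
          rw [h1, Complex.norm_real]
          exact le_abs_self _
      _ ≤ ‖ℓ‖ * ‖b'‖ := ℓ.le_opNorm b'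
      _ ≤ ‖ℓ‖ * (C * ‖b‖) := by gcongr
      _ = _ := by ring
  calc ∫⁻ ξ in Metric.ball 0 r, ‖ι b ξ‖ₑ
      ≤ ∫⁻ ξ in Metric.ball 0 r, ENNReal.ofReal (‖ι b ξ‖ * β ξ) := by
        refine setLIntegral_mono' Metric.isOpen_ball.measurableSet fun ξ hξ => ?_
        have : β ξ = 1 := by
          refine (unitBump d).one_of_mem_closedBall ?_
          rw [mem_closedBall_zero_iff, norm_smul, norm_inv, Real.norm_of_nonneg hr.le,
            inv_mul_le_iff₀ hr]
          simpa [unitBump] using (mem_ball_zero_iff.1 hξ).le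
        rw [this, mul_one, ofReal_norm]
    _ ≤ ∫⁻ ξ, ENNReal.ofReal (‖ι b ξ‖ * β ξ) := setLIntegral_le_lintegral _ _
    _ = ENNReal.ofReal (∫ ξ, ‖ι b ξ‖ * β ξ) :=
        (ofReal_integral_eq_lintegral_ofReal hint (Filter.Eventually.of_forall fun ξ =>
          mul_nonneg (norm_nonneg _) (hβ0 ξ))).symm
    _ ≤ _ := ENNReal.ofReal_le_ofReal h2

/-- The series of nonnegative elements of a BF-space converges pointwise a.e. if it converges
absolutely in norm. -/
theorem IsInvariantBFSpace.exists_ae_sum_le (hB : IsInvariantBFSpace ι v) {κ : Type*} [Countable κ]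
    {b : κ → B} {u : κ → E d → ℝ} (hu0 : ∀ m ξ, 0 ≤ u m ξ)
    (hu : ∀ m, ι (b m) =ᵐ[volume] fun ξ => ((u m ξ : ℝ) : ℂ)) (hb : Summable fun m => ‖b m‖) :
    ∃ H : B, ∀ᵐ ξ, ∀ s : Finset κ, ∑ m ∈ s, u m ξ ≤ ‖ι H ξ‖ := by
  have hsum : Summable b := hb.of_norm
  refine ⟨∑' m, b m, ?_⟩
  set H := ∑' m, b m with hH
  rw [ae_all_iff]
  intro s
  have hιs : ∀ s : Finset κ, ∀ᵐ ξ, ι (∑ m ∈ s, b m) ξ = ((∑ m ∈ s, u m ξ : ℝ) : ℂ) := by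
    intro s
    classical
    induction s using Finset.induction_on with
    | empty =>
      rw [Finset.sum_empty, map_zero]
      filter_upwards [AEEqFun.coeFn_zero (α := E d) (β := ℂ) (μ := volume)] with ξ hξ
      rw [hξ]
      simp
    | insert m s hm ih =>
      rw [Finset.sum_insert hm, map_add]
      filter_upwards [AEEqFun.coeFn_add (ι (b m)) (ι (∑ m ∈ s, b m)), ih, hu m] with ξ h1 h2 h3
      rw [h1, Pi.add_apply, h2, h3, Finset.sum_insert hm]
      push_cast
      rfl
  -- For finite s ⊆ s', the positive part of (sum over s) - |H| is at most |(sum over s') - H|, by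
  -- nonnegativity of the terms. The right side tends to 0 in L¹ of the ball as s' grows, so the
  -- positive part vanishes a.e.
  have key : ∀ r : ℕ, ∀ᵐ ξ ∂(volume.restrict (Metric.ball (0 : E d) (r + 1))),
      ∑ m ∈ s, u m ξ ≤ ‖ι H ξ‖ := by
    intro r
    obtain ⟨C, hC0, hC⟩ := hB.exists_lintegral_le (r := (r : ℝ) + 1) (by positivity)
    have hle : ∀ s' : Finset κ, s ⊆ s' →
        ∫⁻ ξ in Metric.ball 0 (r + 1), ENNReal.ofReal (‖ι (∑ m ∈ s, b m) ξ‖ - ‖ι H ξ‖) ≤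
          ENNReal.ofReal (C * ‖∑ m ∈ s', b m - H‖) := by
      intro s' hss
      refine le_trans (lintegral_mono_ae (ae_restrict_of_ae ?_)) (hC (∑ m ∈ s', b m - H))
      rw [map_sub]
      filter_upwards [hιs s, hιs s', AEEqFun.coeFn_sub (ι (∑ m ∈ s', b m)) (ι H)] with ξ h1 h2 h3
      rw [h3, Pi.sub_apply, ← ofReal_norm, h1]
      refine ENNReal.ofReal_le_ofReal ?_
      have h4 : ∑ m ∈ s, u m ξ ≤ ∑ m ∈ s', u m ξ :=
        Finset.sum_le_sum_of_subset_of_nonneg hss fun m _ _ => hu0 m ξ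
      have h5 : ‖((∑ m ∈ s, u m ξ : ℝ) : ℂ)‖ ≤ ‖((∑ m ∈ s', u m ξ : ℝ) : ℂ)‖ := by
        rw [Complex.norm_real, Complex.norm_real, Real.norm_of_nonneg, Real.norm_of_nonneg]
        · exact h4
        · exact Finset.sum_nonneg fun m _ => hu0 m ξ
        · exact Finset.sum_nonneg fun m _ => hu0 m ξ
      rw [h2]
      linarith [norm_sub_norm_le ((∑ m ∈ s', u m ξ : ℝ) : ℂ) (ι H ξ)]
    have hlim : Filter.Tendsto (fun s' : Finset κ => ENNReal.ofReal (C * ‖∑ m ∈ s', b m - H‖))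
        Filter.atTop (nhds 0) := by
      have h1 : Filter.Tendsto (fun s' : Finset κ => ‖∑ m ∈ s', b m - H‖) Filter.atTop (nhds 0) :=
        tendsto_iff_norm_sub_tendsto_zero.1 hsum.hasSum
      have h2 := (ENNReal.tendsto_ofReal (h1.const_mul C))
      simpa using h2
    have h0 : ∫⁻ ξ in Metric.ball 0 (r + 1),
        ENNReal.ofReal (‖ι (∑ m ∈ s, b m) ξ‖ - ‖ι H ξ‖) = 0 := by
      refine le_antisymm (ge_of_tendsto hlim ?_) (zero_le)
      filter_upwards [Filter.eventually_ge_atTop s] with s' hs'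
      exact hle s' hs'
    rw [lintegral_eq_zero_iff'] at h0
    · filter_upwards [h0, ae_restrict_of_ae (hιs s)] with ξ h1 h2
      have h3 := ENNReal.ofReal_eq_zero.1 h1
      rw [h2, Complex.norm_real, Real.norm_of_nonneg (Finset.sum_nonneg fun m _ => hu0 m ξ)] at h3
      linarith
    · exact (((AEEqFun.aestronglyMeasurable _).norm.sub
        (AEEqFun.aestronglyMeasurable _).norm).aemeasurable.ennreal_ofReal).restrict
  have hun : (⋃ r : ℕ, Metric.ball (0 : E d) (r + 1)) = Set.univ :=
    Set.eq_univ_of_forall fun ξ => by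
      obtain ⟨n, hn⟩ := exists_nat_gt ‖ξ‖
      exact Set.mem_iUnion.2 ⟨n, by rw [mem_ball_zero_iff]; linarith⟩
  have := (ae_restrict_iUnion_iff _ _).2 key
  rwa [hun, Measure.restrict_univ] at this

theorem IsDominated.add (hB : IsInvariantBFSpace ι v) {u u' : E d → ℝ} (h : IsDominated ι u)
    (h' : IsDominated ι u') : IsDominated ι fun ξ => u ξ + u' ξ := by
  obtain ⟨b, hb⟩ := h
  obtain ⟨b', hb'⟩ := h'
  obtain ⟨C, -, hC⟩ := hB.exists_abs
  obtain ⟨a, ha, -⟩ := hC b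
  obtain ⟨a', ha', -⟩ := hC b'
  refine ⟨a + a', ?_⟩
  rw [map_add]
  filter_upwards [hb, hb', ha, ha', AEEqFun.coeFn_add (ι a) (ι a')] with ξ h1 h2 h3 h4 h5
  rw [h5, Pi.add_apply, h3, h4, ← Complex.ofReal_add, Complex.norm_real,
    Real.norm_of_nonneg (by positivity)]
  linarith

theorem IsDominated.exists_eq (hB : IsInvariantBFSpace ι v) {g : E d → ℂ}
    (h : IsDominated ι fun ξ => ‖g ξ‖) (hg : AEStronglyMeasurable g volume) :
    ∃ b : B, ι b =ᵐ[volume] g := by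
  obtain ⟨C, -, hC⟩ := hB.exists_of_norm_le
  obtain ⟨b, hb⟩ := h
  obtain ⟨b', hb', -⟩ := hC g b hg hb
  exact ⟨b', hb'⟩

/-- Sums of translates along the sampling lattice, with rapidly decaying coefficients. -/
theorem IsInvariantBFSpace.exists_sum_translates_le (hB : IsInvariantBFSpace ι v) {R : ℝ}
    (hR : 0 < R) : ∃ N : ℕ, ∀ b : B, ∃ H : B, ∀ᵐ ξ, ∀ s : Finset (Fin d → ℤ),
      ∑ m ∈ s, ((1 + ‖samplePt R m‖) ^ N)⁻¹ * ‖ι b (ξ - samplePt R m)‖ ≤ ‖ι H ξ‖ := by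
  obtain ⟨Cv, Nv, hCv0, hCv⟩ := hB.weight.exists_moderate
  obtain ⟨Ct, hCt⟩ := hB.translation
  obtain ⟨Ca, hCa0, hCa⟩ := hB.exists_abs
  -- The translation norms grow like the power Nv; the remaining 2d powers make the lattice sum
  -- converge.
  refine ⟨Nv + 2 * d, fun b => ?_⟩
  obtain ⟨a, ha, -⟩ := hCa b
  choose t ht htn using fun m : Fin d → ℤ => hCt (samplePt R m) a
  refine hB.exists_ae_sum_le (κ := Fin d → ℤ)
    (b := fun m => ((((1 + ‖samplePt R m‖) ^ (Nv + 2 * d))⁻¹ : ℝ) : ℂ) • t m)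
    (u := fun m ξ => ((1 + ‖samplePt R m‖) ^ (Nv + 2 * d))⁻¹ * ‖ι b (ξ - samplePt R m)‖)
    (fun m ξ => by positivity) (fun m => ?_) ?_
  · rw [map_smul]
    have hae := (measurePreserving_sub_right (volume : Measure (E d))
      (samplePt R m)).quasiMeasurePreserving.ae ha
    filter_upwards [AEEqFun.coeFn_smul ((((1 + ‖samplePt R m‖) ^ (Nv + 2 * d))⁻¹ : ℝ) : ℂ) (ι (t m)),
      ht m, hae] with ξ h1 h2 h3
    rw [h1, Pi.smul_apply, h2, h3, smul_eq_mul, Complex.ofReal_mul]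
  · have hs := (summable_samplePt (d := d) hR le_rfl).mul_left (|Ct| * (Cv * v 0) * ‖a‖)
    refine hs.of_nonneg_of_le (fun m => norm_nonneg _) fun m => ?_
    have hv0 := (hB.weight.pos 0).le
    have hvm := (hB.weight.pos (samplePt R m)).le
    have h1 : v (samplePt R m) ≤ Cv * v 0 * (1 + ‖samplePt R m‖) ^ Nv := by
      simpa using hCv 0 (samplePt R m)
    have h2 : ‖t m‖ ≤ |Ct| * (Cv * v 0 * (1 + ‖samplePt R m‖) ^ Nv) * ‖a‖ := by
      refine (htn m).trans ?_
      have := le_abs_self Ct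
      gcongr
    rw [norm_smul, Complex.norm_real, Real.norm_of_nonneg (by positivity), inv_mul_le_iff₀ (by positivity)]
    refine h2.trans (le_of_eq ?_)
    have h3 : (1 + ‖samplePt R m‖) ^ (2 * d) ≠ 0 := by positivity
    rw [pow_add]
    field_simp

theorem IsInvariantBFSpace.isDominated_tsum (hB : IsInvariantBFSpace ι v) {R : ℝ}
    (hR : 0 < R) : ∃ N : ℕ, ∀ b : B, (∀ᵐ ξ, Summable fun m : Fin d → ℤ =>
      ((1 + ‖samplePt R m‖) ^ N)⁻¹ * ‖ι b (ξ - samplePt R m)‖) ∧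
      IsDominated ι fun ξ => ∑' m, ((1 + ‖samplePt R m‖) ^ N)⁻¹ * ‖ι b (ξ - samplePt R m)‖ := by
  obtain ⟨N, hN⟩ := hB.exists_sum_translates_le hR
  refine ⟨N, fun b => ?_⟩
  obtain ⟨H, hH⟩ := hN b
  exact ⟨hH.mono fun ξ hξ => summable_of_sum_le (fun m => by positivity) hξ, H,
    hH.mono fun ξ hξ => Real.tsum_le_of_sum_le (fun m => by positivity) hξ⟩

theorem exists_norm_sub_latticePt_le {c : ℝ} (hc : 0 < c) (ξ : E d) :
    ∃ m : Fin d → ℤ, ‖ξ - latticePt c m‖ ≤ d * c := by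
  refine ⟨fun i => ⌊ξ i / c⌋, ?_⟩
  have h1 : ∀ i, |(ξ - latticePt c fun i => ⌊ξ i / c⌋) i| ≤ c := fun i => by
    have h1 := Int.floor_le (ξ i / c)
    have h2 := Int.lt_floor_add_one (ξ i / c)
    rw [le_div_iff₀ hc] at h1
    rw [div_lt_iff₀ hc] at h2
    rw [PiLp.sub_apply, latticePt_apply, abs_le]
    constructor <;> nlinarith
  rw [EuclideanSpace.norm_eq, Real.sqrt_le_left (by positivity)]
  calc ∑ i, ‖(ξ - latticePt c fun i => ⌊ξ i / c⌋) i‖ ^ 2 ≤ ∑ _i : Fin d, c ^ 2 :=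
        Finset.sum_le_sum fun i _ => pow_le_pow_left₀ (norm_nonneg _) (h1 i) 2
    _ = d * c ^ 2 := by simp
    _ ≤ (d * c) ^ 2 := by
        rw [mul_pow]
        have : (d : ℝ) ≤ (d : ℝ) ^ 2 := by exact_mod_cast Nat.le_self_pow two_ne_zero d
        gcongr

/-- Each ξ lies within a fixed distance of some lattice point, where the corresponding translate of
a cutoff equals 1. The weighted sum of these translates is thus bounded below by a multiple of the
required power. -/
theorem IsInvariantBFSpace.isDominated_inv_pow (hB : IsInvariantBFSpace ι v) :
    ∃ N : ℕ, IsDominated ι fun ξ => ((1 + ‖ξ‖) ^ N)⁻¹ := by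
  obtain ⟨N, hN⟩ := hB.exists_sum_translates_le one_pos
  obtain ⟨J, hJ⟩ := hB.schwartz_embedding
  set c := 2 * Real.pi / (16 * 1) with hc
  have hc0 : 0 < c := by positivity
  have hr : 0 < d * c + 1 := by positivity
  obtain ⟨H, hH⟩ := hN (J (cutoffS hr))
  refine ⟨N, ?_⟩
  have hdom : IsDominated ι fun ξ => (((1 + (d * c + 1)) ^ N))⁻¹ * ((1 + ‖ξ‖) ^ N)⁻¹ := by
    refine ⟨H, ?_⟩
    have hae : ∀ᵐ ξ : E d, ∀ m : Fin d → ℤ, ι (J (cutoffS hr)) (ξ - samplePt 1 m) =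
        cutoff (d * c + 1) (ξ - samplePt 1 m) := by
      rw [ae_all_iff]
      exact fun m => (measurePreserving_sub_right (volume : Measure (E d))
        (samplePt 1 m)).quasiMeasurePreserving.ae (hJ (cutoffS hr))
    filter_upwards [hH, hae] with ξ h1 h2
    obtain ⟨m, hm⟩ := exists_norm_sub_latticePt_le hc0 ξ
    have h3 := h1 {m}
    rw [Finset.sum_singleton, h2, cutoff_eq_one hr (by change ‖ξ - latticePt c m‖ ≤ _; linarith),
      norm_one, mul_one] at h3
    refine le_trans ?_ h3
    rw [← mul_inv, ← mul_pow]
    refine inv_anti₀ (by positivity) ?_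
    have h4 : 1 + ‖samplePt 1 m‖ ≤ (1 + (d * c + 1)) * (1 + ‖ξ‖) := by
      have e : samplePt 1 m = ξ - (ξ - latticePt c m) := by
        rw [sub_sub_cancel]
        rfl
      rw [e]
      refine (one_add_norm_sub_le _ _).trans ?_
      rw [mul_comm]
      gcongr
      linarith
    gcongr
  refine (hdom.const_mul (c := (1 + (d * c + 1)) ^ N) (by positivity)).mono
    (Filter.Eventually.of_forall fun ξ => ?_)
  rw [mul_inv_cancel_left₀ (by positivity)]

end BFSpace
end FourierBanach

namespace FourierBanach

/-! ### The Fourier transform of a compactly supported distribution -/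

section Identification

variable {d : ℕ}

theorem toTD_injective : Function.Injective (toTD d) := fun φ ψ h => by
  rw [← sub_eq_zero]
  refine eq_zero_of_forall_integral_eq_zero fun θ => ?_
  have := DFunLike.congr_fun (map_sub (toTD d) φ ψ) θ
  rw [toTD_apply, h, sub_self] at this
  exact this

theorem isPolyModerate_one : IsPolyModerate fun _ : E d => 1 :=
  ⟨fun _ => zero_le_one, 1, 0, zero_le_one, fun _ _ => by simp⟩

/-- The Fourier transform of a compactly supported distribution is a function. -/
theorem isGivenBy_fourierT_cutFourier {R : ℝ} (hR : 0 < R) {f : 𝓢'(E d, ℂ)}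
    (hf : ∀ φ, f (SchwartzMap.smulLeftCLM ℂ (cutoff R : E d → ℂ) φ) = f φ) :
    IsGivenBy (fourierT f) fun ξ =>
      (((2 * Real.pi) ^ (-(d : ℝ) / 2) : ℝ) : ℂ) * cutFourier hR f ξ := by
  have hR2 : 0 < 2 * R := by positivity
  have hR4 : 0 < 2 * (2 * R) := by positivity
  obtain ⟨ψ, hψ, -, -, hg⟩ := freqLocal_id.exists_isGivenBy isPolyModerate_one hR hR2 hf
  rw [ContinuousLinearMap.id_apply] at hg
  convert hg using 1
  ext ξ
  set c : ℂ := (((2 * Real.pi) ^ (-(d : ℝ) / 2) : ℝ) : ℂ) with hc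
  have h1 : ∀ η, fourierS d (ψ η) ξ =
      c * toTD d (modulation η (cutoffS hR2)) (modulation (-ξ) (cutoffS hR4)) := fun η => by
    rw [← toTD_injective (hψ η), fourierS_apply, toTD_apply]
    refine congrArg _ (integral_congr_ae (Filter.Eventually.of_forall fun x => ?_))
    simp only
    rw [modulation_apply, modulation_apply, cutoffS_apply, cutoffS_apply]
    have e : Complex.exp (-(Complex.I * (inner ℝ x ξ : ℝ))) = char (-ξ) x := by
      rw [char, inner_neg_right]
      push_cast
      ring_nf
    rw [e]
    linear_combination (-(char η x * char (-ξ) x)) * cutoff_mul_cutoff hR2 x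
  have hχ : ∀ x, cutoff R x * cutoffS (d := d) hR4 x = cutoff R x := fun x => by
    rw [cutoffS_apply]
    rcases le_total ‖x‖ (2 * R) with h | h
    · rw [cutoff_eq_one hR4 (by linarith), mul_one]
    · rw [cutoff_eq_zero hR h, zero_mul]
  -- The series produced by the identity operator is the sampling series of f tested on e^{-i⟨x, ξ⟩}
  -- times a cutoff at scale 4R. That cutoff is 1 on the supports of the smaller ones, so the series
  -- sums to the sample at ξ.
  have h2 := (hasSum_sampling hR hR2 hf ξ (modulation (-ξ) (cutoffS hR4))).mul_left c
  rw [apply_modulation_eq_cutFourier hR hf ξ _ hχ] at h2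
  rw [← h2.tsum_eq]
  refine tsum_congr fun m => ?_
  rw [h1]
  ring

end Identification

/-! ### Pointwise bound by a discrete convolution -/

section KernelBound

variable {d : ℕ}

/-- In the diagonal representation the packet with frequency ξ - s is evaluated at distance |s| from
its centre, so frequency localization turns into decay in s. The condition on N only secures
summability against the growth of the samples. -/
theorem FreqLocal.exists_isGivenBy_le {A : 𝓢'(E d, ℂ) →L[ℂ] 𝓢'(E d, ℂ)} {w : E d → ℝ}
    (hA : FreqLocal A w) (hw : IsPolyModerate w) {R : ℝ} (hR : 0 < R)
    {f : 𝓢'(E d, ℂ)} (hf : ∀ φ, f (SchwartzMap.smulLeftCLM ℂ (cutoff R : E d → ℂ) φ) = f φ)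
    {k : ℕ} {C₁ : ℝ} (hC₁0 : 0 ≤ C₁)
    (hk : ∀ η, ‖cutFourier hR f η‖ ≤ C₁ * (1 + ‖η‖) ^ k) :
    ∃ G : E d → ℂ, Continuous G ∧ IsGivenBy (fourierT (A f)) G ∧
      ∀ N, k + 2 * d ≤ N → ∃ C : ℝ, 0 ≤ C ∧ ∀ ξ,
        Summable (fun m => ((1 + ‖samplePt R m‖) ^ N)⁻¹ * ‖cutFourier hR f (ξ - samplePt R m)‖) ∧
        ‖G ξ‖ ≤ C * w ξ *
          ∑' m, ((1 + ‖samplePt R m‖) ^ N)⁻¹ * ‖cutFourier hR f (ξ - samplePt R m)‖ := by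
  obtain ⟨ψ, -, hb, hGc, hG⟩ := hA.exists_isGivenBy hw hR (by positivity) hf
  refine ⟨_, hGc, hG, fun N hN => ?_⟩
  obtain ⟨C₂, M, hC₂0, hC₂⟩ := hw.moderate
  -- The additional M powers pay for replacing w(ξ - s) by w(ξ).
  obtain ⟨C₃, hC₃0, hC₃⟩ := hb (N + M)
  refine ⟨((16 * R) ^ d)⁻¹ * C₃ * C₂, by positivity, fun ξ => ?_⟩
  have hw0 := hw.nonneg ξ
  have hsum : Summable fun m => ((1 + ‖samplePt R m‖) ^ N)⁻¹ *
      ‖cutFourier hR f (ξ - samplePt R m)‖ := by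
    refine ((summable_samplePt (d := d) hR le_rfl).mul_left (C₁ * (1 + ‖ξ‖) ^ k)).of_nonneg_of_le
      (fun m => by positivity) fun m => ?_
    set s := samplePt R m
    have h1 : ‖cutFourier hR f (ξ - s)‖ ≤ C₁ * ((1 + ‖ξ‖) * (1 + ‖s‖)) ^ k := by
      refine (hk _).trans ?_
      gcongr
      exact one_add_norm_sub_le _ _
    have h2 : (1 + ‖s‖) ^ (k + 2 * d) ≤ (1 + ‖s‖) ^ N := pow_le_pow_right₀ (by simp) hN
    calc ((1 + ‖s‖) ^ N)⁻¹ * ‖cutFourier hR f (ξ - s)‖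
        ≤ ((1 + ‖s‖) ^ (k + 2 * d))⁻¹ * (C₁ * ((1 + ‖ξ‖) * (1 + ‖s‖)) ^ k) := by gcongr
      _ = _ := by
          rw [pow_add, mul_pow]
          field_simp
  refine ⟨hsum, ?_⟩
  have hterm : ∀ m, ‖((((16 * R) ^ d)⁻¹ : ℝ) : ℂ) * cutFourier hR f (ξ - samplePt R m) *
      fourierS d (ψ (ξ - samplePt R m)) ξ‖ ≤ ((16 * R) ^ d)⁻¹ * C₃ * C₂ * w ξ *
      (((1 + ‖samplePt R m‖) ^ N)⁻¹ * ‖cutFourier hR f (ξ - samplePt R m)‖) := fun m => by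
    set s := samplePt R m
    have h2 : w (ξ - s) ≤ C₂ * w ξ * (1 + ‖s‖) ^ M := by
      have := hC₂ ξ (-s)
      rwa [norm_neg, ← sub_eq_add_neg] at this
    have h3 := hC₃ (ξ - s) ξ
    rw [sub_sub_cancel] at h3
    have h4 : ‖fourierS d (ψ (ξ - s)) ξ‖ ≤ C₃ * (C₂ * w ξ) * ((1 + ‖s‖) ^ N)⁻¹ := by
      rw [← div_eq_mul_inv, le_div_iff₀ (by positivity)]
      have hpos : 0 < (1 + ‖s‖) ^ M := by positivity
      refine le_of_mul_le_mul_right ?_ hpos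
      calc _ = (1 + ‖s‖) ^ (N + M) * ‖fourierS d (ψ (ξ - s)) ξ‖ := by ring
        _ ≤ C₃ * w (ξ - s) := h3
        _ ≤ C₃ * (C₂ * w ξ * (1 + ‖s‖) ^ M) := by gcongr
        _ = _ := by ring
    rw [norm_mul, norm_mul, Complex.norm_real, Real.norm_of_nonneg (by positivity)]
    calc _ ≤ ((16 * R) ^ d)⁻¹ * ‖cutFourier hR f (ξ - s)‖ *
          (C₃ * (C₂ * w ξ) * ((1 + ‖s‖) ^ N)⁻¹) := by gcongr
      _ = _ := by ring
  rw [← tsum_mul_left]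
  exact tsum_of_norm_bounded (hsum.mul_left _).hasSum hterm

end KernelBound

/-! ### Separation of cones -/

section Cones

variable {d : ℕ}

/-- Uniform angular separation of `Γ₂` from the complement of `Γ₁`. -/
def IsConeSeparated (Γ₁ Γ₂ : Set (E d)) : Prop :=
  ∃ c : ℝ, 0 < c ∧ c ≤ 1 ∧ ∀ ξ ∈ Γ₂, ∀ ζ ∉ Γ₁, c * ‖ξ‖ ≤ ‖ξ - ζ‖

/-- On the unit sphere the closure of Γ₂ is compact and contained in the open set Γ₁, hence at
positive distance from the complement; homogeneity does the rest. -/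
theorem IsOpenCone.isConeSeparated {Γ₁ Γ₂ : Set (E d)} (h₁ : IsOpenCone Γ₁) (h₂ : IsOpenCone Γ₂)
    (h : closure Γ₂ \ {0} ⊆ Γ₁) : IsConeSeparated Γ₁ Γ₂ := by
  have hK : IsCompact (closure Γ₂ ∩ Metric.sphere 0 1) :=
    (isCompact_sphere _ _).inter_left isClosed_closure
  have hKs : closure Γ₂ ∩ Metric.sphere 0 1 ⊆ Γ₁ := fun ξ hξ => h ⟨hξ.1, fun h0 => by
    have h1 : ξ = 0 := h0
    simpa [h1] using hξ.2⟩
  obtain ⟨δ, hδ, hδs⟩ := hK.exists_thickening_subset_open h₁.isOpen hKs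
  -- A constant at most 1 allows the passage from c|ξ| ≤ |s| to c(1 + |ξ|) ≤ 1 + |s|.
  refine ⟨min δ 1, by positivity, min_le_right _ _, fun ξ hξ ζ hζ => ?_⟩
  by_contra! hlt
  have hξ0 : 0 < ‖ξ‖ := norm_pos_iff.2 fun h0 => h₂.zero_notMem (h0 ▸ hξ)
  refine hζ ?_
  have h3 : ‖ξ‖⁻¹ • ζ ∈ Γ₁ := by
    refine hδs (Metric.mem_thickening_iff.2 ⟨‖ξ‖⁻¹ • ξ,
      ⟨subset_closure (h₂.smul_mem _ (by positivity) ξ hξ), ?_⟩, ?_⟩)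
    · rw [mem_sphere_zero_iff_norm, norm_smul, norm_inv, norm_norm, inv_mul_cancel₀ hξ0.ne']
    · rw [dist_comm, dist_eq_norm, ← smul_sub, norm_smul, norm_inv, norm_norm,
        inv_mul_lt_iff₀ hξ0, mul_comm]
      exact hlt.trans_le (by gcongr; exact min_le_left _ _)
  have := h₁.smul_mem ‖ξ‖ hξ0 _ h3
  rwa [smul_inv_smul₀ hξ0.ne'] at this

theorem IsOpenCone.exists_isConeSeparated {Γ : Set (E d)} (h : IsOpenCone Γ) {ξ₀ : E d}
    (hξ₀ : ξ₀ ∈ Γ) : ∃ Γ' : Set (E d), IsOpenCone Γ' ∧ ξ₀ ∈ Γ' ∧ IsConeSeparated Γ Γ' := by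
  obtain ⟨ε, hε, hball⟩ := Metric.isOpen_iff.1 h.isOpen ξ₀ hξ₀
  have hpos : 0 < ‖ξ₀‖ := norm_pos_iff.2 fun h0 => h.zero_notMem (h0 ▸ hξ₀)
  -- Γ' is the cone over the ball of radius r around ξ₀. The bound r ≤ |ξ₀| excludes the origin; r ≤
  -- ε/2 leaves distance at least r from that ball to the complement of Γ. Since the ball lies
  -- within norm |ξ₀| + r, the separation constant is r / (|ξ₀| + r).
  set r := min (ε / 2) ‖ξ₀‖ with hr
  have hr0 : 0 < r := by positivity
  refine ⟨{ξ | ∃ t : ℝ, 0 < t ∧ ‖t • ξ - ξ₀‖ < r}, ⟨?_, ?_, ?_⟩, ⟨1, one_pos, by simpa⟩,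
    r / (‖ξ₀‖ + r), by positivity, ?_, ?_⟩
  · have : {ξ : E d | ∃ t : ℝ, 0 < t ∧ ‖t • ξ - ξ₀‖ < r} =
        ⋃ (t : ℝ) (_ : 0 < t), {ξ | ‖t • ξ - ξ₀‖ < r} := by
      ext ξ
      simp
    rw [this]
    exact isOpen_iUnion fun t => isOpen_iUnion fun _ =>
      isOpen_lt (by fun_prop) continuous_const
  · rintro ⟨t, -, ht⟩
    rw [smul_zero, zero_sub, norm_neg] at ht
    exact absurd ht (not_lt.2 (min_le_right _ _))
  · rintro t ht ξ ⟨t', ht', hlt⟩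
    refine ⟨t' * t⁻¹, by positivity, ?_⟩
    rwa [smul_smul, inv_mul_cancel_right₀ ht.ne']
  · rw [div_le_one (by positivity)]
    linarith
  · rintro ξ ⟨t, ht, hlt⟩ ζ hζ
    have h1 : ε ≤ ‖t • ζ - ξ₀‖ := by
      by_contra! hlt'
      have h2 := h.smul_mem t⁻¹ (by positivity) _ (hball (mem_ball_iff_norm.2 hlt'))
      rw [inv_smul_smul₀ ht.ne'] at h2
      exact hζ h2
    have h2 : r ≤ t * ‖ξ - ζ‖ := by
      have h3 : ‖t • ζ - ξ₀‖ ≤ ‖t • ξ - ξ₀‖ + ‖t • (ξ - ζ)‖ := by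
        have e : t • ζ - ξ₀ = (t • ξ - ξ₀) - t • (ξ - ζ) := by
          rw [smul_sub]
          abel
        rw [e]
        exact norm_sub_le _ _
      rw [norm_smul, Real.norm_of_nonneg ht.le] at h3
      have := min_le_left (ε / 2) ‖ξ₀‖
      linarith
    have h4 : t * ‖ξ‖ ≤ ‖ξ₀‖ + r := by
      have e : t * ‖ξ‖ = ‖ξ₀ + (t • ξ - ξ₀)‖ := by
        rw [add_sub_cancel, norm_smul, Real.norm_of_nonneg ht.le]
      rw [e]
      exact (norm_add_le _ _).trans (by linarith)
    rw [div_mul_eq_mul_div, div_le_iff₀ (by positivity)]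
    refine le_of_mul_le_mul_left ?_ ht
    calc t * (r * ‖ξ‖) = r * (t * ‖ξ‖) := by ring
      _ ≤ r * (‖ξ₀‖ + r) := by gcongr
      _ ≤ t * ‖ξ - ζ‖ * (‖ξ₀‖ + r) := by gcongr
      _ = _ := by ring

end Cones
end FourierBanach

namespace FourierBanach

/-! ### Finiteness of the seminorms -/

section FiniteSeminorm

variable {d : ℕ} {B : Type*} [NormedAddCommGroup B] [NormedSpace ℂ B]
  {ι : B →ₗ[ℂ] (E d →ₘ[volume] ℂ)}

theorem seminormFB_lt_top_iff {ω : E d × E d → ℝ} {Γ : Set (E d)} {x : E d} {f : 𝓢'(E d, ℂ)} :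
    seminormFB ι ω Γ x f < ⊤ ↔ ∃ (b : B) (g : E d → ℂ), IsGivenBy (fourierT f) g ∧
      ι b =ᵐ[volume] Γ.indicator (fun ξ => g ξ * (ω (x, ξ) : ℂ)) := by
  simp only [seminormFB, iInf_lt_iff]
  exact ⟨fun ⟨b, h, _⟩ => ⟨b, h⟩, fun ⟨b, h⟩ => ⟨b, h, enorm_lt_top⟩⟩

theorem IsGivenBy.add {u u' : 𝓢'(E d, ℂ)} {g g' : E d → ℂ} (h : IsGivenBy u g)
    (h' : IsGivenBy u' g') : IsGivenBy (u + u') (g + g') := by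
  refine ⟨h.1.add h'.1, fun φ hφ => ?_⟩
  have h1 : Integrable fun y => g y * φ y := by
    simpa only [smul_eq_mul, mul_comm] using
      h.1.integrable_smul_left_of_hasCompactSupport φ.continuous hφ
  have h2 : Integrable fun y => g' y * φ y := by
    simpa only [smul_eq_mul, mul_comm] using
      h'.1.integrable_smul_left_of_hasCompactSupport φ.continuous hφ
  have e : (u + u') φ = u φ + u' φ := rfl
  rw [e, h.2 φ hφ, h'.2 φ hφ, ← integral_add h1 h2]
  simp_rw [Pi.add_apply, add_mul]

theorem seminormFB_add_lt_top {ω : E d × E d → ℝ} {Γ : Set (E d)} {x : E d} {f f' : 𝓢'(E d, ℂ)}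
    (h : seminormFB ι ω Γ x f < ⊤) (h' : seminormFB ι ω Γ x f' < ⊤) :
    seminormFB ι ω Γ x (f + f') < ⊤ := by
  rw [seminormFB_lt_top_iff] at *
  obtain ⟨b, g, hg, hb⟩ := h
  obtain ⟨b', g', hg', hb'⟩ := h'
  refine ⟨b + b', g + g', ?_, ?_⟩
  · have : fourierT (f + f') = fourierT f + fourierT f' := rfl
    rw [this]
    exact hg.add hg'
  · rw [map_add]
    filter_upwards [AEEqFun.coeFn_add (ι b) (ι b'), hb, hb'] with ξ h1 h2 h3
    rw [h1, Pi.add_apply, h2, h3]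
    by_cases hξ : ξ ∈ Γ
    · simp [hξ, add_mul]
    · simp [hξ]

end FiniteSeminorm

/-! ### The microlocal estimate on cones -/

section Mapping

variable {d : ℕ} {B : Type*} [NormedAddCommGroup B] [NormedSpace ℂ B] [CompleteSpace B]
  {ι : B →ₗ[ℂ] (E d →ₘ[volume] ℂ)} {v : E d → ℝ}

theorem IsInvariantBFSpace.seminormFB_lt_top (hB : IsInvariantBFSpace ι v) {ω : E d × E d → ℝ}
    (hω : Measurable ω) {Γ : Set (E d)} (hΓ : IsOpen Γ) {x : E d} {f : 𝓢'(E d, ℂ)} {G : E d → ℂ}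
    (hG : IsGivenBy (fourierT f) G)
    (hdom : IsDominated ι (Γ.indicator fun ξ => ‖G ξ‖ * |ω (x, ξ)|)) :
    seminormFB ι ω Γ x f < ⊤ := by
  have hωx : Measurable fun ξ => (ω (x, ξ) : ℂ) :=
    Complex.measurable_ofReal.comp (hω.comp measurable_prodMk_left)
  have hdom' : IsDominated ι fun ξ => ‖Γ.indicator (fun ξ => G ξ * (ω (x, ξ) : ℂ)) ξ‖ := by
    refine hdom.mono (Filter.Eventually.of_forall fun ξ => ?_)
    by_cases hξ : ξ ∈ Γ <;> simp [hξ]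
  obtain ⟨b, hb⟩ := hdom'.exists_eq hB
    ((hG.1.aestronglyMeasurable.mul hωx.aestronglyMeasurable).indicator hΓ.measurableSet)
  rw [seminormFB_lt_top_iff]
  exact ⟨b, G, hG, hb⟩

/-- The discrete convolution bound is split according to whether ξ - s lies in Γ₁. The first part is
a lattice sum of translates of the given element of ℬ, the second a negative power of 1 + |ξ|; both
are dominated in ℬ. -/
theorem FreqLocal.seminormFB_lt_top {A : 𝓢'(E d, ℂ) →L[ℂ] 𝓢'(E d, ℂ)} {w : E d → ℝ}
    (hA : FreqLocal A w) (hw : IsPolyModerate w) (hB : IsInvariantBFSpace ι v)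
    {R : ℝ} (hR : 0 < R)
    {f : 𝓢'(E d, ℂ)} (hf : ∀ φ, f (SchwartzMap.smulLeftCLM ℂ (cutoff R : E d → ℂ) φ) = f φ)
    {ω ω₁ : E d × E d → ℝ} (hω₁ : Measurable ω₁) {x y : E d}
    (hω : IsPolyModerate fun ξ => ω (x, ξ)) {C₀ : ℝ} (hC₀0 : 0 ≤ C₀)
    (hC₀ : ∀ ξ, w ξ * |ω₁ (y, ξ)| ≤ C₀ * ω (x, ξ)) {Γ₁ Γ₂ : Set (E d)} (hΓ₂ : IsOpen Γ₂)
    (hΓ : IsConeSeparated Γ₁ Γ₂) (h : seminormFB ι ω Γ₁ x f < ⊤) :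
    FourierBanach.seminormFB ι ω₁ Γ₂ y (A f) < ⊤ := by
  obtain ⟨b, g, hg, hb⟩ := seminormFB_lt_top_iff.1 h
  obtain ⟨k, C₁, hC₁0, hC₁⟩ := exists_norm_cutFourier_le hR f
  obtain ⟨G, -, hG, hGle⟩ := hA.exists_isGivenBy_le hw hR hf hC₁0 hC₁
  refine hB.seminormFB_lt_top hω₁ hΓ₂ hG ?_
  obtain ⟨C₂, M, hC₂0, hC₂⟩ := hω.moderate
  obtain ⟨c, hc0, hc1, hc⟩ := hΓ
  obtain ⟨N₁, hN₁⟩ := hB.isDominated_tsum hR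
  obtain ⟨N₂, hN₂⟩ := hB.isDominated_inv_pow
  obtain ⟨hsb, hdb⟩ := hN₁ b
  set κ : ℝ := (2 * Real.pi) ^ (-(d : ℝ) / 2) with hκ
  have hκ0 : 0 < κ := by positivity
  -- With P = M + k + N₂, the case inside Γ₁ needs decay N₁ + M and the case outside needs k + P +
  -- 2d. The exponent covers both.
  obtain ⟨C, hC0, hC⟩ := hGle (N₁ + M + k + (M + k + N₂) + 2 * d) (by omega)
  have hbF : ∀ᵐ ξ, ‖ι b ξ‖ = Γ₁.indicator (fun ξ => κ * ‖cutFourier hR f ξ‖ * ω (x, ξ)) ξ := by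
    filter_upwards [hb, hg.ae_eq (isGivenBy_fourierT_cutFourier hR hf)] with ξ h1 h2
    have h0 := hω.nonneg ξ
    rw [h1]
    by_cases hξ : ξ ∈ Γ₁
    · rw [Set.indicator_of_mem hξ, Set.indicator_of_mem hξ, h2, norm_mul, norm_mul,
        Complex.norm_real, Complex.norm_real, Real.norm_of_nonneg hκ0.le, Real.norm_of_nonneg h0]
    · rw [Set.indicator_of_notMem hξ, Set.indicator_of_notMem hξ, norm_zero]
  have hbF' : ∀ᵐ ξ, ∀ m, ‖ι b (ξ - samplePt R m)‖ = Γ₁.indicator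
      (fun ξ => κ * ‖cutFourier hR f ξ‖ * ω (x, ξ)) (ξ - samplePt R m) := by
    rw [ae_all_iff]
    exact fun m => (measurePreserving_sub_right (volume : Measure (E d))
        (samplePt R m)).quasiMeasurePreserving.ae hbF
  set P := M + k + N₂ with hP
  set N := N₁ + M + k + P + 2 * d with hN
  clear_value P N
  set K := C₂ * ω (x, 0) * C₁ * (c⁻¹) ^ P with hK
  have hω0 := hω.nonneg 0
  have hK0 : 0 ≤ K := by positivity
  have hs2 := summable_samplePt (d := d) hR le_rfl
  set S := ∑' m : Fin d → ℤ, ((1 + ‖samplePt R m‖) ^ (2 * d))⁻¹ with hS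
  have hS0 : 0 ≤ S := tsum_nonneg fun m => by positivity
  have hpt : ∀ ξ ∈ Γ₂, (∀ m, ‖ι b (ξ - samplePt R m)‖ = Γ₁.indicator
      (fun ξ => κ * ‖cutFourier hR f ξ‖ * ω (x, ξ)) (ξ - samplePt R m)) → ∀ m,
      ω (x, ξ) * (((1 + ‖samplePt R m‖) ^ N)⁻¹ * ‖cutFourier hR f (ξ - samplePt R m)‖) ≤
      C₂ * κ⁻¹ * (((1 + ‖samplePt R m‖) ^ N₁)⁻¹ * ‖ι b (ξ - samplePt R m)‖) +
      K * ((1 + ‖ξ‖) ^ N₂)⁻¹ * ((1 + ‖samplePt R m‖) ^ (2 * d))⁻¹ := fun ξ hξ hbm m => by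
    set s := samplePt R m
    have h1s : 1 ≤ 1 + ‖s‖ := by simp
    rw [hbm m]
    rw [← mul_assoc, mul_comm (ω (x, ξ)), mul_assoc, inv_mul_le_iff₀ (by positivity)]
    -- Inside Γ₁ the sample times ω(x, ξ - s) is the given element of ℬ up to κ. Moving the weight
    -- to ξ costs M powers of 1 + |s|.
    by_cases hζ : ξ - s ∈ Γ₁
    · rw [Set.indicator_of_mem hζ]
      have h0 := hω.nonneg (ξ - s)
      have h1 : ω (x, ξ) ≤ C₂ * ω (x, ξ - s) * (1 + ‖s‖) ^ M := by
        simpa using hC₂ (ξ - s) s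
      have h2 : (1 + ‖s‖) ^ (M + N₁) ≤ (1 + ‖s‖) ^ N := pow_le_pow_right₀ h1s (by omega)
      calc ω (x, ξ) * ‖cutFourier hR f (ξ - s)‖
          ≤ C₂ * ω (x, ξ - s) * (1 + ‖s‖) ^ M * ‖cutFourier hR f (ξ - s)‖ := by gcongr
        _ = (1 + ‖s‖) ^ (M + N₁) * (C₂ * κ⁻¹ * (((1 + ‖s‖) ^ N₁)⁻¹ *
            (κ * ‖cutFourier hR f (ξ - s)‖ * ω (x, ξ - s)))) := by
            rw [pow_add]
            field_simp
        _ ≤ (1 + ‖s‖) ^ N * (C₂ * κ⁻¹ * (((1 + ‖s‖) ^ N₁)⁻¹ *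
            (κ * ‖cutFourier hR f (ξ - s)‖ * ω (x, ξ - s)))) := by gcongr
        _ ≤ _ := by
            gcongr
            exact le_add_of_nonneg_right (by positivity)
    -- Outside Γ₁ only polynomial growth is known. Separation gives 1 + |ξ| ≤ c⁻¹(1 + |s|), so P
    -- powers of 1 + |ξ| are converted into powers of 1 + |s|, and the factor (1 + |ξ|)^{-N₂} is
    -- left over.
    · rw [Set.indicator_of_notMem hζ, mul_zero, mul_zero, zero_add]
      have h1 : ω (x, ξ) ≤ C₂ * ω (x, 0) * (1 + ‖ξ‖) ^ M := by
        simpa using hC₂ 0 ξ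
      have h2 : ‖cutFourier hR f (ξ - s)‖ ≤ C₁ * ((1 + ‖ξ‖) * (1 + ‖s‖)) ^ k :=
        (hC₁ _).trans (by gcongr; exact one_add_norm_sub_le _ _)
      have h3 : 1 + ‖ξ‖ ≤ c⁻¹ * (1 + ‖s‖) := by
        have := hc ξ hξ (ξ - s) hζ
        rw [sub_sub_cancel] at this
        rw [le_inv_mul_iff₀ hc0]
        linarith
      have h4 : (1 + ‖s‖) ^ (k + P + 2 * d) ≤ (1 + ‖s‖) ^ N := pow_le_pow_right₀ h1s (by omega)
      calc ω (x, ξ) * ‖cutFourier hR f (ξ - s)‖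
          ≤ C₂ * ω (x, 0) * (1 + ‖ξ‖) ^ M * (C₁ * ((1 + ‖ξ‖) * (1 + ‖s‖)) ^ k) := by gcongr
        _ = C₂ * ω (x, 0) * C₁ * (1 + ‖s‖) ^ k * ((1 + ‖ξ‖) ^ N₂)⁻¹ * (1 + ‖ξ‖) ^ P := by
            rw [hP, mul_pow, pow_add, pow_add]
            field_simp
        _ ≤ C₂ * ω (x, 0) * C₁ * (1 + ‖s‖) ^ k * ((1 + ‖ξ‖) ^ N₂)⁻¹ *
            (c⁻¹ * (1 + ‖s‖)) ^ P := by gcongr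
        _ = (1 + ‖s‖) ^ (k + P + 2 * d) *
            (K * ((1 + ‖ξ‖) ^ N₂)⁻¹ * ((1 + ‖s‖) ^ (2 * d))⁻¹) := by
            have e : (1 + ‖s‖) ^ (k + P + 2 * d) =
                (1 + ‖s‖) ^ k * (1 + ‖s‖) ^ P * (1 + ‖s‖) ^ (2 * d) := by rw [pow_add, pow_add]
            rw [hK, e, mul_pow]
            field_simp
        _ ≤ _ := by gcongr
  refine ((hdb.const_mul (c := C * C₀ * (C₂ * κ⁻¹)) (by positivity)).add hB
    (hN₂.const_mul (c := C * C₀ * (K * S)) (by positivity))).mono ?_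
  filter_upwards [hbF', hsb] with ξ h1 h2
  by_cases hξ : ξ ∈ Γ₂
  · rw [Set.indicator_of_mem hξ]
    obtain ⟨hsum, hle⟩ := hC ξ
    have hw0 := hw.nonneg ξ
    set T := ∑' m, ((1 + ‖samplePt R m‖) ^ N)⁻¹ * ‖cutFourier hR f (ξ - samplePt R m)‖ with hT
    have hT0 : 0 ≤ T := tsum_nonneg fun m => by positivity
    have h3 : ω (x, ξ) * T ≤ C₂ * κ⁻¹ *
        (∑' m, ((1 + ‖samplePt R m‖) ^ N₁)⁻¹ * ‖ι b (ξ - samplePt R m)‖) +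
        K * ((1 + ‖ξ‖) ^ N₂)⁻¹ * S := by
      rw [hT, hS, ← tsum_mul_left, ← tsum_mul_left, ← tsum_mul_left,
        ← (h2.mul_left _).tsum_add (hs2.mul_left _)]
      exact (hsum.mul_left _).tsum_le_tsum (hpt ξ hξ h1)
        ((h2.mul_left _).add (hs2.mul_left _))
    calc ‖G ξ‖ * |ω₁ (y, ξ)| ≤ C * w ξ * T * |ω₁ (y, ξ)| := by gcongr
      _ = C * T * (w ξ * |ω₁ (y, ξ)|) := by ring
      _ ≤ C * T * (C₀ * ω (x, ξ)) := mul_le_mul_of_nonneg_left (hC₀ ξ) (by positivity)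
      _ = C * C₀ * (ω (x, ξ) * T) := by ring
      _ ≤ C * C₀ * _ := mul_le_mul_of_nonneg_left h3 (by positivity)
      _ = _ := by ring
  · rw [Set.indicator_of_notMem hξ]
    have : 0 ≤ ∑' m, ((1 + ‖samplePt R m‖) ^ N₁)⁻¹ * ‖ι b (ξ - samplePt R m)‖ :=
      tsum_nonneg fun m => by positivity
    positivity

end Mapping
end FourierBanach

namespace FourierBanach

/-! ### Operators that almost commute with modulations -/

section SchwartzLocal

variable {d : ℕ}

/-- `A` commutes with modulations up to errors that are controlled by `w` in `𝓢`. -/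
def SchwartzLocal (A : 𝓢'(E d, ℂ) →L[ℂ] 𝓢'(E d, ℂ)) (w : E d → ℝ) : Prop :=
  ∀ χ : 𝓢(E d, ℂ), HasCompactSupport χ → ∃ θ : E d → 𝓢(E d, ℂ),
    (∀ η, A (toTD d (modulation η χ)) = toTD d (modulation η (θ η))) ∧
    ∀ m : ℕ × ℕ, ∃ C : ℝ, 0 ≤ C ∧ ∀ η, schwartzSup (E d) ℂ m (θ η) ≤ C * w η

/-- Modulation translates the Fourier transform to η, where the Schwartz bounds on θ η become decay
in ξ - η. The stronger property is the one that visibly survives multiplication by smooth functions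
on either side, since those commute with modulations. -/
theorem SchwartzLocal.freqLocal {A : 𝓢'(E d, ℂ) →L[ℂ] 𝓢'(E d, ℂ)} {w : E d → ℝ}
    (hA : SchwartzLocal A w) : FreqLocal A w := fun χ hχ => by
  obtain ⟨θ, hθ, hb⟩ := hA χ hχ
  refine ⟨fun η => modulation η (θ η), hθ, fun N => ?_⟩
  obtain ⟨m, C, hC0, hC⟩ := exists_schwartzSup_map_le (fourierS d) (N, 0)
  obtain ⟨C', hC'0, hC'⟩ := hb m
  refine ⟨2 ^ N * (C * C'), by positivity, fun η ξ => ?_⟩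
  rw [fourierS_modulation]
  refine (one_add_pow_mul_norm_le_schwartzSup N (fourierS d (θ η)) (ξ - η)).trans ?_
  rw [mul_assoc, mul_assoc]
  gcongr
  exact (hC _).trans (by gcongr; exact hC' η)

theorem smulLeftCLM_toTD {g : E d → ℂ} (hg : g.HasTemperateGrowth) (φ : 𝓢(E d, ℂ)) :
    TemperedDistribution.smulLeftCLM ℂ g (toTD d φ) =
      toTD d (SchwartzMap.smulLeftCLM ℂ g φ) := by
  ext ψ
  rw [TemperedDistribution.smulLeftCLM_apply_apply, toTD_apply, toTD_apply]
  refine integral_congr_ae (Filter.Eventually.of_forall fun x => ?_)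
  simp only
  rw [SchwartzMap.smulLeftCLM_apply_apply hg, SchwartzMap.smulLeftCLM_apply_apply hg, smul_eq_mul,
    smul_eq_mul]
  ring

theorem smulLeftCLM_modulation {g : E d → ℂ} (hg : g.HasTemperateGrowth) (η : E d)
    (φ : 𝓢(E d, ℂ)) : SchwartzMap.smulLeftCLM ℂ g (modulation η φ) =
      modulation η (SchwartzMap.smulLeftCLM ℂ g φ) := by
  ext x
  rw [SchwartzMap.smulLeftCLM_apply_apply hg, modulation_apply, modulation_apply,
    SchwartzMap.smulLeftCLM_apply_apply hg, smul_eq_mul, smul_eq_mul]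
  ring

theorem hasCompactSupport_smulLeftCLM {g : E d → ℂ} (hg : g.HasTemperateGrowth) {φ : 𝓢(E d, ℂ)}
    (hφ : HasCompactSupport φ) : HasCompactSupport (SchwartzMap.smulLeftCLM ℂ g φ) := by
  have e : (SchwartzMap.smulLeftCLM ℂ g φ : E d → ℂ) = g * φ := funext fun x => by
    rw [SchwartzMap.smulLeftCLM_apply_apply hg, smul_eq_mul, Pi.mul_apply]
  rw [e]
  exact hφ.mul_left

theorem SchwartzLocal.comp_smulLeftCLM {A : 𝓢'(E d, ℂ) →L[ℂ] 𝓢'(E d, ℂ)} {w : E d → ℝ}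
    (hA : SchwartzLocal A w) {g : E d → ℂ} (hg : g.HasTemperateGrowth) :
    SchwartzLocal (A.comp (TemperedDistribution.smulLeftCLM ℂ g)) w := fun χ hχ => by
  obtain ⟨θ, hθ, hb⟩ := hA _ (hasCompactSupport_smulLeftCLM hg hχ)
  refine ⟨θ, fun η => ?_, hb⟩
  rw [ContinuousLinearMap.comp_apply, smulLeftCLM_toTD hg, smulLeftCLM_modulation hg, hθ]

theorem SchwartzLocal.smulLeftCLM_comp {A : 𝓢'(E d, ℂ) →L[ℂ] 𝓢'(E d, ℂ)} {w : E d → ℝ}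
    (hA : SchwartzLocal A w) {g : E d → ℂ} (hg : g.HasTemperateGrowth) :
    SchwartzLocal ((TemperedDistribution.smulLeftCLM ℂ g).comp A) w := fun χ hχ => by
  obtain ⟨θ, hθ, hb⟩ := hA χ hχ
  refine ⟨fun η => SchwartzMap.smulLeftCLM ℂ g (θ η), fun η => ?_, fun m => ?_⟩
  · rw [ContinuousLinearMap.comp_apply, hθ, smulLeftCLM_toTD hg, smulLeftCLM_modulation hg]
  · obtain ⟨m', C, hC0, hC⟩ := exists_schwartzSup_map_le
      (SchwartzMap.smulLeftCLM ℂ g : 𝓢(E d, ℂ) →L[ℂ] 𝓢(E d, ℂ)) m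
    obtain ⟨C', hC'0, hC'⟩ := hb m'
    refine ⟨C * C', by positivity, fun η => (hC _).trans ?_⟩
    rw [mul_assoc]
    gcongr
    exact hC' η

theorem ExtendsOp.apply_modulation {a : E d × E d → ℂ} {A : 𝓢'(E d, ℂ) →L[ℂ] 𝓢'(E d, ℂ)}
    (hA : ExtendsOp a A) {M : ℕ} (hb : ∀ η, IsAmplitude M (shiftSymbol a η)) (η : E d)
    (χ : 𝓢(E d, ℂ)) : A (toTD d (modulation η χ)) =
      toTD d (modulation η (oscSchwartz (hb η) (𝓕 χ))) := by
  obtain ⟨ψ, hψ, h⟩ := hA (modulation η χ)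
  rw [h]
  congr 1
  ext x
  rw [hψ, modulation_apply, opSchwartz_eq_oscInt a η χ _ (modulation_apply η χ)]
  rfl

/-- Conjugating by a modulation translates the symbol by η. The translated symbols are amplitudes of
a common order M, with bounds proportional to ω₀(0, η), and the oscillatory estimates are linear in
these bounds. -/
theorem IsSymbol.schwartzLocal {ρ : ℝ} (hρ : 0 < ρ) {ω₀ : E d × E d → ℝ}
    (hω₀ : IsWeight ω₀) {a : E d × E d → ℂ} (ha : IsSymbol ρ 0 ω₀ a)
    {A : 𝓢'(E d, ℂ) →L[ℂ] 𝓢'(E d, ℂ)} (hA : ExtendsOp a A) :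
    SchwartzLocal A fun η => ω₀ (0, η) := fun χ _ => by
  obtain ⟨M, hM, hb⟩ := ha.isAmplitude hρ hω₀
  refine ⟨fun η => oscSchwartz (hb η) (𝓕 χ), fun η => hA.apply_modulation hb η χ, fun m => ?_⟩
  obtain ⟨r, m', K, hK0, hK⟩ := schwartzSup_oscSchwartz_le (d := d) ℂ M m
  obtain ⟨C, hC0, hC⟩ := hM r
  refine ⟨K * C * schwartzSup (E d) ℂ m' (𝓕 χ), by positivity, fun η => ?_⟩
  refine (hK _ (hb η) _ (hC η) _).trans (le_of_eq ?_)
  ring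

end SchwartzLocal

/-! ### Comparison of weights frozen at different points -/

section WeightSlices

variable {d : ℕ}

theorem IsWeight.isPolyModerate {ω : E d × E d → ℝ} (hω : IsWeight ω) (x : E d) :
    IsPolyModerate fun ξ => ω (x, ξ) := by
  obtain ⟨C, N, hC0, hC⟩ := hω.exists_moderate
  refine ⟨fun ξ => (hω.pos _).le, C, N, hC0, fun ξ η => ?_⟩
  have h := hC (x, ξ) (0, η)
  simpa [Prod.norm_mk] using h

theorem IsWeight.exists_slice_le {ω : E d × E d → ℝ} (hω : IsWeight ω) (x y : E d) :
    ∃ C : ℝ, 0 ≤ C ∧ ∀ ξ, ω (y, ξ) ≤ C * ω (x, ξ) := by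
  obtain ⟨C, N, hC0, hC⟩ := hω.exists_moderate
  refine ⟨C * (1 + ‖y - x‖) ^ N, by positivity, fun ξ => ?_⟩
  have h := hC (x, ξ) (y - x, 0)
  simp only [Prod.mk_add_mk, add_sub_cancel, add_zero, Prod.norm_mk, norm_zero,
    norm_nonneg, sup_of_le_left] at h
  exact h.trans (le_of_eq (by ring))

theorem IsWeight.exists_mul_div_le {ω ω₀ : E d × E d → ℝ} (hω : IsWeight ω) (hω₀ : IsWeight ω₀)
    (x y : E d) : ∃ C : ℝ, 0 ≤ C ∧ ∀ ξ, ω₀ (0, ξ) * |ω (y, ξ) / ω₀ (y, ξ)| ≤ C * ω (x, ξ) := by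
  obtain ⟨C, hC0, hC⟩ := hω.exists_slice_le x y
  obtain ⟨C', hC'0, hC'⟩ := hω₀.exists_slice_le y 0
  refine ⟨C' * C, by positivity, fun ξ => ?_⟩
  have h1 := hω.pos (y, ξ)
  have h2 := hω₀.pos (y, ξ)
  rw [abs_of_pos (by positivity)]
  calc ω₀ (0, ξ) * (ω (y, ξ) / ω₀ (y, ξ))
      ≤ C' * ω₀ (y, ξ) * (ω (y, ξ) / ω₀ (y, ξ)) := by gcongr; exact hC' ξ
    _ = C' * ω (y, ξ) := by field_simp
    _ ≤ C' * (C * ω (x, ξ)) := by gcongr; exact hC ξ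
    _ = _ := by ring

end WeightSlices

/-! ### Smoothing operators -/

section RapidDecay

variable {d : ℕ} {B : Type*} [NormedAddCommGroup B] [NormedSpace ℂ B] [CompleteSpace B]
  {ι : B →ₗ[ℂ] (E d →ₘ[volume] ℂ)} {v : E d → ℝ}

theorem isPolyModerate_inv_pow (N : ℕ) : IsPolyModerate fun ξ : E d => ((1 + ‖ξ‖) ^ N)⁻¹ := by
  refine ⟨fun ξ => by positivity, 1, N, zero_le_one, fun ξ η => ?_⟩
  have h : 1 + ‖ξ‖ ≤ (1 + ‖ξ + η‖) * (1 + ‖η‖) := by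
    simpa using one_add_norm_sub_le (ξ + η) η
  rw [one_mul, inv_mul_eq_div, inv_eq_one_div, div_le_div_iff₀ (by positivity) (by positivity),
    one_mul, mul_comm, ← mul_pow]
  gcongr

/-- An amplification factor decaying faster than any power makes the Fourier transform of A f decay
likewise, so membership in ℬ holds on every open set, without information on f in a cone. -/
theorem seminormFB_lt_top_of_forall_freqLocal (hB : IsInvariantBFSpace ι v)
    {A : 𝓢'(E d, ℂ) →L[ℂ] 𝓢'(E d, ℂ)} (hA : ∀ N : ℕ, FreqLocal A fun η => ((1 + ‖η‖) ^ N)⁻¹)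
    {R : ℝ} (hR : 0 < R)
    {f : 𝓢'(E d, ℂ)} (hf : ∀ φ, f (SchwartzMap.smulLeftCLM ℂ (cutoff R : E d → ℂ) φ) = f φ)
    {ω₁ : E d × E d → ℝ} (hω₁ : Measurable ω₁) {y : E d} {C₀ : ℝ} {M : ℕ} (hC₀0 : 0 ≤ C₀)
    (hC₀ : ∀ ξ, |ω₁ (y, ξ)| ≤ C₀ * (1 + ‖ξ‖) ^ M) {Γ : Set (E d)} (hΓ : IsOpen Γ) :
    seminormFB ι ω₁ Γ y (A f) < ⊤ := by
  obtain ⟨k, C₁, hC₁0, hC₁⟩ := exists_norm_cutFourier_le hR f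
  obtain ⟨N₂, hN₂⟩ := hB.isDominated_inv_pow
  -- Here k cancels the growth of the samples and M that of the weight; N₂ is the decay that ℬ
  -- dominates.
  obtain ⟨G, -, hG, hGle⟩ := (hA (k + N₂ + M)).exists_isGivenBy_le
    (isPolyModerate_inv_pow (k + N₂ + M)) hR hf hC₁0 hC₁
  refine hB.seminormFB_lt_top hω₁ hΓ hG ?_
  obtain ⟨C, hC0, hC⟩ := hGle (k + 2 * d) le_rfl
  have hs2 := summable_samplePt (d := d) hR le_rfl
  set S := ∑' m : Fin d → ℤ, ((1 + ‖samplePt R m‖) ^ (2 * d))⁻¹ with hS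
  have hS0 : 0 ≤ S := tsum_nonneg fun m => by positivity
  refine (hN₂.const_mul (c := C * (C₁ * S) * C₀) (by positivity)).mono
    (Filter.Eventually.of_forall fun ξ => ?_)
  by_cases hξ : ξ ∈ Γ
  · rw [Set.indicator_of_mem hξ]
    obtain ⟨hsum, hle⟩ := hC ξ
    have h1 : ∑' m, ((1 + ‖samplePt R m‖) ^ (k + 2 * d))⁻¹ *
        ‖cutFourier hR f (ξ - samplePt R m)‖ ≤ C₁ * (1 + ‖ξ‖) ^ k * S := by
      rw [hS, ← tsum_mul_left]
      refine hsum.tsum_le_tsum (fun m => ?_) (hs2.mul_left _)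
      set s := samplePt R m
      have h2 : ‖cutFourier hR f (ξ - s)‖ ≤ C₁ * ((1 + ‖ξ‖) * (1 + ‖s‖)) ^ k :=
        (hC₁ _).trans (by gcongr; exact one_add_norm_sub_le _ _)
      calc ((1 + ‖s‖) ^ (k + 2 * d))⁻¹ * ‖cutFourier hR f (ξ - s)‖
          ≤ ((1 + ‖s‖) ^ (k + 2 * d))⁻¹ * (C₁ * ((1 + ‖ξ‖) * (1 + ‖s‖)) ^ k) := by gcongr
        _ = _ := by
            rw [pow_add, mul_pow]
            field_simp
    calc ‖G ξ‖ * |ω₁ (y, ξ)| ≤ (C * ((1 + ‖ξ‖) ^ (k + N₂ + M))⁻¹ * (C₁ * (1 + ‖ξ‖) ^ k * S)) *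
          (C₀ * (1 + ‖ξ‖) ^ M) := by
          refine mul_le_mul (hle.trans ?_) (hC₀ ξ) (abs_nonneg _) (by positivity)
          gcongr
      _ = _ := by
          rw [pow_add, pow_add]
          field_simp
  · rw [Set.indicator_of_notMem hξ]
    positivity

theorem IsWeight.exists_div_le {ω ω₀ : E d × E d → ℝ} (hω : IsWeight ω) (hω₀ : IsWeight ω₀)
    (y : E d) : ∃ C : ℝ, ∃ M : ℕ, 0 ≤ C ∧ ∀ ξ, |ω (y, ξ) / ω₀ (y, ξ)| ≤ C * (1 + ‖ξ‖) ^ M := by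
  obtain ⟨C, M, hC0, hC⟩ := (hω.isPolyModerate y).moderate
  obtain ⟨C', M', hC'0, hC'⟩ := (hω₀.isPolyModerate y).moderate
  have h1 := hω.pos (y, 0)
  have h2 := hω₀.pos (y, 0)
  refine ⟨C * ω (y, 0) * (C' * (ω₀ (y, 0))⁻¹), M + M', by positivity, fun ξ => ?_⟩
  have h3 := hω.pos (y, ξ)
  have h4 := hω₀.pos (y, ξ)
  have h5 : ω (y, ξ) ≤ C * ω (y, 0) * (1 + ‖ξ‖) ^ M := by simpa using hC 0 ξ
  have h6 : ω₀ (y, 0) ≤ C' * ω₀ (y, ξ) * (1 + ‖ξ‖) ^ M' := by simpa using hC' ξ (-ξ)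
  rw [abs_of_pos (by positivity), div_le_iff₀ h4]
  calc ω (y, ξ) ≤ C * ω (y, 0) * (1 + ‖ξ‖) ^ M * ((ω₀ (y, 0))⁻¹ * ω₀ (y, 0)) := by
        rwa [inv_mul_cancel₀ h2.ne', mul_one]
    _ ≤ C * ω (y, 0) * (1 + ‖ξ‖) ^ M * ((ω₀ (y, 0))⁻¹ *
        (C' * ω₀ (y, ξ) * (1 + ‖ξ‖) ^ M')) := by gcongr
    _ = _ := by
        rw [pow_add]
        ring

end RapidDecay
end FourierBanach

namespace FourierBanach

/-! ### Integration by parts in frequency -/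

section NonstationaryPhase

variable {d : ℕ}

theorem hasTemperateGrowth_fderiv_apply {p : E d → ℂ} (hp : p.HasTemperateGrowth) (v : E d) :
    (fun ζ => fderiv ℝ p ζ v).HasTemperateGrowth ∧ ∀ n ζ,
      ‖iteratedFDeriv ℝ n (fun ζ => fderiv ℝ p ζ v) ζ‖ ≤ ‖v‖ * ‖iteratedFDeriv ℝ (n + 1) p ζ‖ := by
  have h1 : ContDiff ℝ (⊤ : ℕ∞) (fderiv ℝ p) := contDiff_fderiv_of_contDiff_top hp.1
  have h2 : ∀ n ζ, ‖iteratedFDeriv ℝ n (fun ζ => fderiv ℝ p ζ v) ζ‖ ≤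
      ‖v‖ * ‖iteratedFDeriv ℝ (n + 1) p ζ‖ := fun n ζ => by
    rw [← norm_iteratedFDeriv_fderiv]
    exact norm_iteratedFDeriv_clm_apply_const h1.contDiffAt (by exact_mod_cast le_top)
  refine ⟨⟨h1.clm_apply contDiff_const, fun n => ?_⟩, h2⟩
  obtain ⟨k, C, hC⟩ := hp.2 (n + 1)
  refine ⟨k, ‖v‖ * C, fun ζ => (h2 n ζ).trans ?_⟩
  rw [mul_assoc]
  gcongr
  exact hC ζ

theorem integrable_schwartz_mul (g : 𝓢(E d, ℂ)) {p : E d → ℂ} (hp : p.HasTemperateGrowth) :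
    Integrable fun ζ => g ζ * p ζ := by
  refine (SchwartzMap.smulLeftCLM ℂ p g).integrable.congr (Filter.Eventually.of_forall fun ζ => ?_)
  rw [SchwartzMap.smulLeftCLM_apply_apply hp, smul_eq_mul, mul_comm]

/-- Up to the factor -2πi, multiplication by ⟨y, v⟩ is ∂_v on the Fourier side; integration by parts
moves that derivative to p. The gain 1/(2π) is discarded. -/
theorem norm_integral_fourier_inner_mul_le (g : 𝓢(E d, ℂ)) {p : E d → ℂ}
    (hp : p.HasTemperateGrowth) (v : E d) :
    ‖∫ ζ, 𝓕 (SchwartzMap.smulLeftCLM ℂ (fun y : E d => (inner ℝ y v : ℝ)) g) ζ * p ζ‖ ≤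
      ‖∫ ζ, 𝓕 g ζ * fderiv ℝ p ζ v‖ := by
  set F : 𝓢(E d, ℂ) := 𝓕 g with hF
  set H : 𝓢(E d, ℂ) := 𝓕 (SchwartzMap.smulLeftCLM ℂ (fun y : E d => (inner ℝ y v : ℝ)) g) with hH
  have h1 : ∀ ζ, fderiv ℝ F ζ v = -(2 * Real.pi * Complex.I) * H ζ := fun ζ => by
    have := DFunLike.congr_fun (SchwartzMap.lineDerivOp_fourier_eq g v) ζ
    rw [FourierTransform.fourier_smul] at this
    rw [← smul_eq_mul, ← smul_apply, ← this]
    rfl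
  have h2 := integral_mul_fderiv_eq_neg_fderiv_mul_of_integrable (μ := (volume : Measure (E d)))
    (f := F) (g := p) (v := v) (by
      simp_rw [h1, mul_assoc]
      exact (integrable_schwartz_mul H hp).const_mul _)
    (integrable_schwartz_mul F (hasTemperateGrowth_fderiv_apply hp v).1)
    (integrable_schwartz_mul F hp)
    (fun x _ => F.differentiableAt) (fun x _ => (hp.1.differentiable (by simp)) x)
  simp_rw [h1, mul_assoc (-(2 * Real.pi * Complex.I) : ℂ)] at h2
  rw [integral_const_mul] at h2
  rw [h2, norm_neg, norm_mul]
  refine le_mul_of_one_le_left (norm_nonneg _) ?_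
  rw [norm_neg, norm_mul, norm_mul, Complex.norm_I, Complex.norm_real,
    Real.norm_of_nonneg Real.pi_pos.le]
  simp only [Complex.norm_ofNat, mul_one]
  linarith [Real.pi_gt_three]

theorem exists_norm_integral_fourier_mul_le (d M : ℕ) : ∃ m : ℕ × ℕ, ∃ K : ℝ, 0 ≤ K ∧
    ∀ (h : 𝓢(E d, ℂ)) (p : E d → ℂ) (A : ℝ), 0 ≤ A → (∀ ζ, ‖p ζ‖ ≤ A * (1 + ‖ζ‖) ^ M) →
      ‖∫ ζ, 𝓕 h ζ * p ζ‖ ≤ K * A * schwartzSup (E d) ℂ m h := by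
  obtain ⟨m, C, hC0, hC⟩ := exists_schwartzSup_map_le
    (FourierTransform.fourierCLM ℂ 𝓢(E d, ℂ)) (M + (d + 1), 0)
  have hint : Integrable fun ζ : E d => ((1 + ‖ζ‖) ^ (d + 1))⁻¹ := by
    have := integrable_one_add_norm (E := E d) (μ := volume) (r := (d + 1 : ℕ)) (by simp)
    refine this.congr (Filter.Eventually.of_forall fun ζ => ?_)
    simp only
    rw [Real.rpow_neg (by positivity), Real.rpow_natCast]
  set I := ∫ ζ : E d, ((1 + ‖ζ‖) ^ (d + 1))⁻¹ with hI
  have hI0 : 0 ≤ I := integral_nonneg fun ζ => by positivity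
  refine ⟨m, I * (2 ^ (M + (d + 1)) * C), by positivity, fun h p A hA0 hA => ?_⟩
  set S := 2 ^ (M + (d + 1)) * (C * schwartzSup (E d) ℂ m h) with hS
  have hS0 : 0 ≤ S := by positivity
  have hpt : ∀ ζ, ‖𝓕 h ζ * p ζ‖ ≤ S * A * ((1 + ‖ζ‖) ^ (d + 1))⁻¹ := fun ζ => by
    have h1 : (1 + ‖ζ‖) ^ (M + (d + 1)) * ‖𝓕 h ζ‖ ≤ S :=
      (one_add_pow_mul_norm_le_schwartzSup (M + (d + 1)) (𝓕 h) ζ).trans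
        (mul_le_mul_of_nonneg_left (hC h) (by positivity))
    rw [norm_mul, ← div_eq_mul_inv, le_div_iff₀ (by positivity)]
    calc ‖𝓕 h ζ‖ * ‖p ζ‖ * (1 + ‖ζ‖) ^ (d + 1)
        ≤ ‖𝓕 h ζ‖ * (A * (1 + ‖ζ‖) ^ M) * (1 + ‖ζ‖) ^ (d + 1) := by gcongr; exact hA ζ
      _ = (1 + ‖ζ‖) ^ (M + (d + 1)) * ‖𝓕 h ζ‖ * A := by
          rw [pow_add]
          ring
      _ ≤ S * A := by gcongr
  calc _ ≤ ∫ ζ : E d, S * A * ((1 + ‖ζ‖) ^ (d + 1))⁻¹ :=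
        norm_integral_le_of_norm_le (hint.const_mul _) (Filter.Eventually.of_forall hpt)
    _ = S * A * I := integral_const_mul _ _
    _ = _ := by ring

/-- A smooth compactly supported function which equals `|y|⁻²` for `r ≤ |y| ≤ R`. -/
noncomputable def invSqCutoff (r R : ℝ) (y : E d) : ℂ :=
  (1 - cutoff (r / 2) y) * (((‖y‖ ^ 2)⁻¹ : ℝ) : ℂ) * cutoff R y

theorem contDiff_invSqCutoff {r : ℝ} (hr : 0 < r) (R : ℝ) :
    ContDiff ℝ (⊤ : ℕ∞) (invSqCutoff r R : E d → ℂ) := by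
  refine ContDiff.mul ?_ (contDiff_cutoff R)
  rw [contDiff_iff_contDiffAt]
  intro y
  by_cases hy : y = 0
  · have : (fun y : E d => (1 - cutoff (r / 2) y) * (((‖y‖ ^ 2)⁻¹ : ℝ) : ℂ)) =ᶠ[nhds y]
        fun _ => 0 := by
      filter_upwards [Metric.ball_mem_nhds y (half_pos hr)] with z hz
      rw [hy, mem_ball_zero_iff] at hz
      rw [cutoff_eq_one (half_pos hr) hz.le, sub_self, zero_mul]
    exact contDiffAt_const.congr_of_eventuallyEq this
  · refine (contDiff_const.sub (contDiff_cutoff _)).contDiffAt.mul ?_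
    refine Complex.ofRealCLM.contDiff.contDiffAt.comp y ?_
    exact (contDiff_norm_sq ℝ).contDiffAt.inv (by simpa using hy)

/-- On the annulus h = Σ_k y_k (y_k |y|⁻² h). The multipliers are cut off to smooth compactly
supported functions, so they act continuously on 𝓢 and preserve zeros of h. This allows the division
to be repeated. -/
theorem exists_sum_inner_smulLeftCLM_eq {r R : ℝ} (hr : 0 < r) (hR : 0 < R) :
    ∃ L : Fin d → 𝓢(E d, ℂ) →L[ℂ] 𝓢(E d, ℂ), (∀ k h y, h y = 0 → L k h y = 0) ∧
      ∀ h : 𝓢(E d, ℂ), (∀ y, ‖y‖ < r → h y = 0) → (∀ y, R < ‖y‖ → h y = 0) →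
        h = ∑ k, SchwartzMap.smulLeftCLM ℂ
          (fun y : E d => (inner ℝ y (EuclideanSpace.single k (1 : ℝ)) : ℝ)) (L k h) := by
  have hcs : HasCompactSupport (invSqCutoff r R : E d → ℂ) :=
    (hasCompactSupport_cutoff hR).mul_left
  have ht : ∀ k : Fin d, (fun y : E d => (((y k : ℝ) : ℂ) * invSqCutoff r R y)).HasTemperateGrowth :=
    fun k => by
      refine HasCompactSupport.hasTemperateGrowth hcs.mul_left ?_
      refine ContDiff.mul ?_ (contDiff_invSqCutoff hr R)
      exact Complex.ofRealCLM.contDiff.comp (EuclideanSpace.proj (𝕜 := ℝ) k).contDiff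
  refine ⟨fun k => SchwartzMap.smulLeftCLM ℂ (fun y : E d => ((y k : ℝ) : ℂ) * invSqCutoff r R y),
    fun k h y hy => ?_, fun h h0 h1 => ?_⟩
  · rw [SchwartzMap.smulLeftCLM_apply_apply (ht k), hy, smul_zero]
  · ext y
    rw [sum_apply]
    have e : ∀ k : Fin d, SchwartzMap.smulLeftCLM ℂ
        (fun y : E d => (inner ℝ y (EuclideanSpace.single k (1 : ℝ)) : ℝ))
        (SchwartzMap.smulLeftCLM ℂ (fun y : E d => ((y k : ℝ) : ℂ) * invSqCutoff r R y) h) y =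
        (((y k) ^ 2 : ℝ) : ℂ) * (invSqCutoff r R y * h y) := fun k => by
      rw [SchwartzMap.smulLeftCLM_apply_apply (by fun_prop),
        SchwartzMap.smulLeftCLM_apply_apply (ht k), EuclideanSpace.inner_single_right]
      simp only [Complex.real_smul, smul_eq_mul]
      simp
      ring
    simp_rw [e]
    rw [← Finset.sum_mul, ← Complex.ofReal_sum]
    have hn : ∑ k, (y k) ^ 2 = ‖y‖ ^ 2 := by
      rw [EuclideanSpace.norm_sq_eq]
      simp
    rw [hn]
    rcases lt_or_ge ‖y‖ r with hy | hy
    · simp [h0 y hy]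
    rcases lt_or_ge R ‖y‖ with hy' | hy'
    · simp [h1 y hy']
    have hy0 : ((‖y‖ : ℝ) : ℂ) ≠ 0 := by
      exact_mod_cast (hr.trans_le hy).ne'
    rw [invSqCutoff, cutoff_eq_zero (half_pos hr) (by linarith), cutoff_eq_one hR hy']
    push_cast
    field_simp
    ring

/-- Each division by |y|² followed by integration by parts trades one derivative of p for a
constant. The constants depend only on the annulus and the orders, not on h or p. -/
theorem exists_norm_integral_fourier_mul_le_of_eq_zero {r R : ℝ} (hr : 0 < r) (hR : 0 < R)
    (d M N : ℕ) : ∃ m : ℕ × ℕ, ∃ K : ℝ, 0 ≤ K ∧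
    ∀ h : 𝓢(E d, ℂ), (∀ y, ‖y‖ < r → h y = 0) → (∀ y, R < ‖y‖ → h y = 0) →
    ∀ p : E d → ℂ, p.HasTemperateGrowth → ∀ A : ℝ, 0 ≤ A →
      (∀ ζ, ‖iteratedFDeriv ℝ N p ζ‖ ≤ A * (1 + ‖ζ‖) ^ M) →
      ‖∫ ζ, 𝓕 h ζ * p ζ‖ ≤ K * A * schwartzSup (E d) ℂ m h := by
  induction N with
  | zero =>
    obtain ⟨m, K, hK0, hK⟩ := exists_norm_integral_fourier_mul_le d M
    exact ⟨m, K, hK0, fun h _ _ p _ A hA0 hA => hK h p A hA0 fun ζ => by simpa using hA ζ⟩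
  | succ N ih =>
    obtain ⟨m, K, hK0, hK⟩ := ih
    obtain ⟨L, hL0, hL⟩ := exists_sum_inner_smulLeftCLM_eq (d := d) hr hR
    choose m' C hC0 hC using fun k => exists_schwartzSup_map_le (L k) m
    refine ⟨Finset.univ.sup m', K * ∑ k, C k,
      mul_nonneg hK0 (Finset.sum_nonneg fun k _ => hC0 k), fun h h0 h1 p hp A hA0 hA => ?_⟩
    set v : Fin d → E d := fun k => EuclideanSpace.single k (1 : ℝ) with hv
    have e : ∫ ζ, 𝓕 h ζ * p ζ = ∑ k, ∫ ζ, 𝓕 (SchwartzMap.smulLeftCLM ℂ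
        (fun y : E d => (inner ℝ y (v k) : ℝ)) (L k h)) ζ * p ζ := by
      rw [← integral_finsetSum _ fun k _ => integrable_schwartz_mul _ hp]
      refine integral_congr_ae (Filter.Eventually.of_forall fun ζ => ?_)
      simp only
      conv_lhs => rw [hL h h0 h1]
      have := map_sum (FourierTransform.fourierCLM ℂ 𝓢(E d, ℂ)) (fun k => SchwartzMap.smulLeftCLM ℂ
        (fun y : E d => (inner ℝ y (v k) : ℝ)) (L k h)) Finset.univ
      simp only [FourierTransform.fourierCLM_apply] at this
      rw [this, sum_apply, Finset.sum_mul]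
    rw [e, Finset.mul_sum, Finset.sum_mul, Finset.sum_mul]
    refine (norm_sum_le _ _).trans (Finset.sum_le_sum fun k _ => ?_)
    obtain ⟨ht, hb⟩ := hasTemperateGrowth_fderiv_apply hp (v k)
    calc _ ≤ ‖∫ ζ, 𝓕 (L k h) ζ * fderiv ℝ p ζ (v k)‖ :=
          norm_integral_fourier_inner_mul_le (L k h) hp (v k)
      _ ≤ K * A * schwartzSup (E d) ℂ m (L k h) := by
          refine hK _ (fun y hy => hL0 k h y (h0 y hy)) (fun y hy => hL0 k h y (h1 y hy)) _ ht A hA0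
            fun ζ => (hb N ζ).trans ?_
          rw [hv, PiLp.norm_single, norm_one, one_mul]
          exact hA ζ
      _ ≤ K * A * (C k * schwartzSup (E d) ℂ (Finset.univ.sup m') h) := by
          have h2 := schwartzSup_mono (D := E d) (V := ℂ) (Finset.le_sup (f := m') (Finset.mem_univ k)) h
          have := (hC k h).trans (mul_le_mul_of_nonneg_left h2 (hC0 k))
          gcongr
      _ = _ := by ring

end NonstationaryPhase
end FourierBanach

namespace FourierBanach

/-! ### Pseudo-locality -/

section PseudoLocality

variable {d : ℕ}

theorem fourier_compSubConstCLM (c : E d) (φ : 𝓢(E d, ℂ)) (ζ : E d) :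
    𝓕 (compSubConstCLM ℂ c φ) ζ = (𝐞 (-inner ℝ ζ c) : ℂ) * 𝓕 φ ζ := by
  have h1 : 𝓕 (compSubConstCLM ℂ c φ) ζ = ∫ y, (𝐞 (-inner ℝ y ζ) : ℂ) * φ (y - c) := by
    rw [SchwartzMap.fourier_coe, Real.fourier_eq]
    rfl
  have h2 : 𝓕 φ ζ = ∫ y, (𝐞 (-inner ℝ y ζ) : ℂ) * φ y := by
    rw [SchwartzMap.fourier_coe, Real.fourier_eq]
    rfl
  rw [h1, h2, ← integral_add_right_eq_self _ c, ← integral_const_mul]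
  refine integral_congr_ae (Filter.Eventually.of_forall fun y => ?_)
  simp only
  rw [add_sub_cancel_right, ← mul_assoc, ← Circle.coe_mul, ← AddChar.map_add_eq_mul, inner_add_left,
    real_inner_comm c ζ]
  congr 4
  ring

/-- The phase is absorbed into the translate χ(· + x). Separation of x from the support of χ then
means that the translate vanishes near the origin. -/
theorem oscInt_fourier_eq (b : E d × E d → ℂ) (χ : 𝓢(E d, ℂ)) (x : E d) :
    oscInt b (𝓕 χ) x = ∫ ζ, 𝓕 (compSubConstCLM ℂ (-x) χ) ζ * b (x, ζ) := by
  refine integral_congr_ae (Filter.Eventually.of_forall fun ζ => ?_)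
  simp only
  rw [fourier_compSubConstCLM, inner_neg_right, neg_neg, smul_eq_mul, smul_eq_mul, mul_assoc]

theorem IsAmplitude.hasTemperateGrowth_slice {M : ℕ} {b : E d × E d → ℂ} (hb : IsAmplitude M b)
    (x : E d) : (fun ζ => b (x, ζ)).HasTemperateGrowth := by
  refine ⟨hb.smooth.comp (by fun_prop), fun n => ?_⟩
  obtain ⟨A, hA⟩ := hb.bound n
  refine ⟨M, A * (1 + ‖x‖) ^ M, fun ζ => ?_⟩
  refine (norm_iteratedFDeriv_slice_le hb.smooth x ζ n).trans ((hA n le_rfl x ζ).trans ?_)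
  rw [mul_assoc]

theorem norm_iteratedFDeriv_shiftSymbol_slice {a : E d × E d → ℂ} (ha : ContDiff ℝ (⊤ : ℕ∞) a)
    (η : E d) (N : ℕ) (x ζ : E d) :
    ‖iteratedFDeriv ℝ N (fun ζ => shiftSymbol a η (x, ζ)) ζ‖ =
      (2 * Real.pi) ^ N * mixedDeriv 0 N a x ((2 * Real.pi) • ζ + η) := by
  have h1 : ContDiff ℝ N fun ξ => a (x, ξ + η) :=
    contDiff_infty.1 (ha.comp (by fun_prop)) N
  have h2 := iteratedFDeriv_comp_const_smul (2 * Real.pi) h1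
  have e : (fun ζ => shiftSymbol a η (x, ζ)) = fun ζ => a (x, (2 * Real.pi) • ζ + η) := rfl
  rw [e, h2]
  simp only
  rw [norm_smul, norm_pow, Real.norm_of_nonneg (by positivity),
    iteratedFDeriv_comp_add_right' N η (f := fun ξ => a (x, ξ)), mixedDeriv,
    norm_iteratedFDeriv_zero]

/-- Sufficiently many frequency derivatives of a symbol decay as fast as we like. -/
theorem IsSymbol.exists_norm_iteratedFDeriv_slice_le {ρ : ℝ} (hρ : 0 < ρ) {ω₀ : E d × E d → ℝ}
    (hω₀ : IsWeight ω₀) {a : E d × E d → ℂ} (ha : IsSymbol ρ 0 ω₀ a) (K : ℕ) :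
    ∃ N M : ℕ, ∃ C : ℝ, 0 ≤ C ∧ ∀ η x ζ,
      ‖iteratedFDeriv ℝ N (fun ζ => shiftSymbol a η (x, ζ)) ζ‖ ≤
        C * (1 + ‖x‖) ^ M * ((1 + ‖η‖) ^ K)⁻¹ * (1 + ‖ζ‖) ^ M := by
  obtain ⟨C₀, N₀, hC₀0, hC₀⟩ := hω₀.exists_moderate
  -- Each frequency derivative gains ⟨ξ⟩^{-ρ}. With ρN ≥ N₀ + K the gain exceeds the growth N₀ of ω₀
  -- by K powers, later transferred from ξ to η at the expense of powers of 1 + |ζ|.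
  obtain ⟨N, hN⟩ := exists_nat_ge (((N₀ + K : ℕ) : ℝ) / ρ)
  rw [div_le_iff₀ hρ] at hN
  obtain ⟨D, hD⟩ := ha.bound 0 N
  have hp := Real.pi_gt_three
  have h00 := hω₀.pos (0, 0)
  refine ⟨N, N₀ + K, (2 * Real.pi) ^ N * (|D| * (C₀ * ω₀ (0, 0)) * 2 ^ (N₀ + K) *
    (2 * Real.pi) ^ K), by positivity, fun η x ζ => ?_⟩
  rw [norm_iteratedFDeriv_shiftSymbol_slice ha.smooth]
  set ξ := (2 * Real.pi) • ζ + η with hξ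
  have h1 : ω₀ (x, ξ) ≤ C₀ * ω₀ (0, 0) * ((1 + ‖x‖) * (1 + ‖ξ‖)) ^ N₀ := by
    have := hC₀ (0, 0) (x, ξ)
    rw [Prod.mk_add_mk, zero_add, zero_add] at this
    exact this.trans (by gcongr; exact one_add_norm_prod_le x ξ)
  have hb1 := one_le_bracket ξ
  have h2 : bracket ξ ^ (-ρ * N + 0 * (0 : ℕ)) ≤ (bracket ξ ^ (N₀ + K))⁻¹ := by
    rw [← Real.rpow_natCast, ← Real.rpow_neg (by linarith)]
    refine Real.rpow_le_rpow_of_exponent_le hb1 ?_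
    nlinarith
  have h3 : 1 + ‖ξ‖ ≤ 2 * bracket ξ := by
    have : ‖ξ‖ ≤ bracket ξ := Real.le_sqrt_of_sq_le (by linarith)
    linarith
  have h4 : 1 + ‖η‖ ≤ (1 + ‖ξ‖) * (2 * Real.pi * (1 + ‖ζ‖)) := by
    have e : η = ξ - (2 * Real.pi) • ζ := by rw [hξ, add_sub_cancel_left]
    calc 1 + ‖η‖ = 1 + ‖ξ - (2 * Real.pi) • ζ‖ := by rw [← e]
      _ ≤ (1 + ‖ξ‖) * (1 + ‖(2 * Real.pi) • ζ‖) := one_add_norm_sub_le _ _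
      _ ≤ _ := by
          gcongr
          rw [norm_smul, Real.norm_of_nonneg (by positivity)]
          nlinarith [norm_nonneg ζ]
  have h5 : (1 + ‖ξ‖) ^ N₀ * (bracket ξ ^ (N₀ + K))⁻¹ ≤
      2 ^ (N₀ + K) * (2 * Real.pi) ^ K * ((1 + ‖η‖) ^ K)⁻¹ * (1 + ‖ζ‖) ^ K := by
    calc (1 + ‖ξ‖) ^ N₀ * (bracket ξ ^ (N₀ + K))⁻¹
        ≤ (1 + ‖ξ‖) ^ N₀ * (((1 + ‖ξ‖) / 2) ^ (N₀ + K))⁻¹ := by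
          gcongr
          linarith
      _ = 2 ^ (N₀ + K) * ((1 + ‖ξ‖) ^ K)⁻¹ := by
          rw [div_pow, pow_add (1 + ‖ξ‖)]
          field_simp
      _ ≤ 2 ^ (N₀ + K) * ((2 * Real.pi * (1 + ‖ζ‖)) ^ K * ((1 + ‖η‖) ^ K)⁻¹) := by
          gcongr
          rw [← div_eq_mul_inv, inv_eq_one_div,
            div_le_div_iff₀ (by positivity) (by positivity), one_mul, ← mul_pow, mul_comm _ (1 + ‖ξ‖)]
          gcongr
      _ = _ := by
          rw [mul_pow]
          ring
  have hmix : mixedDeriv 0 N a x ξ ≤ |D| * (C₀ * ω₀ (0, 0)) * (1 + ‖x‖) ^ N₀ *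
      ((1 + ‖ξ‖) ^ N₀ * (bracket ξ ^ (N₀ + K))⁻¹) := by
    have h0 := (hω₀.pos (x, ξ)).le
    have hr : 0 ≤ bracket ξ ^ (-ρ * N + 0 * (0 : ℕ)) := Real.rpow_nonneg (by linarith) _
    calc mixedDeriv 0 N a x ξ ≤ D * ω₀ (x, ξ) * bracket ξ ^ (-ρ * N + 0 * (0 : ℕ)) := hD x ξ
      _ ≤ |D| * (C₀ * ω₀ (0, 0) * ((1 + ‖x‖) * (1 + ‖ξ‖)) ^ N₀) *
          (bracket ξ ^ (N₀ + K))⁻¹ := by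
          gcongr
          exact le_abs_self D
      _ = _ := by
          rw [mul_pow]
          ring
  calc (2 * Real.pi) ^ N * mixedDeriv 0 N a x ξ
      ≤ (2 * Real.pi) ^ N * (|D| * (C₀ * ω₀ (0, 0)) * (1 + ‖x‖) ^ (N₀ + K) *
        (2 ^ (N₀ + K) * (2 * Real.pi) ^ K * ((1 + ‖η‖) ^ K)⁻¹ * (1 + ‖ζ‖) ^ (N₀ + K))) := by
        refine mul_le_mul_of_nonneg_left (hmix.trans ?_) (by positivity)
        refine mul_le_mul ?_ (h5.trans ?_) (by positivity) (by positivity)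
        · exact mul_le_mul_of_nonneg_left
            (pow_le_pow_right₀ (by simp) (Nat.le_add_right _ _)) (by positivity)
        · exact mul_le_mul_of_nonneg_left
            (pow_le_pow_right₀ (by simp) (Nat.le_add_left _ _)) (by positivity)
    _ = _ := by ring

/-- Off-diagonal decay of the kernel of a pseudo-differential operator. -/
theorem IsSymbol.exists_norm_oscInt_le {ρ : ℝ} (hρ : 0 < ρ) {ω₀ : E d × E d → ℝ}
    (hω₀ : IsWeight ω₀) {a : E d × E d → ℂ} (ha : IsSymbol ρ 0 ω₀ a) (K : ℕ) {r R : ℝ}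
    (hr : 0 < r) (hR : 0 < R) (χ : 𝓢(E d, ℂ)) : ∃ C : ℝ, 0 ≤ C ∧ ∀ η x, ‖x‖ ≤ R →
      (∀ y, ‖y - x‖ < r → χ y = 0) → (∀ y, R < ‖y‖ → χ y = 0) →
      ‖oscInt (shiftSymbol a η) (𝓕 χ) x‖ ≤ C * ((1 + ‖η‖) ^ K)⁻¹ := by
  obtain ⟨N, M, C, hC0, hC⟩ := ha.exists_norm_iteratedFDeriv_slice_le hρ hω₀ K
  obtain ⟨M', -, hb⟩ := ha.isAmplitude hρ hω₀
  -- Translation by x with |x| ≤ R enlarges the support radius of χ to at most R + R.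
  obtain ⟨m, K', hK'0, hK'⟩ := exists_norm_integral_fourier_mul_le_of_eq_zero hr
    (show 0 < R + R by positivity) d M N
  refine ⟨K' * (C * (1 + R) ^ M) * (2 ^ m.1 * (1 + R) ^ m.1 * schwartzSup (E d) ℂ m χ),
    by positivity, fun η x hx h0 h1 => ?_⟩
  rw [oscInt_fourier_eq]
  have hA : ∀ ζ, ‖iteratedFDeriv ℝ N (fun ζ => shiftSymbol a η (x, ζ)) ζ‖ ≤
      C * (1 + R) ^ M * ((1 + ‖η‖) ^ K)⁻¹ * (1 + ‖ζ‖) ^ M := fun ζ =>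
    (hC η x ζ).trans (by gcongr)
  refine (hK' (compSubConstCLM ℂ (-x) χ) (fun y hy => ?_) (fun y hy => ?_) _
    ((hb η).hasTemperateGrowth_slice x) _ (by positivity) hA).trans ?_
  · rw [compSubConstCLM_apply]
    exact h0 _ (by simpa using hy)
  · rw [compSubConstCLM_apply, sub_neg_eq_add]
    refine h1 _ ?_
    have := norm_sub_le (y + x) x
    rw [add_sub_cancel_right] at this
    linarith
  · have h2 := schwartzSup_compSubConstCLM_le m (-x) χ
    rw [norm_neg] at h2
    have h3 : schwartzSup (E d) ℂ m (compSubConstCLM ℂ (-x) χ) ≤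
        2 ^ m.1 * (1 + R) ^ m.1 * schwartzSup (E d) ℂ m χ := h2.trans (by gcongr)
    calc _ ≤ K' * (C * (1 + R) ^ M * ((1 + ‖η‖) ^ K)⁻¹) *
          (2 ^ m.1 * (1 + R) ^ m.1 * schwartzSup (E d) ℂ m χ) := by gcongr
      _ = _ := by ring

theorem norm_fourierS_le (φ : 𝓢(E d, ℂ)) (ξ : E d) :
    ‖fourierS d φ ξ‖ ≤ (2 * Real.pi) ^ (-(d : ℝ) / 2) * ∫ x, ‖φ x‖ := by
  rw [fourierS_apply, norm_mul, Complex.norm_real, Real.norm_of_nonneg (by positivity)]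
  gcongr
  refine (norm_integral_le_integral_norm _).trans (le_of_eq ?_)
  refine integral_congr_ae (Filter.Eventually.of_forall fun x => ?_)
  have e : Complex.exp (-(Complex.I * (inner ℝ x ξ : ℝ))) = char (-ξ) x := by
    rw [char, inner_neg_right]
    push_cast
    ring_nf
  simp only
  rw [norm_mul, e, norm_char, mul_one]

/-- Pseudo-locality: cutting an operator off to disjoint regions gives a smoothing operator. -/
theorem IsSymbol.freqLocal_of_disjoint {ρ : ℝ} (hρ : 0 < ρ) {ω₀ : E d × E d → ℝ}
    (hω₀ : IsWeight ω₀) {a : E d × E d → ℂ} (ha : IsSymbol ρ 0 ω₀ a)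
    {A : 𝓢'(E d, ℂ) →L[ℂ] 𝓢'(E d, ℂ)} (hA : ExtendsOp a A) {α β : E d → ℂ}
    (hα : ContDiff ℝ (⊤ : ℕ∞) α) (hαc : HasCompactSupport α) (hβ : β.HasTemperateGrowth) {r : ℝ}
    (hr : 0 < r) (hαβ : ∀ x y, α x ≠ 0 → ‖y - x‖ < r → β y = 0) (N : ℕ) :
    FreqLocal ((TemperedDistribution.smulLeftCLM ℂ α).comp
      (A.comp (TemperedDistribution.smulLeftCLM ℂ β))) fun η => ((1 + ‖η‖) ^ N)⁻¹ := by
  intro χ hχ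
  have hαt : α.HasTemperateGrowth := hαc.hasTemperateGrowth hα
  obtain ⟨θ, hθ, hθb⟩ := (((ha.schwartzLocal hρ hω₀ hA).comp_smulLeftCLM hβ).smulLeftCLM_comp hαt)
    χ hχ
  obtain ⟨M, -, hb⟩ := ha.isAmplitude hρ hω₀
  set χ' := SchwartzMap.smulLeftCLM ℂ β χ with hχ'
  have hθx : ∀ η x, θ η x = α x * oscInt (shiftSymbol a η) (𝓕 χ') x := fun η x => by
    have h1 := hθ η
    rw [ContinuousLinearMap.comp_apply, ContinuousLinearMap.comp_apply, smulLeftCLM_toTD hβ,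
      smulLeftCLM_modulation hβ, hA.apply_modulation hb, smulLeftCLM_toTD hαt,
      smulLeftCLM_modulation hαt] at h1
    have h2 := DFunLike.congr_fun (toTD_injective h1) x
    rw [modulation_apply, modulation_apply, SchwartzMap.smulLeftCLM_apply_apply hαt] at h2
    have h3 : char η x ≠ 0 := norm_ne_zero_iff.1 (by rw [norm_char]; exact one_ne_zero)
    exact (mul_left_cancel₀ h3 h2).symm
  refine ⟨fun η => modulation η (θ η), hθ, fun L => ?_⟩
  obtain ⟨k₁, hk₁⟩ := hαc.isCompact.isBounded.exists_norm_le
  obtain ⟨k₂, hk₂⟩ := hχ.isCompact.isBounded.exists_norm_le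
  set R := max 1 (max k₁ k₂) with hR
  have hR0 : 0 < R := lt_of_lt_of_le one_pos (le_max_left _ _)
  have hαR : ∀ x, α x ≠ 0 → ‖x‖ ≤ R := fun x hx => (hk₁ x (subset_tsupport _ hx)).trans
    ((le_max_left _ _).trans (le_max_right _ _))
  have hχR : ∀ y, R < ‖y‖ → χ' y = 0 := fun y hy => by
    have h0 : χ y = 0 := by
      by_contra h
      exact absurd ((hk₂ y (subset_tsupport _ h)).trans
        ((le_max_right _ _).trans (le_max_right _ _))) (not_le.2 hy)
    rw [hχ', SchwartzMap.smulLeftCLM_apply_apply hβ, h0, smul_zero]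
  obtain ⟨C₀, M₀, hC₀0, hC₀⟩ := (hω₀.isPolyModerate 0).moderate
  have h00 := hω₀.pos (0, 0)
  -- The exponent anticipates a geometric mean: the crude bound loses M₀ powers of 1 + |η|, and
  -- halving the remaining 2N leaves N.
  obtain ⟨C₁, hC₁0, hC₁⟩ := ha.exists_norm_oscInt_le hρ hω₀ (M₀ + 2 * N) hr hR0 χ'
  obtain ⟨m, C₂, hC₂0, hC₂⟩ := exists_schwartzSup_map_le (fourierS d) (2 * L, 0)
  obtain ⟨C₃, hC₃0, hC₃⟩ := hθb m
  set κ : ℝ := (2 * Real.pi) ^ (-(d : ℝ) / 2) with hκ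
  have hκ0 : 0 < κ := by positivity
  set I := ∫ x, ‖α x‖ with hI
  have hI0 : 0 ≤ I := integral_nonneg fun x => norm_nonneg _
  have hsmall : ∀ η ξ, ‖fourierS d (θ η) ξ‖ ≤ κ * I * C₁ * ((1 + ‖η‖) ^ (M₀ + 2 * N))⁻¹ :=
    fun η ξ => by
      refine (norm_fourierS_le _ _).trans ?_
      have hle : ∫ x, ‖θ η x‖ ≤ ∫ x, ‖α x‖ * (C₁ * ((1 + ‖η‖) ^ (M₀ + 2 * N))⁻¹) := by
        refine integral_mono (θ η).integrable.norm
          ((hα.continuous.integrable_of_hasCompactSupport hαc).norm.mul_const _) fun x => ?_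
        simp only
        rw [hθx, norm_mul]
        by_cases hx : α x = 0
        · simp [hx]
        · gcongr
          refine hC₁ η x (hαR x hx) (fun y hy => ?_) hχR
          rw [hχ', SchwartzMap.smulLeftCLM_apply_apply hβ, hαβ x y hx hy, zero_smul]
      rw [integral_mul_const] at hle
      calc _ ≤ κ * (I * (C₁ * ((1 + ‖η‖) ^ (M₀ + 2 * N))⁻¹)) := by gcongr
        _ = _ := by ring
  have hlarge : ∀ η ξ, (1 + ‖ξ‖) ^ (2 * L) * ‖fourierS d (θ η) ξ‖ ≤
      2 ^ (2 * L) * (C₂ * (C₃ * (C₀ * ω₀ (0, 0) * (1 + ‖η‖) ^ M₀))) := fun η ξ => by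
    refine (one_add_pow_mul_norm_le_schwartzSup (2 * L) (fourierS d (θ η)) ξ).trans ?_
    gcongr
    refine (hC₂ _).trans ?_
    gcongr
    refine (hC₃ η).trans ?_
    gcongr
    simpa using hC₀ 0 η
  set D := κ * I * C₁ * (2 ^ (2 * L) * (C₂ * (C₃ * (C₀ * ω₀ (0, 0))))) with hD
  have hD0 : 0 ≤ D := by positivity
  refine ⟨Real.sqrt D, Real.sqrt_nonneg _, fun η ξ => ?_⟩
  rw [fourierS_modulation]
  -- The square is estimated by the product of `hsmall`, which decays in η uniformly in ξ, and
  -- `hlarge`, which decays in the Fourier variable but grows in η. Their geometric mean decays in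
  -- both.
  refine le_of_sq_le_sq ?_ (by positivity)
  rw [mul_pow _ _ 2, mul_pow _ _ 2, Real.sq_sqrt hD0]
  set X := ‖fourierS d (θ η) (ξ - η)‖ with hX
  calc ((1 + ‖ξ - η‖) ^ L) ^ 2 * X ^ 2 = X * ((1 + ‖ξ - η‖) ^ (2 * L) * X) := by ring
    _ ≤ (κ * I * C₁ * ((1 + ‖η‖) ^ (M₀ + 2 * N))⁻¹) *
        (2 ^ (2 * L) * (C₂ * (C₃ * (C₀ * ω₀ (0, 0) * (1 + ‖η‖) ^ M₀)))) :=
        mul_le_mul (hsmall _ _) (hlarge _ _) (by positivity) (by positivity)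
    _ = _ := by
        rw [pow_add, pow_mul', hD]
        field_simp

end PseudoLocality
end FourierBanach

namespace FourierBanach

/-! ### Wave-front sets -/

section WaveFront

variable {d : ℕ} {B : Type*} [NormedAddCommGroup B] [NormedSpace ℂ B] [CompleteSpace B]
  {ι : B →ₗ[ℂ] (E d →ₘ[volume] ℂ)} {v : E d → ℝ}

theorem exists_bump (x₀ : E d) {r : ℝ} (hr : 0 < r) : ∃ α : E d → ℂ, ContDiff ℝ (⊤ : ℕ∞) α ∧
    HasCompactSupport α ∧ (∀ x, ‖x - x₀‖ ≤ r → α x = 1) ∧ tsupport α ⊆ Metric.closedBall x₀ (2 * r) := by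
  let b : ContDiffBump x₀ := ⟨r, 2 * r, hr, by linarith⟩
  have ht : tsupport (fun x => (b x : ℂ)) ⊆ Metric.closedBall x₀ (2 * r) := by
    refine (closure_mono fun x hx => ?_).trans b.tsupport_eq.subset
    intro h0
    exact hx (by simp [h0])
  refine ⟨fun x => (b x : ℂ), Complex.ofRealCLM.contDiff.comp b.contDiff,
    (isCompact_closedBall _ _).of_isClosed_subset (isClosed_tsupport _) ht, fun x hx => ?_, ht⟩
  change ((b x : ℝ) : ℂ) = 1
  rw [b.one_of_mem_closedBall (mem_closedBall_iff_norm.2 hx), Complex.ofReal_one]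

theorem contDiff_div_of_tsupport {α φ : E d → ℂ} (hα : ContDiff ℝ (⊤ : ℕ∞) α)
    (hφ : ContDiff ℝ (⊤ : ℕ∞) φ) (h : ∀ x ∈ tsupport α, φ x ≠ 0) :
    ContDiff ℝ (⊤ : ℕ∞) fun x => α x / φ x := by
  rw [contDiff_iff_contDiffAt]
  intro x
  by_cases hx : x ∈ tsupport α
  · simp_rw [div_eq_mul_inv]
    exact hα.contDiffAt.mul (hφ.contDiffAt.inv (h x hx))
  · have : (fun x => α x / φ x) =ᶠ[nhds x] fun _ => 0 := by
      filter_upwards [(isClosed_tsupport α).isOpen_compl.mem_nhds hx] with z hz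
      rw [image_eq_zero_of_notMem_tsupport hz, zero_div]
    exact contDiffAt_const.congr_of_eventuallyEq this

theorem smulLeftCLM_apply_cutoff {R : ℝ} (hR : 0 < R)
    {f : 𝓢'(E d, ℂ)} (hf : ∀ φ, f (SchwartzMap.smulLeftCLM ℂ (cutoff R : E d → ℂ) φ) = f φ)
    {g : E d → ℂ} (hg : g.HasTemperateGrowth) (φ : 𝓢(E d, ℂ)) :
    TemperedDistribution.smulLeftCLM ℂ g f (SchwartzMap.smulLeftCLM ℂ (cutoff R : E d → ℂ) φ) =
      TemperedDistribution.smulLeftCLM ℂ g f φ := by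
  rw [TemperedDistribution.smulLeftCLM_apply_apply, TemperedDistribution.smulLeftCLM_apply_apply,
    ← hf (SchwartzMap.smulLeftCLM ℂ g φ)]
  congr 1
  ext x
  rw [SchwartzMap.smulLeftCLM_apply_apply hg, smulLeftCLM_cutoff_apply hR,
    smulLeftCLM_cutoff_apply hR, SchwartzMap.smulLeftCLM_apply_apply hg, smul_eq_mul, smul_eq_mul]
  ring

variable {ρ : ℝ} {ω ω₀ : E d × E d → ℝ} {a : E d × E d → ℂ}
  {A : 𝓢'(E d, ℂ) →L[ℂ] 𝓢'(E d, ℂ)} {f : 𝓢'(E d, ℂ)}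

theorem seminormFB_op_lt_top (hB : IsInvariantBFSpace ι v) (hρ : 0 < ρ) (hω : IsWeight ω)
    (hω₀ : IsWeight ω₀) (ha : IsSymbol ρ 0 ω₀ a) (hA : ExtendsOp a A)
    (hf : IsCompact (Distribution.dsupport f)) {Γ₁ Γ₂ : Set (E d)} (hΓ₂ : IsOpen Γ₂)
    (hΓ : IsConeSeparated Γ₁ Γ₂) {x y : E d} (h : seminormFB ι ω Γ₁ x f < ⊤) :
    seminormFB ι (fun z => ω z / ω₀ z) Γ₂ y (A f) < ⊤ := by
  obtain ⟨R, hR, hfR⟩ := exists_apply_cutoff hf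
  obtain ⟨C, hC0, hC⟩ := hω.exists_mul_div_le hω₀ x y
  exact (ha.schwartzLocal hρ hω₀ hA).freqLocal.seminormFB_lt_top (hω₀.isPolyModerate 0) hB hR hfR
    (hω.measurable.div hω₀.measurable) (hω.isPolyModerate x) hC0 hC hΓ₂ hΓ h

/-- A localization of f that is finite near ξ₀ has to produce one of Op(a)f. Near x₀ the
distribution f is a smooth multiple of φf, to which the cone estimate applies; the part of f away
from x₀ contributes only a smoothing error there. -/
theorem exists_seminormFB_smul_op_lt_top (hB : IsInvariantBFSpace ι v) (hρ : 0 < ρ)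
    (hω : IsWeight ω) (hω₀ : IsWeight ω₀) (ha : IsSymbol ρ 0 ω₀ a) (hA : ExtendsOp a A)
    (hf : IsCompact (Distribution.dsupport f)) {φ : E d → ℂ} (hφ : ContDiff ℝ (⊤ : ℕ∞) φ)
    (hφc : HasCompactSupport φ) {x₀ : E d} (hφ₀ : φ x₀ ≠ 0) {Γ : Set (E d)} (hΓ : IsOpenCone Γ)
    {ξ₀ : E d} (hξ₀ : ξ₀ ∈ Γ) {x : E d} (y : E d)
    (h : seminormFB ι ω Γ x (TemperedDistribution.smulLeftCLM ℂ φ f) < ⊤) :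
    ∃ α : E d → ℂ, ContDiff ℝ (⊤ : ℕ∞) α ∧ HasCompactSupport α ∧ α x₀ ≠ 0 ∧
      ∃ Γ' : Set (E d), IsOpenCone Γ' ∧ ξ₀ ∈ Γ' ∧ seminormFB ι (fun z => ω z / ω₀ z) Γ' y
        (TemperedDistribution.smulLeftCLM ℂ α (A f)) < ⊤ := by
  obtain ⟨R, hR, hfR⟩ := exists_apply_cutoff hf
  obtain ⟨Γ', hΓ', hξ₀', hsep⟩ := hΓ.exists_isConeSeparated hξ₀
  obtain ⟨ε, hε, hball⟩ := Metric.isOpen_iff.1 (isOpen_ne_fun hφ.continuous continuous_const) x₀ hφ₀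
  -- The support of χ, of radius at most 2r, stays in {φ ≠ 0}, so χ/φ is smooth. As α lives within
  -- r/2 of x₀ and χ = 1 within r, the supports of α and 1 - χ are r/2 apart.
  set r := ε / 4 with hr
  have hr0 : 0 < r := by positivity
  obtain ⟨χ, hχ, hχc, hχ1, hχs⟩ := exists_bump x₀ hr0
  obtain ⟨α, hα, hαc, hα1, hαs⟩ := exists_bump x₀ (show 0 < r / 4 by positivity)
  have hκ : ContDiff ℝ (⊤ : ℕ∞) fun x => χ x / φ x := contDiff_div_of_tsupport hχ hφ fun x hx =>
    hball (Metric.closedBall_subset_ball (by linarith) (hχs hx))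
  have hκc : HasCompactSupport fun x => χ x / φ x := hχc.mono' fun x hx => by
    refine subset_tsupport _ fun h0 => hx ?_
    simp [h0]
  have hχt : χ.HasTemperateGrowth := hχc.hasTemperateGrowth hχ
  have hφt : φ.HasTemperateGrowth := hφc.hasTemperateGrowth hφ
  have hκt : (fun x => χ x / φ x).HasTemperateGrowth := hκc.hasTemperateGrowth hκ
  have hαt : α.HasTemperateGrowth := hαc.hasTemperateGrowth hα
  have hβt : (fun x => 1 - χ x).HasTemperateGrowth := (Function.HasTemperateGrowth.const 1).sub hχt
  set β : E d → ℂ := fun x => 1 - χ x with hβ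
  set T := TemperedDistribution.smulLeftCLM (E := E d) ℂ α with hT
  have hsplit : f = TemperedDistribution.smulLeftCLM ℂ (fun x => χ x / φ x)
      (TemperedDistribution.smulLeftCLM ℂ φ f) + TemperedDistribution.smulLeftCLM ℂ β f := by
    ext ψ
    rw [add_apply, TemperedDistribution.smulLeftCLM_apply_apply,
      TemperedDistribution.smulLeftCLM_apply_apply, TemperedDistribution.smulLeftCLM_apply_apply,
      ← map_add]
    congr 1
    ext z
    rw [add_apply, SchwartzMap.smulLeftCLM_apply_apply hφt,
      SchwartzMap.smulLeftCLM_apply_apply hκt, SchwartzMap.smulLeftCLM_apply_apply hβt]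
    simp only [smul_eq_mul, hβ]
    by_cases hz : φ z = 0
    · have : χ z = 0 := by
        by_contra hne
        exact hball (Metric.closedBall_subset_ball (by linarith) (hχs (subset_tsupport _ hne))) hz
      rw [this]
      ring
    · field_simp
      ring
  have e : T (A f) = (T.comp (A.comp (TemperedDistribution.smulLeftCLM ℂ (fun x => χ x / φ x))))
      (TemperedDistribution.smulLeftCLM ℂ φ f) +
      (T.comp (A.comp (TemperedDistribution.smulLeftCLM ℂ β))) f := by
    conv_lhs => rw [hsplit, map_add, map_add]
    rfl
  refine ⟨α, hα, hαc, ?_, Γ', hΓ', hξ₀', ?_⟩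
  · rw [hα1 x₀ (by simp; positivity)]
    exact one_ne_zero
  rw [e]
  have hmeas : Measurable fun z => ω z / ω₀ z := hω.measurable.div hω₀.measurable
  -- The near term uses the hypothesis on Γ and the smaller cone Γ'; the far term is smoothing and
  -- would be finite on any open cone.
  refine seminormFB_add_lt_top ?_ ?_
  · obtain ⟨C, hC0, hC⟩ := hω.exists_mul_div_le hω₀ x y
    exact (((ha.schwartzLocal hρ hω₀ hA).comp_smulLeftCLM hκt).smulLeftCLM_comp
      hαt).freqLocal.seminormFB_lt_top (hω₀.isPolyModerate 0) hB hR
      (smulLeftCLM_apply_cutoff hR hfR hφt) hmeas (hω.isPolyModerate x) hC0 hC hΓ'.isOpen hsep h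
  · obtain ⟨C, M, hC0, hC⟩ := hω.exists_div_le hω₀ y
    refine seminormFB_lt_top_of_forall_freqLocal hB (fun N => ha.freqLocal_of_disjoint hρ hω₀ hA
      hα hαc hβt (half_pos hr0) (fun z z' hz hz' => ?_) N) hR hfR hmeas hC0 hC hΓ'.isOpen
    have h1 := mem_closedBall_iff_norm.1 (hαs (subset_tsupport _ hz))
    have h2 := norm_add_le (z' - z) (z - x₀)
    rw [sub_add_sub_cancel] at h2
    rw [hβ]
    simp only
    rw [hχ1 z' (by linarith), sub_self]

theorem waveFrontFB_op_subset (hB : IsInvariantBFSpace ι v) (hρ : 0 < ρ)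
    (hω : IsWeight ω) (hω₀ : IsWeight ω₀) (ha : IsSymbol ρ 0 ω₀ a) (hA : ExtendsOp a A)
    (hf : IsCompact (Distribution.dsupport f)) (x y : E d) :
    waveFrontFB ι (fun z => ω z / ω₀ z) y (A f) ⊆ waveFrontFB ι ω x f := by
  rintro ⟨x₀, ξ₀⟩ ⟨hne, hWF⟩
  refine ⟨hne, fun φ hφ hφc hφ₀ => ⟨hne, fun ⟨Γ, hΓ, hξ₀, h⟩ => ?_⟩⟩
  obtain ⟨α, hα, hαc, hα₀, Γ', hΓ', hξ₀', h'⟩ :=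
    exists_seminormFB_smul_op_lt_top hB hρ hω hω₀ ha hA hf hφ hφc hφ₀ hΓ hξ₀ y h
  exact (hWF α hα hαc hα₀).2 ⟨Γ', hΓ', hξ₀', h'⟩

end WaveFront
end FourierBanach

theorem mainTheorem12 {d : ℕ} {B : Type*} [NormedAddCommGroup B] [NormedSpace ℂ B]
    [CompleteSpace B] (ι : B →ₗ[ℂ] (FourierBanach.E d →ₘ[MeasureTheory.volume] ℂ))
    (v : FourierBanach.E d → ℝ) (hB : FourierBanach.IsInvariantBFSpace ι v)
    (ρ : ℝ) (hρ : 0 < ρ)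
    (ω ω₀ : FourierBanach.E d × FourierBanach.E d → ℝ)
    (hω : FourierBanach.IsWeight ω) (hω₀ : FourierBanach.IsSymbolWeight ρ 0 ω₀)
    (a : FourierBanach.E d × FourierBanach.E d → ℂ) (ha : FourierBanach.IsSymbol ρ 0 ω₀ a) :
    -- `Op(a)` is well defined on `𝓢'`, as the unique continuous extension from `𝓢`
    (∃! A : 𝓢'(FourierBanach.E d, ℂ) →L[ℂ] 𝓢'(FourierBanach.E d, ℂ),
      FourierBanach.ExtendsOp a A) ∧
    ∀ OpA : 𝓢'(FourierBanach.E d, ℂ) →L[ℂ] 𝓢'(FourierBanach.E d, ℂ),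
      FourierBanach.ExtendsOp a OpA →
      ∀ f : 𝓢'(FourierBanach.E d, ℂ), IsCompact (Distribution.dsupport f) →
        (∀ Γ₁ Γ₂ : Set (FourierBanach.E d), FourierBanach.IsOpenCone Γ₁ →
          FourierBanach.IsOpenCone Γ₂ → closure Γ₂ \ {0} ⊆ Γ₁ →
          ∀ x y : FourierBanach.E d,
            FourierBanach.seminormFB ι ω Γ₁ x f < ⊤ →
            FourierBanach.seminormFB ι (fun z => ω z / ω₀ z) Γ₂ y (OpA f) < ⊤) ∧
        (∀ x y : FourierBanach.E d,
          FourierBanach.waveFrontFB ι (fun z => ω z / ω₀ z) y (OpA f) ⊆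
            FourierBanach.waveFrontFB ι ω x f) := by
  obtain ⟨M, -, hb⟩ := ha.isAmplitude hρ hω₀.weight
  refine ⟨FourierBanach.existsUnique_extendsOp (hb 0), fun OpA hA f hf =>
    ⟨fun Γ₁ Γ₂ h₁ h₂ hcl x y h => ?_, fun x y => ?_⟩⟩
  · exact FourierBanach.seminormFB_op_lt_top hB hρ hω hω₀.weight ha hA hf h₂.isOpen
      (h₁.isConeSeparated h₂ hcl) h
  · exact FourierBanach.waveFrontFB_op_subset hB hρ hω hω₀.weight ha hA hf x y
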